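/- **Corollary (type $\mathrm{D}$ branching rule).** Let $\mathbb{K}$ be a field of characteristic $0$ and let $n \geqslant 4$. Let $\widetilde{W}_n = \{\pm1\}^n \rtimes \mathfrak{S}_n$ be the Coxeter group of type $\mathrm{B}_n$ (signed permutations), with generators $s_1,\dots,s_{n-1},t_n$, where $s_i$ is the transposition $(i,i+1)$ and $t_n$ is the sign change at $n$. Put $s_n = t_n s_{n-1} t_n$, $t_0 = s_1\cdots s_{n-1}t_ns_{n-1}\cdots s_1$ (the sign change at $1$) and $s_0 = t_0 s_1 t_0$. Let $W_n = \langle s_1,\dots,s_n\rangle$, the Coxeter group of type $\mathrm{D}_n$, and let $H \leqslant W_n$ be one of the subgroups $$W_1W_{n-1} = \langle \{s_0,\dots,s_n\}\setminus\{s_0,s_1\}\rangle, \qquad W_{n-1}W_1 = \langle \{s_0,\dots,s_n\}\setminus\{s_{n-1},s_n\}\rangle,$$ each identified with $W_{n-1}$ by the corresponding isomorphism of Coxeter groups ($s_k\mapsto s_{k+1}$, respectively $s_k \mapsto s_{n-1-k}$, for $1 \leqslant k \leqslant n-1$). For a bipartition $\gamma=(\gamma_1;\gamma_2)$ of $n$,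 i.e. an ordered pair of partitions with $|\gamma_1|+|\gamma_2| = n$, let $[\gamma_1;\gamma_2]$ be the irreducible character of $\widetilde{W}_n$ induced from the character $[\gamma_1]\boxtimes(\varepsilon'\otimes[\gamma_2])$ of $\widetilde{W}_{|\gamma_1|}\times\widetilde{W}_{|\gamma_2|}$; here $[\gamma_i]$ is the irreducible character of $\mathfrak{S}_{|\gamma_i|}$ labelled by $\gamma_i$ (with $[(k)]$ trivial), inflated to $\widetilde{W}_{|\gamma_i|}$, and $\varepsilon'$ is the linear character taking the value $1$ on transpositions and $-1$ on sign changes at one point. Its restriction to $W_n$ is irreducible if $\gamma_1\neq\gamma_2$, and is a sum of two irreducible characters if $\gamma_1=\gamma_2$. An irreducible character of $W_n$ is said to be *labelled by* $\gamma$ if it is a constituent of this restriction. The same convention, with $n-1$ in place of $n$, is used for the irreducible characters of $H \cong W_{n-1}$. For a partition $\alpha = (\alpha_1,\dots,\alpha_k)$ let $I(\alpha)$ be the set of all $d\in\{1,\dots,k\}$ such that $d=k$ or $\alpha_d>\alpha_{d+1}$, and for $d \in I(\alpha)$ let $\alpha^{(d)}$ be the partition obtained from $\alpha$ by replacing $\alpha_d$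 with $\alpha_d-1$ and removing any zero entries. For a bipartition $\gamma$ of $n$ put $$Z(\gamma)=\{(\gamma_1^{(d)};\gamma_2),(\gamma_2;\gamma_1^{(d)}) \mid d\in I(\gamma_1)\}\cup\{(\gamma_1;\gamma_2^{(d)}),(\gamma_2^{(d)};\gamma_1) \mid d\in I(\gamma_2)\}.$$ Then for any bipartition $\gamma$ of $n$, any bipartition $\beta$ of $n-1$, any irreducible character $X$ of $W_n$ over $\mathbb{K}$ labelled by $\gamma$ and any irreducible character $B$ of $H$ over $\mathbb{K}$ labelled by $\beta$, $$\langle \mathrm{Res}^{W_n}_H(X), B\rangle_H = \begin{cases} 1 & \text{if } \beta\in Z(\gamma),\\ 0 & \text{if } \beta\notin Z(\gamma),\end{cases}$$ where $\langle\chi,\psi\rangle_H = \dim_{\mathbb{K}}\mathrm{Hom}_{\mathbb{K}H}(M_\chi,M_\psi)$ for $\mathbb{K}H$-modules $M_\chi$, $M_\psi$ affording $\chi$, $\psi$. -/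

import Mathlib

open Equiv

/-! ## Signed permutations: the Coxeter group of type `B_n` -/

/-- The group of signed permutations of `n` points, i.e. `{±1}ⁿ ⋊ 𝔖_n`; this is the Coxeter group
of type `B_n`. The pair `(x, σ)` sends the basis vector `e_i` to `x (σ i) • e_{σ i}`. -/
abbrev HypOct (n : ℕ) : Type :=
  (Fin n → ℤˣ) ⋊[(mulAutArrow : Perm (Fin n) →* MulAut (Fin n → ℤˣ))] Perm (Fin n)

namespace HypOct

/-- `s_k` for `1 ≤ k < n`: the transposition of the points number `k` and `k + 1`
(points are numbered from `1`; point number `k` is the element `k - 1` of `Fin n`). -/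
def s (n k : ℕ) : HypOct n :=
  if h : 0 < k ∧ k < n then
    SemidirectProduct.inr (swap (⟨k - 1, by omega⟩ : Fin n) ⟨k, h.2⟩)
  else 1

/-- The sign change at point number `k`, for `1 ≤ k ≤ n`. The Coxeter generators of type `B_n` are
`s_1, …, s_{n-1}, t_n = t n n`. -/
def t (n k : ℕ) : HypOct n :=
  if h : 0 < k ∧ k ≤ n then
    SemidirectProduct.inl (Pi.mulSingle (⟨k - 1, by omega⟩ : Fin n) (-1 : ℤˣ))
  else 1

theorem s_eq {n k : ℕ} (h0 : 0 < k) (h1 : k < n) :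
    s n k = SemidirectProduct.inr (swap (⟨k - 1, by omega⟩ : Fin n) ⟨k, h1⟩) := by
  rw [s, dif_pos ⟨h0, h1⟩]

theorem t_eq {n k : ℕ} (h0 : 0 < k) (h1 : k ≤ n) :
    t n k = SemidirectProduct.inl (Pi.mulSingle (⟨k - 1, by omega⟩ : Fin n) (-1 : ℤˣ)) := by
  rw [t, dif_pos ⟨h0, h1⟩]

theorem s_mul_self (n k : ℕ) : s n k * s n k = 1 := by
  by_cases h : 0 < k ∧ k < n
  · rw [s_eq h.1 h.2, ← map_mul, swap_mul_self, map_one]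
  · simp [s, h]

theorem t_mul_self (n k : ℕ) : t n k * t n k = 1 := by
  by_cases h : 0 < k ∧ k ≤ n
  · rw [t_eq h.1 h.2, ← map_mul, ← Pi.mulSingle_mul]; simp
  · simp [t, h]

theorem inr_mul_inl_mulSingle {n : ℕ} (σ : Perm (Fin n)) (i : Fin n) :
    (SemidirectProduct.inr σ * SemidirectProduct.inl (Pi.mulSingle i (-1 : ℤˣ)) : HypOct n)
      = SemidirectProduct.inl (Pi.mulSingle (σ i) (-1 : ℤˣ)) * SemidirectProduct.inr σ := by
  apply SemidirectProduct.ext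
  · funext j
    simp only [SemidirectProduct.mul_left, SemidirectProduct.left_inr, SemidirectProduct.right_inr,
      SemidirectProduct.left_inl, SemidirectProduct.right_inl, map_one, mul_one, one_mul]
    change (Pi.mulSingle i (-1 : ℤˣ) : Fin n → ℤˣ) (σ⁻¹ j) = _
    by_cases hj : j = σ i
    · subst hj; simp
    · rw [Pi.mulSingle_eq_of_ne hj, Pi.mulSingle_eq_of_ne]
      rintro h; apply hj; rw [← h]; simp
  · simp

/-- The relation `t_k = s_k t_{k+1} s_k`. Iterating it shows that the sign change at the first
point is `t_0 = s_1 ⋯ s_{n-1} t_n s_{n-1} ⋯ s_1`. -/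
theorem t_eq_conj {n k : ℕ} (h0 : 0 < k) (h1 : k < n) :
    t n k = s n k * t n (k + 1) * s n k := by
  rw [s_eq h0 h1, t_eq h0 h1.le, t_eq (Nat.succ_pos k) h1, inr_mul_inl_mulSingle, mul_assoc,
    ← map_mul, swap_mul_self, map_one, mul_one]
  congr 2
  simp

/-- The nodes `s_0, s_1, …, s_n` of the extended Coxeter diagram of type `D_n` (for `n ≥ 4`):
`s_0 = t_0 s_1 t_0`, where `t_0 = t n 1`, and `s_n = t_n s_{n-1} t_n`. -/
def gen (n k : ℕ) : HypOct n :=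
  if k = 0 then t n 1 * s n 1 * t n 1
  else if k = n then t n n * s n (n - 1) * t n n
  else s n k

end HypOct

open HypOct

/-! ## The type `D_n` group and its two subgroups of type `D_{n-1}` -/

/-- `W_n = ⟨s_1, …, s_n⟩`, of type `D_n` (trivial for `n ≤ 1`). -/
def W (n : ℕ) : Subgroup (HypOct n) :=
  Subgroup.closure (gen n '' Set.Icc 1 n)

/-- `W_1 W_{n-1} = ⟨{s_0, …, s_n} ∖ {s_0, s_1}⟩`. -/
def WOneW (n : ℕ) : Subgroup (HypOct n) :=
  Subgroup.closure (gen n '' (Set.Icc 0 n \ {0, 1}))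

/-- `W_{n-1} W_1 = ⟨{s_0, …, s_n} ∖ {s_{n-1}, s_n}⟩`. -/
def WWOne (n : ℕ) : Subgroup (HypOct n) :=
  Subgroup.closure (gen n '' (Set.Icc 0 n \ {n - 1, n}))

namespace HypOct

theorem gen_mem_W {n k : ℕ} (h0 : 0 < k) (h1 : k ≤ n) : gen n k ∈ W n :=
  Subgroup.subset_closure ⟨k, ⟨h0, h1⟩, rfl⟩

theorem s_mem_W {n k : ℕ} (h0 : 0 < k) (h1 : k < n) : s n k ∈ W n := by
  have := gen_mem_W h0 h1.le
  rwa [gen, if_neg h0.ne', if_neg h1.ne] at this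

/-- Conjugation by any sign change preserves `W_n`. -/
theorem t_conj_mem_W {n k : ℕ} (h0 : 0 < k) (h1 : k ≤ n) {w : HypOct n} (hw : w ∈ W n) :
    t n k * w * t n k ∈ W n := by
  obtain ⟨d, hd⟩ := Nat.exists_eq_add_of_le h1
  induction d generalizing k w with
  | zero =>
    obtain rfl : n = k := by omega
    have inv : (t n n)⁻¹ = t n n := inv_eq_of_mul_eq_one_left (t_mul_self n n)
    have key : W n ≤ (W n).comap (MulAut.conj (t n n)).toMonoidHom := by
      rw [W, Subgroup.closure_le]
      rintro _ ⟨j, ⟨hj0, hj1⟩, rfl⟩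
      change t n n * gen n j * (t n n)⁻¹ ∈ W n
      rw [inv]
      by_cases hjn : j = n
      · subst hjn
        rw [gen, if_neg (by omega), if_pos rfl]
        have : t j j * (t j j * s j (j - 1) * t j j) * t j j = s j (j - 1) := by
          calc _ = (t j j * t j j) * s j (j - 1) * (t j j * t j j) := by group
            _ = _ := by rw [t_mul_self, one_mul, mul_one]
        rw [this]
        by_cases hj : j - 1 = 0
        · rw [hj, s, dif_neg (by omega)]; exact one_mem _
        · exact s_mem_W (by omega) (by omega)
      · rw [gen, if_neg (by omega), if_neg hjn]
        by_cases hjn' : j = n - 1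
        · subst hjn'
          have := gen_mem_W (n := n) (k := n) (by omega) le_rfl
          rwa [gen, if_neg (by omega), if_pos rfl] at this
        · have hc : s n j * t n n = t n n * s n j := by
            rw [s_eq (by omega) (by omega), t_eq (by omega) le_rfl, inr_mul_inl_mulSingle]
            rw [swap_apply_of_ne_of_ne] <;> (intro h; rw [Fin.mk.injEq] at h; omega)
          rw [← hc, mul_assoc, t_mul_self, mul_one]
          exact s_mem_W (by omega) (by omega)
    have := key hw
    change t n n * w * (t n n)⁻¹ ∈ W n at this
    rwa [inv] at this
  | succ d ih =>
    have hj : k < n := by omega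
    rw [t_eq_conj h0 hj]
    have hs := s_mem_W h0 hj
    have := ih (k := k + 1) (by omega) (by omega) (W n |>.mul_mem (W n |>.mul_mem hs hw) hs) (by omega)
    have := W n |>.mul_mem (W n |>.mul_mem hs this) hs
    convert this using 1
    group

theorem gen_zero_mem_W {n : ℕ} (hn : 2 ≤ n) : gen n 0 ∈ W n := by
  rw [gen, if_pos rfl]
  exact t_conj_mem_W one_pos (by omega) (s_mem_W one_pos (by omega))

end HypOct

theorem WOneW_le_W {n : ℕ} : WOneW n ≤ W n := by
  rw [WOneW, Subgroup.closure_le]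
  rintro _ ⟨k, ⟨⟨_, hk⟩, hk'⟩, rfl⟩
  simp only [Set.mem_insert_iff, Set.mem_singleton_iff, not_or] at hk'
  exact gen_mem_W (by omega) hk

theorem WWOne_le_W {n : ℕ} (hn : 2 ≤ n) : WWOne n ≤ W n := by
  rw [WWOne, Subgroup.closure_le]
  rintro _ ⟨k, ⟨⟨_, hk⟩, hk'⟩, rfl⟩
  by_cases h : k = 0
  · subst h; exact gen_zero_mem_W hn
  · exact gen_mem_W (by omega) hk

/-! ## Embeddings of signed permutation groups -/

namespace HypOct

theorem extend_comp_perm {m n : ℕ} (f : Fin m ↪ Fin n) (σ : Perm (Fin m)) (x : Fin m → ℤˣ) :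
    Function.extend f (fun i => x (σ⁻¹ i)) 1
      = fun j => Function.extend f x 1 ((σ.viaEmbedding f)⁻¹ j) := by
  funext j
  by_cases hj : ∃ i, f i = j
  · obtain ⟨i, rfl⟩ := hj
    have : (σ.viaEmbedding f)⁻¹ (f i) = f (σ⁻¹ i) := by
      rw [Perm.inv_eq_iff_eq, Perm.viaEmbedding_apply]; simp
    rw [this, f.injective.extend_apply, f.injective.extend_apply]
  · have : (σ.viaEmbedding f)⁻¹ j = j := by
      rw [Perm.inv_eq_iff_eq, Perm.viaEmbedding_apply_of_notMem]
      rintro ⟨i, hi⟩; exact hj ⟨i, hi⟩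
    rw [this, Function.extend_apply' _ _ _ hj, Function.extend_apply' _ _ _ hj]

/-- The embedding of signed permutation groups induced by an injection of the points: act
through `f` on the image of `f` and trivially on all other points. -/
noncomputable def emb {m n : ℕ} (f : Fin m ↪ Fin n) : HypOct m →* HypOct n :=
  SemidirectProduct.map (Function.ExtendByOne.hom ℤˣ f) (Perm.viaEmbeddingHom f) (by
    intro σ
    apply MonoidHom.ext
    intro x
    exact extend_comp_perm f σ x)

theorem emb_left {m n : ℕ} (f : Fin m ↪ Fin n) (g : HypOct m) :
    (emb f g).left = Function.extend f g.left 1 := rfl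

theorem emb_right {m n : ℕ} (f : Fin m ↪ Fin n) (g : HypOct m) :
    (emb f g).right = g.right.viaEmbedding f := rfl

theorem emb_injective {m n : ℕ} (f : Fin m ↪ Fin n) : Function.Injective (emb f) := by
  intro g h hgh
  apply SemidirectProduct.ext
  · have := congrArg SemidirectProduct.left hgh
    rw [emb_left, emb_left] at this
    funext i
    simpa [f.injective.extend_apply] using congrFun this (f i)
  · exact Perm.viaEmbeddingHom_injective f (congrArg SemidirectProduct.right hgh)

theorem emb_inr_swap {m n : ℕ} (f : Fin m ↪ Fin n) (i j : Fin m) :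
    emb f (SemidirectProduct.inr (swap i j)) = SemidirectProduct.inr (swap (f i) (f j)) := by
  rw [emb, SemidirectProduct.map_inr, Perm.viaEmbeddingHom_apply]
  congr 1
  ext1 k
  by_cases hk : ∃ l, f l = k
  · obtain ⟨l, rfl⟩ := hk
    rw [Perm.viaEmbedding_apply, f.injective.map_swap]
  · rw [Perm.viaEmbedding_apply_of_notMem, swap_apply_of_ne_of_ne]
    · rintro rfl; exact hk ⟨_, rfl⟩
    · rintro rfl; exact hk ⟨_, rfl⟩
    · rintro ⟨l, hl⟩; exact hk ⟨l, hl⟩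

theorem emb_inl_mulSingle {m n : ℕ} (f : Fin m ↪ Fin n) (i : Fin m) :
    emb f (SemidirectProduct.inl (Pi.mulSingle i (-1 : ℤˣ)))
      = SemidirectProduct.inl (Pi.mulSingle (f i) (-1 : ℤˣ)) := by
  rw [emb, SemidirectProduct.map_inl]
  congr 1
  funext k
  change Function.extend f _ 1 k = _
  by_cases hk : ∃ l, f l = k
  · obtain ⟨l, rfl⟩ := hk
    rw [f.injective.extend_apply]
    by_cases h : l = i
    · subst h; simp
    · rw [Pi.mulSingle_eq_of_ne h, Pi.mulSingle_eq_of_ne (f.injective.ne h)]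
  · rw [Function.extend_apply' _ _ _ hk, Pi.mulSingle_eq_of_ne]
    · rfl
    · rintro rfl; exact hk ⟨_, rfl⟩

theorem emb_commute {a b n : ℕ} (f : Fin a ↪ Fin n) (g : Fin b ↪ Fin n)
    (hfg : ∀ i j, f i ≠ g j) (x : HypOct a) (y : HypOct b) : Commute (emb f x) (emb g y) := by
  have hx : ∀ (σ : Perm (Fin a)) (j : Fin b), σ.viaEmbedding f (g j) = g j := fun σ j =>
    Perm.viaEmbedding_apply_of_notMem _ _ _ (by rintro ⟨i, hi⟩; exact hfg i j hi)
  have hy : ∀ (σ : Perm (Fin b)) (i : Fin a), σ.viaEmbedding g (f i) = f i := fun σ i =>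
    Perm.viaEmbedding_apply_of_notMem _ _ _ (by rintro ⟨j, hj⟩; exact hfg i j hj.symm)
  have hd : Perm.Disjoint (x.right.viaEmbedding f) (y.right.viaEmbedding g) := by
    intro k
    by_cases hk : ∃ i, f i = k
    · obtain ⟨i, rfl⟩ := hk; right; exact hy _ _
    · left; exact Perm.viaEmbedding_apply_of_notMem _ _ _ (by rintro ⟨i, hi⟩; exact hk ⟨i, hi⟩)
  have e1 : (fun j => Function.extend g y.left 1 ((x.right.viaEmbedding f)⁻¹ j))
      = Function.extend g y.left 1 := by
    funext k
    by_cases hk : ∃ j, g j = k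
    · obtain ⟨j, rfl⟩ := hk
      rw [Perm.inv_eq_iff_eq.mpr (hx x.right j).symm]
    · rw [Function.extend_apply' _ _ _ hk, Function.extend_apply']
      · rfl
      rintro ⟨j, hj⟩
      rw [Perm.eq_inv_iff_eq, hx] at hj
      exact hk ⟨j, hj⟩
  have e2 : (fun j => Function.extend f x.left 1 ((y.right.viaEmbedding g)⁻¹ j))
      = Function.extend f x.left 1 := by
    funext k
    by_cases hk : ∃ j, f j = k
    · obtain ⟨j, rfl⟩ := hk
      rw [Perm.inv_eq_iff_eq.mpr (hy y.right j).symm]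
    · rw [Function.extend_apply' _ _ _ hk, Function.extend_apply']
      · rfl
      rintro ⟨j, hj⟩
      rw [Perm.eq_inv_iff_eq, hy] at hj
      exact hk ⟨j, hj⟩
  apply SemidirectProduct.ext
  · change Function.extend f x.left 1
        * (fun j => Function.extend g y.left 1 ((x.right.viaEmbedding f)⁻¹ j))
      = Function.extend g y.left 1
        * (fun j => Function.extend f x.left 1 ((y.right.viaEmbedding g)⁻¹ j))
    rw [e1, e2, mul_comm]
  · exact hd.commute

/-- The homomorphism `(x, y) ↦ x y` from the product of the groups of type `B_a` and `B_b` into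
the group of type `B_{a+b}`, where the first factor acts on the first `a` points and the second
factor on the last `b` points. -/
noncomputable def prodHom {a b n : ℕ} (h : a + b = n) : HypOct a × HypOct b →* HypOct n :=
  MonoidHom.noncommCoprod
    (emb ((Fin.castAddEmb b).trans (finCongr h).toEmbedding))
    (emb ((Fin.natAddEmb a).trans (finCongr h).toEmbedding))
    (emb_commute _ _ (by
      intro i j hij
      have := congrArg Fin.val hij
      simp at this
      omega))

/-- `emb` along `i ↦ i + 1` sends the generator `s_k` of `W_m` to the generator `s_{k+1}`. -/
theorem emb_succ_gen {m k : ℕ} (hm : 2 ≤ m) (h0 : 0 < k) (h1 : k ≤ m) :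
    emb (Fin.succEmb m) (gen m k) = gen (m + 1) (k + 1) := by
  by_cases hk : k = m
  · subst hk
    rw [gen, if_neg (by omega), if_pos rfl, gen, if_neg (by omega), if_pos rfl, map_mul, map_mul,
      t_eq h0 le_rfl, s_eq (by omega) (by omega), emb_inl_mulSingle, emb_inr_swap,
      t_eq (by omega) le_rfl, s_eq (by omega) (by omega)]
    congr 4 <;> (apply Fin.ext; simp; try omega)
  · rw [gen, if_neg (by omega), if_neg hk, gen, if_neg (by omega), if_neg (by omega),
      s_eq h0 (by omega), emb_inr_swap, s_eq (by omega) (by omega)]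
    congr 2; apply Fin.ext; simp; omega

/-- The injection `i ↦ m - 1 - i` of the points, written from `0`. -/
def revEmb (m : ℕ) : Fin m ↪ Fin (m + 1) :=
  ⟨fun i => (Fin.rev i).castSucc, fun i j h => by simpa using h⟩

theorem revEmb_mk {m i : ℕ} (h : i < m) : revEmb m ⟨i, h⟩ = ⟨m - 1 - i, by omega⟩ := by
  apply Fin.ext
  change m - (i + 1) = m - 1 - i
  omega

/-- `emb` along `revEmb` sends the generator `s_k` of `W_m` to `s_{m-k}`. -/
theorem emb_rev_gen {m k : ℕ} (hm : 2 ≤ m) (h0 : 0 < k) (h1 : k ≤ m) :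
    emb (revEmb m) (gen m k) = gen (m + 1) (m - k) := by
  by_cases hk : k = m
  · subst hk
    rw [gen, if_neg (by omega), if_pos rfl, gen, if_pos (by omega), map_mul, map_mul,
      t_eq h0 le_rfl, s_eq (by omega) (by omega), emb_inl_mulSingle, emb_inr_swap,
      t_eq (by omega) (by omega), s_eq (by omega) (by omega), revEmb_mk, revEmb_mk, swap_comm]
    congr 4 <;> (first | (apply Fin.ext; simp; try omega) | omega)
  · rw [gen, if_neg (by omega), if_neg hk, gen, if_neg (by omega), if_neg (by omega),
      s_eq h0 (by omega), emb_inr_swap, s_eq (by omega) (by omega), revEmb_mk, revEmb_mk, swap_comm]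
    congr 2 <;> (apply Fin.ext; simp; try omega)

theorem map_succ_W {m : ℕ} (hm : 2 ≤ m) :
    (W m).map (emb (Fin.succEmb m)) = WOneW (m + 1) := by
  rw [W, MonoidHom.map_closure, WOneW]
  congr 1
  ext x
  constructor
  · rintro ⟨_, ⟨k, ⟨h0, h1⟩, rfl⟩, rfl⟩
    refine ⟨k + 1, ⟨⟨by omega, by omega⟩, ?_⟩, (emb_succ_gen hm (by omega) h1).symm⟩
    simp; omega
  · rintro ⟨k, ⟨⟨_, h1⟩, hk⟩, rfl⟩
    simp only [Set.mem_insert_iff, Set.mem_singleton_iff, not_or] at hk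
    refine ⟨_, ⟨k - 1, ⟨by omega, by omega⟩, rfl⟩, ?_⟩
    rw [emb_succ_gen hm (by omega) (by omega)]
    congr 1; omega

theorem map_rev_W {m : ℕ} (hm : 2 ≤ m) :
    (W m).map (emb (revEmb m)) = WWOne (m + 1) := by
  rw [W, MonoidHom.map_closure, WWOne]
  congr 1
  ext x
  constructor
  · rintro ⟨_, ⟨k, ⟨h0, h1⟩, rfl⟩, rfl⟩
    refine ⟨m - k, ⟨⟨by omega, by omega⟩, ?_⟩, (emb_rev_gen hm (by omega) h1).symm⟩
    simp; omega
  · rintro ⟨k, ⟨⟨_, h1⟩, hk⟩, rfl⟩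
    simp only [Set.mem_insert_iff, Set.mem_singleton_iff, not_or] at hk
    refine ⟨_, ⟨m - k, ⟨by omega, by omega⟩, rfl⟩, ?_⟩
    rw [emb_rev_gen hm (by omega) (by omega)]
    congr 1; omega

end HypOct

/-- The isomorphism `W_{n-1} ≅ W_1 W_{n-1}`, `s_k ↦ s_{k+1}` (with `n = m + 1`). -/
noncomputable def isoWOneW {m : ℕ} (hm : 2 ≤ m) : W m ≃* WOneW (m + 1) :=
  ((W m).equivMapOfInjective (emb (Fin.succEmb m)) (emb_injective _)).trans
    (MulEquiv.subgroupCongr (map_succ_W hm))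

/-- The isomorphism `W_{n-1} ≅ W_{n-1} W_1`, `s_k ↦ s_{n-1-k}` (with `n = m + 1`). It is the
restriction of the isomorphism `s_k ↦ s_{n-1-k}`, `t_{n-1} ↦ t_0` of groups of type `B_{n-1}`. -/
noncomputable def isoWWOne {m : ℕ} (hm : 2 ≤ m) : W m ≃* WWOne (m + 1) :=
  ((W m).equivMapOfInjective (emb (revEmb m)) (emb_injective _)).trans
    (MulEquiv.subgroupCongr (map_rev_W hm))

/-! ## Irreducible representations of the symmetric groups -/

section Specht

variable (K : Type*) [Field K] {μ : YoungDiagram} {k : ℕ}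

/-- The row stabilizer of a tableau `T` of shape `μ` (a bijective filling of the boxes). -/
def rowStab (T : Fin k ≃ μ.cells) : Subgroup (Perm (Fin k)) where
  carrier := {σ | ∀ i, (T (σ i)).1.1 = (T i).1.1}
  one_mem' := fun _ => rfl
  mul_mem' := fun {σ τ} hσ hτ i => (hσ (τ i)).trans (hτ i)
  inv_mem' := fun {σ} hσ i => by simpa using (hσ (σ⁻¹ i)).symm

/-- The column stabilizer of a tableau `T` of shape `μ`. -/
def colStab (T : Fin k ≃ μ.cells) : Subgroup (Perm (Fin k)) where
  carrier := {σ | ∀ i, (T (σ i)).1.2 = (T i).1.2}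
  one_mem' := fun _ => rfl
  mul_mem' := fun {σ τ} hσ hτ i => (hσ (τ i)).trans (hτ i)
  inv_mem' := fun {σ} hσ i => by simpa using (hσ (σ⁻¹ i)).symm

open Classical in
/-- The Young symmetrizer of `T`: the signed sum over the column stabilizer times the sum over the
row stabilizer. -/
noncomputable def youngSymmetrizer (T : Fin k ≃ μ.cells) : MonoidAlgebra K (Perm (Fin k)) :=
  (∑ σ ∈ Finset.univ.filter (· ∈ colStab T),
      MonoidAlgebra.single σ ((Perm.sign σ : ℤ) : K)) *
    ∑ σ ∈ Finset.univ.filter (· ∈ rowStab T), MonoidAlgebra.single σ (1 : K)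

/-- The left ideal of the group algebra generated by the Young symmetrizer of `T`, as a
subrepresentation of the left regular representation. -/
noncomputable def spechtSub (T : Fin k ≃ μ.cells) :
    Subrepresentation (Representation.leftRegular K (Perm (Fin k))) where
  toSubmodule := Submodule.span K
    (Set.range fun g => Representation.leftRegular K (Perm (Fin k)) g (youngSymmetrizer K T))
  apply_mem_toSubmodule := by
    intro g v hv
    induction hv using Submodule.span_induction with
    | mem x hx =>
      obtain ⟨h, rfl⟩ := hx
      refine Submodule.subset_span ⟨g * h, ?_⟩
      simp only [map_mul, Module.End.mul_apply]
    | zero => rw [map_zero]; exact Submodule.zero_mem _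
    | add x y _ _ hx hy => rw [map_add]; exact Submodule.add_mem _ hx hy
    | smul a x _ hx => rw [map_smul]; exact Submodule.smul_mem _ a hx

variable (μ)

/-- A tableau of shape `μ`; the choice does not matter up to isomorphism of representations. -/
noncomputable def someTableau : Fin μ.card ≃ μ.cells := μ.cells.equivFin.symm

/-- The space of the irreducible representation `[μ]` of the symmetric group. -/
def SpechtV : Type _ := (spechtSub K (someTableau μ)).toSubmodule

noncomputable instance : AddCommGroup (SpechtV K μ) :=
  inferInstanceAs (AddCommGroup (spechtSub K (someTableau μ)).toSubmodule)

noncomputable instance : Module K (SpechtV K μ) :=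
  inferInstanceAs (Module K (spechtSub K (someTableau μ)).toSubmodule)

/-- The irreducible representation `[μ]` of the symmetric group labelled by the partition `μ`
(`(k)` labels the trivial representation and `(1, …, 1)` the sign). -/
noncomputable def specht : Representation K (Perm (Fin μ.card)) (SpechtV K μ) :=
  (spechtSub K (someTableau μ)).toRepresentation

end Specht

/-! ## Bipartitions and the irreducible representations of type `B_n` -/

/-- Bipartitions of `n`: ordered pairs of partitions (as Young diagrams) of total size `n`. -/
@[ext] structure Bipartition (n : ℕ) where
  fst : YoungDiagram
  snd : YoungDiagram
  card_add : fst.card + snd.card = n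

/-- The representation `g ↦ χ g • ρ g`, for a sign-valued linear character `χ`. -/
noncomputable def Representation.signTwist {K G V : Type*} [Field K] [Group G] [AddCommGroup V]
    [Module K V] (χ : G →* ℤˣ) (ρ : Representation K G V) : Representation K G V where
  toFun g := (((χ g : ℤˣ) : ℤ) : K) • ρ g
  map_one' := by simp
  map_mul' g h := by
    ext v
    simp only [map_mul, Units.val_mul, Int.cast_mul, LinearMap.smul_apply, Module.End.mul_apply,
      map_smul, mul_smul]
    exact smul_comm _ _ _

/-- The outer tensor product `ρ ⊠ σ`. -/
noncomputable def Representation.boxTensor {K G H V U : Type*} [Field K] [Group G] [Group H]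
    [AddCommGroup V] [Module K V] [AddCommGroup U] [Module K U]
    (ρ : Representation K G V) (σ : Representation K H U) :
    Representation K (G × H) (TensorProduct K V U) :=
  Representation.tprod (ρ.comp (MonoidHom.fst G H)) (σ.comp (MonoidHom.snd G H))

/-- The linear character of the type `B_n` group with `s_i ↦ 1` and `t_n ↦ -1`. -/
def HypOct.signProd (n : ℕ) : HypOct n →* ℤˣ where
  toFun g := ∏ i, g.left i
  map_one' := by simp
  map_mul' g h := by
    rw [SemidirectProduct.mul_left]
    simp only [Pi.mul_apply, Finset.prod_mul_distrib]
    congr 1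
    exact Equiv.prod_comp (g.right⁻¹ : Perm (Fin n)) h.left

section TypeB

variable (K : Type*) [Field K] {n : ℕ} (γ : Bipartition n)

/-- The inflation of `[μ]` from the symmetric group to the type `B` group. -/
noncomputable def inflate (μ : YoungDiagram) :
    Representation K (HypOct μ.card) (SpechtV K μ) :=
  (specht K μ).comp SemidirectProduct.rightHom

/-- The representation of the type `B` group affording `[γ₁; γ₂]` is induced from
`[γ₁] ⊠ (ε' ⊗ [γ₂])`, where `[γ_i]` is inflated from the symmetric group to the type `B` group and
`ε'` is the linear character `s_i ↦ 1`, `t ↦ -1`. -/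
noncomputable def typeBInner :
    Representation K (HypOct γ.fst.card × HypOct γ.snd.card)
      (TensorProduct K (SpechtV K γ.fst) (SpechtV K γ.snd)) :=
  (inflate K γ.fst).boxTensor (Representation.signTwist (HypOct.signProd γ.snd.card)
    (inflate K γ.snd))

/-- The space of the representation `[γ₁; γ₂]`. -/
abbrev TypeBV : Type _ :=
  Representation.IndV (prodHom γ.card_add) (typeBInner K γ)

/-- The irreducible representation `[γ₁; γ₂]` of the type `B_n` group: the representation induced
from `[γ₁] ⊠ (ε' ⊗ [γ₂])` on the product of the groups of types `B_{|γ₁|}` and `B_{|γ₂|}`. -/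
noncomputable def typeB : Representation K (HypOct n) (TypeBV K γ) :=
  Representation.ind (prodHom γ.card_add) (typeBInner K γ)

end TypeB

/-- `X` is an irreducible representation of `W_n` labelled by `γ`, i.e. its character is
`[γ₁; γ₂]` restricted to `W_n` if `γ₁ ≠ γ₂`, and one of the two irreducible constituents
`[γ₁; γ₁]_±` of this restriction if `γ₁ = γ₂`: `X` is an irreducible constituent of the
restriction of `[γ₁; γ₂]` to `W_n`. -/
def IsLabelledBy {K V : Type*} [Field K] [AddCommGroup V] [Module K V] {n : ℕ}
    (X : Representation K (W n) V) (γ : Bipartition n) : Prop :=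
  X.IsIrreducible ∧
    ∃ f : Representation.IntertwiningMap X ((typeB K γ).comp (W n).subtype), f ≠ 0

/-! ## Removal of boxes -/

namespace YoungDiagram

/-- The set `I(μ)` of all (indices of) rows of `μ` that are longer than the next row (rows beyond
the last one have length `0`; rows are indexed from `0`). -/
def removableRows (μ : YoungDiagram) : Set ℕ := {d | μ.rowLen (d + 1) < μ.rowLen d}

/-- `μ^(d)`: the last box of row `d` is removed. -/
def removeBox (μ : YoungDiagram) (d : ℕ) (hd : d ∈ μ.removableRows) : YoungDiagram where
  cells := μ.cells.erase (d, μ.rowLen d - 1)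
  isLowerSet := by
    rintro ⟨i, j⟩ ⟨i', j'⟩ hle hmem
    simp only [Finset.coe_erase, Set.mem_sdiff, Finset.mem_coe, mem_cells,
      Set.mem_singleton_iff, Prod.mk.injEq] at hmem ⊢
    obtain ⟨hi, hj⟩ : i' ≤ i ∧ j' ≤ j := hle
    refine ⟨μ.up_left_mem hi hj hmem.1, ?_⟩
    rintro ⟨rfl, rfl⟩
    have h1 := hmem.1
    rw [mem_iff_lt_rowLen] at h1
    have hd' : μ.rowLen (i' + 1) < μ.rowLen i' := hd
    rcases Nat.eq_or_lt_of_le hi with rfl | hlt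
    · exact hmem.2 ⟨rfl, by omega⟩
    · have := μ.rowLen_anti (i' + 1) i hlt
      omega

end YoungDiagram

/-- The set `Z(γ)` of bipartitions obtained by removing one box from `γ₁` or `γ₂`, in either order
of the resulting pair. -/
def Bipartition.Z {m : ℕ} (γ : Bipartition (m + 1)) : Set (Bipartition m) :=
  {β | (∃ d, ∃ hd : d ∈ γ.fst.removableRows,
          (β.fst = γ.fst.removeBox d hd ∧ β.snd = γ.snd) ∨
          (β.fst = γ.snd ∧ β.snd = γ.fst.removeBox d hd)) ∨
       (∃ d, ∃ hd : d ∈ γ.snd.removableRows,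
          (β.fst = γ.fst ∧ β.snd = γ.snd.removeBox d hd) ∨
          (β.fst = γ.snd.removeBox d hd ∧ β.snd = γ.fst))}

/-!
Hom spaces are computed by characters: over a field of characteristic zero the dimension `homDim ρ σ`
of the space of intertwining maps depends only on the two characters and is additive in them. In
particular no splitting field is needed: a representation is irreducible as soon as
`homDim ρ ρ = 1`.

*Symmetric groups.* The left ideals generated by Young symmetrizers are irreducible and pairwise
non-isomorphic (`homDim_spechtRep_self`, `homDim_spechtRep_of_ne`). If `ν` arises from `μ` by removing
a box, then `[ν]` occurs in the restriction of `[μ]`, because restricting functions on the larger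
symmetric group to the smaller one maps one Young symmetrizer to the other
(`homDim_spechtRep_restrict_ne_zero`). Writing `f_μ` for the degree of `[μ]`, this gives
`∑ f_ν ≤ f_μ` over the diagrams `ν` below `μ` and, by Frobenius reciprocity,
`∑ f_μ ≤ (|ν| + 1) f_ν` over the diagrams `μ` above `ν`. The commutation relation between adding and
removing boxes forces equality in both (`YoungDiagram.sum_down_eq_of_le`).

*Type `B`.* The sign changes act on the inducing subspace of `[γ₁; γ₂]` through a character whose
stabilizer in the type `B` group is the inducing subgroup, so that the endomorphisms of the induced
representation are those of the inducing one, and the `[γ₁; γ₂]` are irreducible and pairwise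
non-isomorphic (`homDim_typeB`). A bipartition obtained from `γ` by removing a box labels a
constituent of the restriction of `[γ]`, and by the degree formula these constituents exhaust the
restriction (`sum_finrank_toBip`). Hence the restriction is multiplicity free (`homDim_typeB_emb`).

*Type `D`.* The group `W_n` is the kernel of the linear character `signProd`, which exchanges the two
components of a bipartition (`character_typeB_swap`). So `[γ]` stays irreducible on `W_n` if the
components differ. If they agree, then an involution which commutes with `W_n` and anticommutes with
sign changes (`exists_involution`) shows that `[γ]` becomes reducible, and by Clifford theory it is
the sum of any constituent and its conjugate under a sign change
(`character_add_character_conj`). A sign change at the point missed by an embedding of `W_{n-1}`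
centralizes the embedded group, so conjugate constituents have the same restriction. Therefore
`4 ⟨X, B⟩` is the product of `⟨[γ], [β]⟩ + ⟨[γ], [β₂; β₁]⟩`, computed for type `B`, with a factor `1`
or `2` for each of `γ` and `β`, according to whether the components agree or differ
(`Bipartition.mul_ite_add_ite`).

Both subgroups are images of `W_{n-1}` under `emb f` for an injection `f` of the points, and the
multiplicity does not depend on `f`, since different injections give conjugate embeddings of type `B`
groups.
-/

/-! ### Hom spaces and characters -/

namespace Representation

section General

variable {K G H : Type*} [Field K] [Group G] [Group H]
  {V W U : Type*} [AddCommGroup V] [Module K V] [AddCommGroup W] [Module K W]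
  [AddCommGroup U] [Module K U]

/-- The dimension of the space of intertwining maps from `ρ` to `σ`. -/
noncomputable def homDim (ρ : Representation K G V) (σ : Representation K G W) : ℕ :=
  Module.finrank K (IntertwiningMap ρ σ)

variable [FiniteDimensional K V] [FiniteDimensional K W] [FiniteDimensional K U]

section Hom

variable {ρ : Representation K G V} {σ : Representation K G W}

theorem homDim_ne_zero_iff : homDim ρ σ ≠ 0 ↔ ∃ f : IntertwiningMap ρ σ, f ≠ 0 := by
  rw [homDim, ← Nat.pos_iff_ne_zero, Module.finrank_pos_iff, nontrivial_iff_exists_ne 0]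

theorem homDim_eq_zero_iff : homDim ρ σ = 0 ↔ ∀ f : IntertwiningMap ρ σ, f = 0 := by
  rw [← not_iff_not, ← ne_eq, homDim_ne_zero_iff]; simp

end Hom

omit [FiniteDimensional K V] in
theorem homDim_eq_one_of_forall_smul {ρ : Representation K G V} [Nontrivial V]
    (h : ∀ f : IntertwiningMap ρ ρ, ∃ c : K, ∀ v, f v = c • v) : homDim ρ ρ = 1 := by
  rw [homDim, finrank_eq_one_iff_of_nonzero' (IntertwiningMap.id ρ)]
  · intro f
    obtain ⟨c, hc⟩ := h f
    exact ⟨c, IntertwiningMap.ext (LinearMap.ext fun v => by simp [hc])⟩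
  · intro h0
    obtain ⟨v, hv⟩ := exists_ne (0 : V)
    exact hv (by simpa using DFunLike.congr_fun h0 v)

/-- The intertwining map obtained by regarding an intertwining map as one between pull-backs along a
group homomorphism. -/
def IntertwiningMap.pull {ρ : Representation K G V} {σ : Representation K G W} (φ : H →* G)
    (f : IntertwiningMap ρ σ) :
    IntertwiningMap (MonoidHom.comp ρ φ) (MonoidHom.comp σ φ) :=
  ⟨f.toLinearMap, fun h => f.isIntertwining' (φ h)⟩

section Characters

variable [CharZero K] [Finite G]

instance : NeZero (Nat.card G : K) := ⟨Nat.cast_ne_zero.mpr Nat.card_pos.ne'⟩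

theorem card_inv_mul_sum_char [Fintype G] (ρ : Representation K G V) (σ : Representation K G W) :
    (Nat.card G : K)⁻¹ * ∑ g : G, σ.character g * ρ.character g⁻¹ = homDim ρ σ := by
  let _ : Invertible (Nat.card G : K) := invertibleOfNonzero (NeZero.ne _)
  exact card_inv_mul_sum_char_mul_char_eq_finrank ρ σ

theorem homDim_comm (ρ : Representation K G V) (σ : Representation K G W) :
    homDim ρ σ = homDim σ ρ := by
  cases nonempty_fintype G
  apply Nat.cast_injective (R := K)
  rw [← card_inv_mul_sum_char, ← card_inv_mul_sum_char]
  congr 1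
  refine Fintype.sum_equiv (Equiv.inv G) _ _ fun g => ?_
  simp [mul_comm]

theorem homDim_sum_right {ι : Type*} (s : Finset ι) {E : ι → Type*} [∀ i, AddCommGroup (E i)]
    [∀ i, Module K (E i)] [∀ i, FiniteDimensional K (E i)] (τ : ∀ i, Representation K G (E i))
    (ρ : Representation K G V) (σ : Representation K G W)
    (h : ∀ g, σ.character g = ∑ i ∈ s, (τ i).character g) :
    homDim ρ σ = ∑ i ∈ s, homDim ρ (τ i) := by
  cases nonempty_fintype G
  apply Nat.cast_injective (R := K)
  rw [Nat.cast_sum, ← card_inv_mul_sum_char]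
  simp_rw [← card_inv_mul_sum_char, h, ← Finset.mul_sum, Finset.sum_mul]
  rw [Finset.sum_comm]

theorem homDim_sum_left {ι : Type*} (s : Finset ι) {E : ι → Type*} [∀ i, AddCommGroup (E i)]
    [∀ i, Module K (E i)] [∀ i, FiniteDimensional K (E i)] (τ : ∀ i, Representation K G (E i))
    (ρ : Representation K G V) (σ : Representation K G W)
    (h : ∀ g, σ.character g = ∑ i ∈ s, (τ i).character g) :
    homDim σ ρ = ∑ i ∈ s, homDim (τ i) ρ := by
  rw [homDim_comm, homDim_sum_right s τ ρ σ h]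
  exact Finset.sum_congr rfl fun i _ => homDim_comm _ _

theorem homDim_add_right {W₁ W₂ : Type*} [AddCommGroup W₁] [Module K W₁] [AddCommGroup W₂]
    [Module K W₂] [FiniteDimensional K W₁] [FiniteDimensional K W₂]
    (ρ : Representation K G V) {σ : Representation K G W} {σ₁ : Representation K G W₁}
    {σ₂ : Representation K G W₂} (h : ∀ g, σ.character g = σ₁.character g + σ₂.character g) :
    homDim ρ σ = homDim ρ σ₁ + homDim ρ σ₂ := by
  cases nonempty_fintype G
  apply Nat.cast_injective (R := K)
  rw [Nat.cast_add, ← card_inv_mul_sum_char, ← card_inv_mul_sum_char, ← card_inv_mul_sum_char]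
  simp_rw [h, add_mul, Finset.sum_add_distrib, mul_add]

theorem homDim_add_left {W₁ W₂ : Type*} [AddCommGroup W₁] [Module K W₁] [AddCommGroup W₂]
    [Module K W₂] [FiniteDimensional K W₁] [FiniteDimensional K W₂]
    (ρ : Representation K G V) {σ : Representation K G W} {σ₁ : Representation K G W₁}
    {σ₂ : Representation K G W₂} (h : ∀ g, σ.character g = σ₁.character g + σ₂.character g) :
    homDim σ ρ = homDim σ₁ ρ + homDim σ₂ ρ := by
  rw [homDim_comm, homDim_add_right ρ h, homDim_comm ρ, homDim_comm ρ]

theorem homDim_congr {V' W' : Type*} [AddCommGroup V'] [Module K V'] [AddCommGroup W']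
    [Module K W'] [FiniteDimensional K V'] [FiniteDimensional K W']
    {ρ : Representation K G V} {σ : Representation K G W} {ρ' : Representation K G V'}
    {σ' : Representation K G W'} (hρ : ∀ g, ρ.character g = ρ'.character g)
    (hσ : ∀ g, σ.character g = σ'.character g) : homDim ρ σ = homDim ρ' σ' := by
  cases nonempty_fintype G
  apply Nat.cast_injective (R := K)
  rw [← card_inv_mul_sum_char, ← card_inv_mul_sum_char]
  simp_rw [hρ, hσ]

omit [CharZero K] [Finite G] in
theorem character_prod (ρ : Representation K G V) (σ : Representation K G W) (g : G) :
    (ρ.prod σ).character g = ρ.character g + σ.character g :=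
  LinearMap.trace_prodMap' (ρ g) (σ g)

theorem homDim_boxTensor [Finite H] {V' W' : Type*} [AddCommGroup V'] [Module K V']
    [AddCommGroup W'] [Module K W'] [FiniteDimensional K V'] [FiniteDimensional K W']
    (ρ : Representation K G V) (σ : Representation K H W) (ρ' : Representation K G V')
    (σ' : Representation K H W') :
    homDim (ρ.boxTensor σ) (ρ'.boxTensor σ') = homDim ρ ρ' * homDim σ σ' := by
  cases nonempty_fintype G
  cases nonempty_fintype H
  apply Nat.cast_injective (R := K)
  rw [Nat.cast_mul, ← card_inv_mul_sum_char, ← card_inv_mul_sum_char, ← card_inv_mul_sum_char,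
    Fintype.sum_prod_type, Nat.card_prod]
  have h1 : ∀ g h, (ρ.boxTensor σ).character (g, h) = ρ.character g * σ.character h := fun g h => by
    rw [boxTensor, char_tensor]; rfl
  have h2 : ∀ g h, (ρ'.boxTensor σ').character (g, h) = ρ'.character g * σ'.character h :=
    fun g h => by rw [boxTensor, char_tensor]; rfl
  simp_rw [Prod.inv_mk, h1, h2]
  rw [mul_mul_mul_comm, Finset.sum_mul_sum, Nat.cast_mul, mul_inv]
  congr 1
  refine Finset.sum_congr rfl fun g _ => Finset.sum_congr rfl fun h _ => ?_
  ring

omit [FiniteDimensional K V] [FiniteDimensional K W] in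
/-- Maschke's theorem in the form of a splitting of an injective intertwining map. -/
theorem exists_equiv_prod_of_injective {ρ : Representation K G V} {σ : Representation K G W}
    (f : IntertwiningMap ρ σ) (hf : Function.Injective f) :
    ∃ q : Subrepresentation σ, Nonempty ((ρ.prod q.toRepresentation).Equiv σ) := by
  obtain ⟨q, hq⟩ := exists_isCompl f.range
  let F : IntertwiningMap (ρ.prod q.toRepresentation) σ :=
    ⟨f.toLinearMap.coprod q.toSubmodule.subtype, fun g => by
      ext x
      · simp [prod, f.isIntertwining]
      · simp [prod, Subrepresentation.toRepresentation]⟩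
  have hF : ∀ x y, F (x, y) = f x + y := fun x y => rfl
  refine ⟨q, ⟨IntertwiningMap.ofBijective F ⟨?_, ?_⟩⟩⟩
  · refine (injective_iff_map_eq_zero F).mpr ?_
    rintro ⟨x, y, hy⟩ h
    rw [hF] at h
    have hx : f x ∈ f.range ⊓ q := by
      refine ⟨⟨x, rfl⟩, ?_⟩
      rw [eq_neg_of_add_eq_zero_left h]
      exact q.toSubmodule.neg_mem hy
    rw [hq.inf_eq_bot] at hx
    have hx0 : f x = 0 := hx
    have : x = 0 := hf (by rw [hx0, map_zero])
    subst this
    simpa using h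
  · intro w
    have hw : w ∈ f.range ⊔ q := by rw [hq.sup_eq_top]; trivial
    obtain ⟨_, ⟨x, rfl⟩, y, hy, rfl⟩ := (Submodule.mem_sup (p := f.range.toSubmodule)
      (p' := q.toSubmodule)).mp hw
    exact ⟨(x, ⟨y, hy⟩), rfl⟩

omit [CharZero K] [Finite G] in
theorem homDim_self_ne_zero (q : Representation K G V) [Nontrivial V] : homDim q q ≠ 0 := by
  rw [homDim_ne_zero_iff]
  refine ⟨IntertwiningMap.id q, fun h => ?_⟩
  obtain ⟨v, hv⟩ := exists_ne (0 : V)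
  exact hv (by simpa using DFunLike.congr_fun h v)

/-- If an intertwining map `θ` takes a nonzero value in a subrepresentation `q` of its target, then
`q` and the source of `θ` share a constituent. -/
theorem homDim_toRepresentation_ne_zero {ρ : Representation K G V} {σ : Representation K G W}
    (θ : IntertwiningMap ρ σ) (q : Subrepresentation σ) {v : V} (hv : θ v ∈ q) (h0 : θ v ≠ 0) :
    homDim q.toRepresentation ρ ≠ 0 := by
  let P : Subrepresentation ρ :=
    { toSubmodule := q.toSubmodule.comap θ.toLinearMap
      apply_mem_toSubmodule := fun g x hx => by
        change θ (ρ g x) ∈ q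
        rw [θ.isIntertwining]
        exact q.apply_mem_toSubmodule g hx }
  let F : IntertwiningMap P.toRepresentation q.toRepresentation :=
    ⟨(θ.toLinearMap ∘ₗ P.toSubmodule.subtype).codRestrict q.toSubmodule (fun x => x.2), fun g => by
        apply LinearMap.ext
        intro x
        apply Subtype.ext
        exact θ.isIntertwining _ _ g x.1⟩
  have hF : F ≠ 0 := fun h =>
    h0 (congrArg Subtype.val (DFunLike.congr_fun h (⟨v, hv⟩ : P.toSubmodule)))
  have h1 : homDim P.toRepresentation q.toRepresentation ≠ 0 := homDim_ne_zero_iff.mpr ⟨F, hF⟩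
  rw [homDim_comm, homDim_ne_zero_iff] at h1
  obtain ⟨ψ, hψ⟩ := h1
  refine homDim_ne_zero_iff.mpr ⟨⟨P.toSubmodule.subtype ∘ₗ ψ.toLinearMap, fun g => ?_⟩, ?_⟩
  · apply LinearMap.ext
    intro x
    exact congrArg Subtype.val (ψ.isIntertwining _ _ g x)
  · intro h
    apply hψ
    apply IntertwiningMap.ext
    apply LinearMap.ext
    intro x
    apply Subtype.ext
    exact DFunLike.congr_fun h x

/-- A representation with one-dimensional endomorphism algebra is irreducible. -/
theorem isIrreducible_of_homDim_eq_one {ρ : Representation K G V} (h : homDim ρ ρ = 1) :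
    ρ.IsIrreducible := by
  have hnt : Nontrivial V := by
    by_contra hV
    rw [not_nontrivial_iff_subsingleton] at hV
    have : homDim ρ ρ = 0 := homDim_eq_zero_iff.mpr fun f =>
      IntertwiningMap.ext (LinearMap.ext fun v => Subsingleton.elim _ _)
    omega
  have : Nontrivial (Subrepresentation ρ) := by
    refine ⟨⊥, ⊤, fun hbt => ?_⟩
    obtain ⟨v, hv⟩ := exists_ne (0 : V)
    have : v ∈ (⊤ : Subrepresentation ρ) := Submodule.mem_top
    rw [← hbt] at this
    exact hv this
  refine ⟨fun p => ?_⟩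
  let f : IntertwiningMap p.toRepresentation ρ := ⟨p.toSubmodule.subtype, fun g => rfl⟩
  obtain ⟨q, ⟨e⟩⟩ := exists_equiv_prod_of_injective f p.toSubmodule.injective_subtype
  have hc : ∀ g, ρ.character g = p.toRepresentation.character g + q.toRepresentation.character g :=
    fun g => by rw [← char_iso e, character_prod]
  rw [homDim_add_right ρ hc, homDim_add_left _ hc, homDim_add_left _ hc] at h
  by_contra! hp
  have hp0 : Nontrivial p.toSubmodule := by
    rw [Submodule.nontrivial_iff_ne_bot]
    exact fun hb => hp.1 (Subrepresentation.toSubmodule_injective hb)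
  have hq0 : Nontrivial q.toSubmodule := by
    rw [Submodule.nontrivial_iff_ne_bot]
    intro hb
    apply hp.2
    apply Subrepresentation.toSubmodule_injective
    have h1 : Module.finrank K V = Module.finrank K p.toSubmodule := by
      rw [← e.toLinearEquiv.finrank_eq, Module.finrank_prod, hb, finrank_bot, add_zero]
    exact Submodule.eq_top_of_finrank_eq h1.symm
  have h1 := homDim_self_ne_zero p.toRepresentation
  have h2 := homDim_self_ne_zero q.toRepresentation
  omega

/-- If `V` contains each member of a finite family of pairwise non-isomorphic irreducible
representations then it contains their direct sum; so if the dimensions agree, `V` has the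
character of the direct sum. -/
theorem sum_finrank_le_and_character_eq {ι : Type*} {E : ι → Type*} [∀ i, AddCommGroup (E i)]
    [∀ i, Module K (E i)] [∀ i, FiniteDimensional K (E i)] (τ : ∀ i, Representation K G (E i))
    (hirr : ∀ i, (τ i).IsIrreducible) (hne : ∀ i j, i ≠ j → homDim (τ i) (τ j) = 0)
    (s : Finset ι) (ρ : Representation K G V) (hs : ∀ i ∈ s, homDim (τ i) ρ ≠ 0) :
    ∑ i ∈ s, Module.finrank K (E i) ≤ Module.finrank K V ∧
      (∑ i ∈ s, Module.finrank K (E i) = Module.finrank K V →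
        ∀ g, ρ.character g = ∑ i ∈ s, (τ i).character g) := by
  classical
  induction s using Finset.induction_on generalizing V with
  | empty =>
    refine ⟨by simp, fun h g => ?_⟩
    have hV : Module.finrank K V = 0 := by simpa using h.symm
    have := Module.finrank_zero_iff.mp hV
    rw [character, Subsingleton.elim (ρ g) 0]; simp
  | insert i s hi ih =>
    obtain ⟨f, hf⟩ := homDim_ne_zero_iff.mp (hs i (Finset.mem_insert_self _ _))
    have := hirr i
    obtain ⟨q, ⟨e⟩⟩ := exists_equiv_prod_of_injective f
      ((IsIrreducible.injective_or_eq_zero f).resolve_right hf)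
    have hc : ∀ g, ρ.character g = (τ i).character g + q.toRepresentation.character g :=
      fun g => by rw [← char_iso e, character_prod]
    have hd : Module.finrank K V = Module.finrank K (E i) + Module.finrank K q.toSubmodule := by
      rw [← e.toLinearEquiv.finrank_eq, Module.finrank_prod]
    obtain ⟨h1, h2⟩ := ih q.toRepresentation fun j hj => by
      have := hs j (Finset.mem_insert_of_mem hj)
      rwa [homDim_add_right _ hc, hne j i (by rintro rfl; exact hi hj), zero_add] at this
    rw [Finset.sum_insert hi, hd]
    refine ⟨by omega, fun h g => ?_⟩
    rw [Finset.sum_insert hi, hc, h2 (by omega)]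

end Characters

end General

end Representation

/-! ### Induced representations -/

namespace Representation

section Induction

variable {K G H : Type*} [Field K] [Group G] [Group H] (φ : H →* G)
  {V W : Type*} [AddCommGroup V] [Module K V] [AddCommGroup W] [Module K W]
  (ρ : Representation K H V) (σ : Representation K G W)

theorem indV_mk_map_mul (h : H) (g : G) (v : V) :
    IndV.mk φ ρ (φ h * g) (ρ h v) = IndV.mk φ ρ g v := by
  have := Coinvariants.mk_self_apply (tprod ((leftRegular K G).comp φ) ρ) h
    (TensorProduct.tmul K (MonoidAlgebra.single g 1) v)
  simpa using this

theorem indV_mk_eq (g : G) (v : V) :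
    IndV.mk φ ρ g v = ind φ ρ g⁻¹ (IndV.mk φ ρ 1 v) := by
  rw [ind_mk, inv_inv, one_mul]

/-- The vectors `mk 1 v` span a copy of the inducing representation. -/
theorem ind_map_mk_one (h : H) (v : V) :
    ind φ ρ (φ h) (IndV.mk φ ρ 1 v) = IndV.mk φ ρ 1 (ρ h v) := by
  rw [ind_mk, one_mul, ← indV_mk_map_mul φ ρ h, ← map_inv, ← map_mul, mul_inv_cancel, map_one]

/-- Frobenius reciprocity. -/
noncomputable def indHomEquiv :
    IntertwiningMap (ind φ ρ) σ ≃ₗ[K] IntertwiningMap ρ (MonoidHom.comp σ φ) where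
  toFun f := ⟨f.toLinearMap ∘ₗ IndV.mk φ ρ 1, fun h => by
    ext v
    change f (IndV.mk φ ρ 1 (ρ h v)) = σ (φ h) (f (IndV.mk φ ρ 1 v))
    rw [← ind_map_mk_one, f.isIntertwining]⟩
  map_add' _ _ := rfl
  map_smul' _ _ := rfl
  invFun f := ⟨Coinvariants.lift _
    (TensorProduct.lift <| (Finsupp.lift _ _ _ fun g => σ g⁻¹ ∘ₗ f.toLinearMap) ∘ₗ
      (MonoidAlgebra.coeffLinearEquiv K).toLinearMap)
    fun h ↦ by
      ext g x
      simp only [LinearMap.coe_comp, Function.comp_apply, MonoidAlgebra.lsingle_apply]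
      have : f (ρ h x) = σ (φ h) (f x) := DFunLike.congr_fun (f.isIntertwining' h) x
      simp [this], fun g ↦ by ext; simp⟩
  left_inv f := by
    apply IntertwiningMap.ext
    ext h a
    simpa using (f.isIntertwining _ _ h⁻¹ (IndV.mk φ ρ 1 a)).symm
  right_inv f := by
    apply IntertwiningMap.ext
    ext; simp

theorem indHomEquiv_symm_mk_one (f : IntertwiningMap ρ (MonoidHom.comp σ φ)) (v : V) :
    (indHomEquiv φ ρ σ).symm f (IndV.mk φ ρ 1 v) = f v :=
  DFunLike.congr_fun ((indHomEquiv φ ρ σ).apply_symm_apply f) v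

theorem homDim_ind : homDim (ind φ ρ) σ = homDim ρ (MonoidHom.comp σ φ) :=
  (indHomEquiv φ ρ σ).finrank_eq

instance [FiniteDimensional K V] [Finite G] : FiniteDimensional K (IndV φ ρ) := by
  unfold IndV
  infer_instance

theorem character_leftRegular [Finite G] [DecidableEq G] (g : G) :
    (leftRegular K G).character g = if g = 1 then (Nat.card G : K) else 0 := by
  cases nonempty_fintype G
  let b : Module.Basis G K (MonoidAlgebra K G) := .ofRepr (MonoidAlgebra.coeffLinearEquiv K)
  have hb : ∀ h, b h = MonoidAlgebra.single h 1 := fun h => rfl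
  have h1 : ∀ h : G, LinearMap.toMatrix b b (leftRegular K G g) h h = if g = 1 then 1 else 0 := by
    intro h
    rw [LinearMap.toMatrix_apply, hb, ofMulAction_single]
    change (Finsupp.single (g * h) (1 : K)) h = _
    simp only [Finsupp.single_apply, mul_eq_right]
  rw [character, LinearMap.trace_eq_matrix_trace K b, Matrix.trace]
  simp_rw [Matrix.diag_apply, h1]
  split_ifs <;> simp

variable [CharZero K] [Finite G] [FiniteDimensional K V] [FiniteDimensional K W]

theorem homDim_leftRegular : homDim σ (leftRegular K G) = Module.finrank K W := by
  classical
  cases nonempty_fintype G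
  apply Nat.cast_injective (R := K)
  rw [← card_inv_mul_sum_char]
  simp_rw [character_leftRegular, ite_mul, zero_mul, Finset.sum_ite_eq' Finset.univ]
  simp

theorem finrank_indV [Finite H] (hφ : Function.Injective φ) :
    Nat.card H * Module.finrank K (IndV φ ρ) = Nat.card G * Module.finrank K V := by
  classical
  cases nonempty_fintype H
  apply Nat.cast_injective (R := K)
  rw [← homDim_leftRegular (ind φ ρ), homDim_ind, Nat.cast_mul, ← card_inv_mul_sum_char]
  have : ∀ h, character (MonoidHom.comp (leftRegular K G) φ) h
      = if h = 1 then (Nat.card G : K) else 0 := fun h => by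
    rw [← map_eq_one_iff φ hφ (x := h), ← character_leftRegular]; rfl
  simp_rw [this, ite_mul, zero_mul, Finset.sum_ite_eq' Finset.univ]
  have : (Nat.card H : K) ≠ 0 := Nat.cast_ne_zero.mpr Nat.card_pos.ne'
  simp

/-- The inducing representation as a subspace of the induced representation. -/
noncomputable def indIncl : IntertwiningMap ρ (MonoidHom.comp (ind φ ρ) φ) :=
  ⟨IndV.mk φ ρ 1, fun h => LinearMap.ext fun v => (ind_map_mk_one φ ρ h v).symm⟩

theorem indIncl_ne_zero [Finite H] [Nontrivial V] (hφ : Function.Injective φ) :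
    indIncl φ ρ ≠ 0 := by
  intro h0
  have h1 : (LinearMap.id : IndV φ ρ →ₗ[K] IndV φ ρ) = 0 := by
    apply IndV.hom_ext
    intro g
    apply LinearMap.ext
    intro v
    have h2 : IndV.mk φ ρ 1 v = 0 := DFunLike.congr_fun h0 v
    change IndV.mk φ ρ g v = 0
    rw [indV_mk_eq, h2, map_zero]
  have h3 : Subsingleton (IndV φ ρ) := ⟨fun x y => by
    rw [← LinearMap.id_apply (R := K) x, ← LinearMap.id_apply (R := K) y, h1]; rfl⟩
  have h4 := finrank_indV φ ρ hφ
  rw [Module.finrank_zero_of_subsingleton, mul_zero, eq_comm] at h4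
  exact (Nat.mul_pos (Nat.card_pos (α := G)) (Module.finrank_pos (R := K) (M := V))).ne' h4

end Induction

end Representation

/-! ### Removing and adding boxes -/

namespace YoungDiagram

theorem eq_of_le_of_card_le {ν μ : YoungDiagram} (h : ν ≤ μ) (hc : μ.card ≤ ν.card) : ν = μ :=
  YoungDiagram.ext (Finset.eq_of_subset_of_card_le (cells_subset_iff.mpr h) hc)

theorem card_mono {ν μ : YoungDiagram} (h : ν ≤ μ) : ν.card ≤ μ.card :=
  Finset.card_le_card (cells_subset_iff.mpr h)

theorem card_sup_add_card_inf (ν μ : YoungDiagram) :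
    (ν ⊔ μ).card + (ν ⊓ μ).card = ν.card + μ.card := by
  rw [YoungDiagram.card, YoungDiagram.card, cells_sup, cells_inf]
  exact Finset.card_union_add_card_inter _ _

theorem lt_card_of_mem {μ : YoungDiagram} {i j : ℕ} (h : (i, j) ∈ μ) : i < μ.card ∧ j < μ.card := by
  constructor
  · have : (Finset.range (i + 1)).image (fun a => (a, j)) ⊆ μ.cells := by
      intro c hc
      obtain ⟨a, ha, rfl⟩ := Finset.mem_image.mp hc
      exact μ.up_left_mem (by simp at ha; omega) le_rfl h
    have h1 := Finset.card_le_card this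
    rwa [Finset.card_image_of_injective _ (fun a b hab => (Prod.mk.inj hab).1),
      Finset.card_range] at h1
  · have : (Finset.range (j + 1)).image (fun a => (i, a)) ⊆ μ.cells := by
      intro c hc
      obtain ⟨a, ha, rfl⟩ := Finset.mem_image.mp hc
      exact μ.up_left_mem le_rfl (by simp at ha; omega) h
    have h1 := Finset.card_le_card this
    rwa [Finset.card_image_of_injective _ (fun a b hab => (Prod.mk.inj hab).2),
      Finset.card_range] at h1

theorem finite_card_le (n : ℕ) : {μ : YoungDiagram | μ.card ≤ n}.Finite := by
  refine Set.Finite.of_finite_image (f := cells)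
    ((Finset.finite_toSet (Finset.range n ×ˢ Finset.range n).powerset).subset ?_)
    (fun μ _ ν _ h => YoungDiagram.ext h)
  rintro _ ⟨μ, hμ, rfl⟩
  simp only [Finset.coe_powerset, Set.mem_preimage, Set.mem_powerset_iff, Finset.coe_subset]
  rintro ⟨i, j⟩ hc
  have := lt_card_of_mem hc
  simp only [Set.mem_ofPred_eq] at hμ
  simp only [Finset.mem_product, Finset.mem_range]
  omega

/-- The Young diagrams obtained from `μ` by removing one box. -/
noncomputable def down (μ : YoungDiagram) : Finset YoungDiagram :=
  ((finite_card_le μ.card).subset (t := {ν | ν ≤ μ ∧ ν.card + 1 = μ.card})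
    fun _ h => card_mono h.1).toFinset

/-- The Young diagrams obtained from `ν` by adding one box. -/
noncomputable def up (ν : YoungDiagram) : Finset YoungDiagram :=
  ((finite_card_le (ν.card + 1)).subset (t := {μ | ν ≤ μ ∧ ν.card + 1 = μ.card})
    fun _ h => h.2.ge).toFinset

@[simp] theorem mem_down {ν μ : YoungDiagram} : ν ∈ μ.down ↔ ν ≤ μ ∧ ν.card + 1 = μ.card := by
  simp [down]

@[simp] theorem mem_up {ν μ : YoungDiagram} : μ ∈ ν.up ↔ ν ≤ μ ∧ ν.card + 1 = μ.card := by
  simp [up]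

theorem exists_cells_eq_insert {ν μ : YoungDiagram} (h : ν ∈ μ.down) :
    ∃ i j, (i, j) ∉ ν ∧ μ.cells = insert (i, j) ν.cells := by
  rw [mem_down] at h
  obtain ⟨⟨i, j⟩, hc, he⟩ := (Finset.covBy_iff_card_sdiff_eq_one.mpr
    ⟨cells_subset_iff.mpr h.1, by
      rw [Finset.card_sdiff_of_subset (cells_subset_iff.mpr h.1)]
      have := h.2
      unfold YoungDiagram.card at this
      omega⟩ : ν.cells ⋖ μ.cells).exists_finset_insert
  exact ⟨i, j, hc, he.symm⟩

/-- The box that distinguishes a diagram from one it covers sits at the end of its row. -/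
theorem rowLen_of_cells_eq_insert {ν μ : YoungDiagram} {i j : ℕ} (hn : (i, j) ∉ ν)
    (h : μ.cells = insert (i, j) ν.cells) :
    ν.rowLen i = j ∧ μ.rowLen i = j + 1 ∧ μ.rowLen (i + 1) < μ.rowLen i ∧
      ∀ e, i = e + 1 → ν.rowLen i < ν.rowLen e := by
  have hm : ∀ c, c ∈ μ ↔ c = (i, j) ∨ c ∈ ν := fun c => by
    rw [← mem_cells, h, Finset.mem_insert, mem_cells]
  have h1 : ν.rowLen i ≤ j := by rw [← not_lt, ← mem_iff_lt_rowLen]; exact hn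
  have h2 : ∀ k, k < j → k < ν.rowLen i := fun k hk => by
    have : (i, k) ∈ μ := μ.up_left_mem le_rfl hk.le ((hm (i, j)).mpr (Or.inl rfl))
    rw [hm, mem_iff_lt_rowLen, Prod.mk.injEq] at this
    omega
  have h3 : j < μ.rowLen i := mem_iff_lt_rowLen.mp ((hm _).mpr (Or.inl rfl))
  have h4 : (i, j + 1) ∉ μ := by
    rw [hm, not_or]
    exact ⟨by simp, fun h' => hn (ν.up_left_mem le_rfl (Nat.le_succ j) h')⟩
  have h5 : (i + 1, j) ∉ μ := by
    rw [hm, not_or]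
    exact ⟨by simp, fun h' => hn (ν.up_left_mem (Nat.le_succ i) le_rfl h')⟩
  rw [mem_iff_lt_rowLen] at h4 h5
  have h6 : ν.rowLen i = j := by
    by_contra hne
    have := h2 (ν.rowLen i) (by omega)
    omega
  refine ⟨h6, by omega, by omega, ?_⟩
  rintro e rfl
  have : (e, j) ∈ μ := μ.up_left_mem (Nat.le_succ e) le_rfl ((hm _).mpr (Or.inl rfl))
  rw [hm, mem_iff_lt_rowLen, Prod.mk.injEq] at this
  omega

theorem removeBox_cells (μ : YoungDiagram) {d : ℕ} (hd : d ∈ μ.removableRows) :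
    μ.cells = insert (d, μ.rowLen d - 1) (μ.removeBox d hd).cells := by
  have h : μ.rowLen (d + 1) < μ.rowLen d := hd
  refine (Finset.insert_erase ?_).symm
  rw [mem_cells, mem_iff_lt_rowLen]
  omega

theorem notMem_removeBox (μ : YoungDiagram) {d : ℕ} (hd : d ∈ μ.removableRows) :
    (d, μ.rowLen d - 1) ∉ μ.removeBox d hd :=
  Finset.notMem_erase _ _

theorem mem_down_of_cells_eq_insert {ν μ : YoungDiagram} {c : ℕ × ℕ} (hn : c ∉ ν)
    (h : μ.cells = insert c ν.cells) : ν ∈ μ.down := by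
  rw [mem_down]
  refine ⟨?_, ?_⟩
  · rw [← cells_subset_iff, h]; exact Finset.subset_insert _ _
  · rw [YoungDiagram.card, YoungDiagram.card, h, Finset.card_insert_of_notMem hn]

theorem mem_down_iff_exists_removeBox {ν μ : YoungDiagram} :
    ν ∈ μ.down ↔ ∃ d, ∃ hd : d ∈ μ.removableRows, ν = μ.removeBox d hd := by
  constructor
  · intro h
    obtain ⟨i, j, hn, he⟩ := exists_cells_eq_insert h
    obtain ⟨-, h1, h2, -⟩ := rowLen_of_cells_eq_insert hn he
    refine ⟨i, h2, YoungDiagram.ext ?_⟩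
    change ν.cells = μ.cells.erase (i, μ.rowLen i - 1)
    rw [h1, Nat.add_sub_cancel, he, Finset.erase_insert hn]
  · rintro ⟨d, hd, rfl⟩
    exact mem_down_of_cells_eq_insert (notMem_removeBox μ hd) (removeBox_cells μ hd)

/-- `μ` with a box added at the end of row `d`. -/
def addBox (μ : YoungDiagram) (d : ℕ) (hd : ∀ e, d = e + 1 → e ∈ μ.removableRows) :
    YoungDiagram where
  cells := insert (d, μ.rowLen d) μ.cells
  isLowerSet := by
    rintro ⟨i, j⟩ ⟨i', j'⟩ hle hmem
    obtain ⟨hi, hj⟩ : i' ≤ i ∧ j' ≤ j := hle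
    simp only [Finset.coe_insert, Set.mem_insert_iff, Finset.mem_coe, mem_cells,
      mem_iff_lt_rowLen, Prod.mk.injEq] at hmem ⊢
    rcases hmem with ⟨rfl, rfl⟩ | hmem
    · rcases Nat.eq_or_lt_of_le hi with rfl | hlt
      · omega
      · obtain ⟨e, rfl⟩ : ∃ e, i = e + 1 := ⟨i - 1, by omega⟩
        have h1 : μ.rowLen (e + 1) < μ.rowLen e := hd e rfl
        have h2 := μ.rowLen_anti i' e (by omega)
        omega
    · have := μ.rowLen_anti i' i hi
      omega

theorem finite_removableRows (μ : YoungDiagram) : μ.removableRows.Finite := by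
  refine (Finset.finite_toSet (Finset.range μ.card)).subset fun d hd => ?_
  have h : μ.rowLen (d + 1) < μ.rowLen d := hd
  have : (d, 0) ∈ μ := mem_iff_lt_rowLen.mpr (by omega)
  simpa using (lt_card_of_mem this).1

theorem card_down (μ : YoungDiagram) : μ.down.card = μ.finite_removableRows.toFinset.card := by
  symm
  refine Finset.card_bij (fun d hd => μ.removeBox d (by simpa using hd)) ?_ ?_ ?_
  · intro d hd
    exact mem_down_iff_exists_removeBox.mpr ⟨d, _, rfl⟩
  · intro d hd e he h
    have h1 : (d, μ.rowLen d - 1) ∈ μ.cells := by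
      rw [removeBox_cells μ (by simpa using hd)]; exact Finset.mem_insert_self _ _
    have h2 := notMem_removeBox μ (d := d) (by simpa using hd)
    rw [h, ← mem_cells] at h2
    rw [removeBox_cells μ (d := e) (by simpa using he), Finset.mem_insert] at h1
    exact (Prod.mk.inj (h1.resolve_right h2)).1
  · intro ν hν
    obtain ⟨d, hd, rfl⟩ := mem_down_iff_exists_removeBox.mp hν
    exact ⟨d, by simpa using hd, rfl⟩

/-- There is one more way to add a box than to remove one. -/
theorem card_up (ν : YoungDiagram) : ν.up.card = ν.down.card + 1 := by
  classical
  rw [card_down]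
  set R := ν.finite_removableRows.toFinset with hR
  have hA : (insert 0 (R.image Nat.succ)).card = R.card + 1 := by
    rw [Finset.card_insert_of_notMem (by simp),
      Finset.card_image_of_injective _ Nat.succ_injective]
  rw [← hA]
  symm
  have hmem : ∀ d, d ∈ insert 0 (R.image Nat.succ) ↔ ∀ e, d = e + 1 → e ∈ ν.removableRows := by
    intro d
    rcases d with _ | d
    · simp
    · simp [hR]
  have hn : ∀ d, (d, ν.rowLen d) ∉ ν := fun d => by rw [mem_iff_lt_rowLen]; omega
  refine Finset.card_bij (fun d hd => ν.addBox d ((hmem d).mp hd)) ?_ ?_ ?_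
  · intro d hd
    rw [mem_up, ← mem_down]
    exact mem_down_of_cells_eq_insert (hn d) rfl
  · intro d hd e he h
    have h1 : insert (d, ν.rowLen d) ν.cells = insert (e, ν.rowLen e) ν.cells :=
      congrArg cells h
    have h2 := Finset.mem_insert_self (d, ν.rowLen d) ν.cells
    rw [h1, Finset.mem_insert] at h2
    exact (Prod.mk.inj (h2.resolve_right (hn d))).1
  · intro μ hμ
    rw [mem_up, ← mem_down] at hμ
    obtain ⟨i, j, hij, he⟩ := exists_cells_eq_insert hμ
    obtain ⟨h1, -, -, h2⟩ := rowLen_of_cells_eq_insert hij he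
    refine ⟨i, (hmem i).mpr ?_, YoungDiagram.ext ?_⟩
    · rintro e rfl
      exact h2 e rfl
    · change insert (i, ν.rowLen i) ν.cells = μ.cells
      rw [he, h1]

theorem sup_eq_of_mem_down {ν κ μ : YoungDiagram} (hν : ν ∈ μ.down) (hκ : κ ∈ μ.down)
    (hne : κ ≠ ν) : ν ⊔ κ = μ := by
  rw [mem_down] at hν hκ
  refine eq_of_le_of_card_le (sup_le hν.1 hκ.1) ?_
  by_contra! h
  have h1 : ν = ν ⊔ κ := eq_of_le_of_card_le le_sup_left (by omega)
  exact hne (eq_of_le_of_card_le (h1 ▸ le_sup_right) (by omega))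

theorem inf_eq_of_mem_up {ν κ ρ : YoungDiagram} (hν : ρ ∈ ν.down) (hκ : ρ ∈ κ.down)
    (hne : κ ≠ ν) : ν ⊓ κ = ρ := by
  rw [mem_down] at hν hκ
  refine (eq_of_le_of_card_le (le_inf hν.1 hκ.1) ?_).symm
  by_contra! h
  have h1 : ν ⊓ κ = ν := eq_of_le_of_card_le inf_le_left (by omega)
  exact hne (eq_of_le_of_card_le (h1 ▸ inf_le_right) (by omega)).symm

theorem down_nonempty {ν : YoungDiagram} (hν : ν.card ≠ 0) : ν.down.Nonempty := by
  rw [← Finset.card_pos, card_down, Finset.card_pos]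
  by_contra! hemp
  rw [Set.Finite.toFinset_eq_empty] at hemp
  have hr : ∀ d, ν.rowLen 0 ≤ ν.rowLen d := by
    intro d
    induction d with
    | zero => exact le_rfl
    | succ d ihd =>
      have : d ∉ ν.removableRows := by rw [hemp]; simp
      simp only [removableRows, Set.mem_ofPred_eq, not_lt] at this
      omega
  obtain ⟨⟨i, j⟩, hc⟩ : ν.cells.Nonempty := by
    rw [← Finset.card_pos]; exact Nat.pos_of_ne_zero hν
  have h0 := mem_iff_lt_rowLen.mp hc
  have h00 := ν.rowLen_anti 0 i (Nat.zero_le i)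
  have : (ν.card, 0) ∈ ν := mem_iff_lt_rowLen.mpr (by have := hr ν.card; omega)
  exact absurd (lt_card_of_mem this).1 (lt_irrefl _)

/-- The commutation relation between adding and removing boxes: passing from `ν` up and then down
agrees with passing down and then up, except for one additional way of returning to `ν`. -/
theorem sum_up_sum_down (f : YoungDiagram → ℕ) (ν : YoungDiagram) :
    ∑ μ ∈ ν.up, ∑ κ ∈ μ.down, f κ = f ν + ∑ ρ ∈ ν.down, ∑ κ ∈ ρ.up, f κ := by
  classical
  have h1 : ∀ μ ∈ ν.up, ∑ κ ∈ μ.down, f κ = f ν + ∑ κ ∈ μ.down.erase ν, f κ := fun μ hμ =>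
    (Finset.add_sum_erase _ _ (by rw [mem_down, ← mem_up]; exact hμ)).symm
  have h2 : ∀ ρ ∈ ν.down, ∑ κ ∈ ρ.up, f κ = f ν + ∑ κ ∈ ρ.up.erase ν, f κ := fun ρ hρ =>
    (Finset.add_sum_erase _ _ (by rw [mem_up, ← mem_down]; exact hρ)).symm
  rw [Finset.sum_congr rfl h1, Finset.sum_congr rfl h2, Finset.sum_add_distrib,
    Finset.sum_add_distrib, Finset.sum_const, Finset.sum_const, card_up, smul_eq_mul, smul_eq_mul]
  have h3 : ∑ μ ∈ ν.up, ∑ κ ∈ μ.down.erase ν, f κ = ∑ ρ ∈ ν.down, ∑ κ ∈ ρ.up.erase ν, f κ := by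
    rw [Finset.sum_sigma', Finset.sum_sigma']
    refine Finset.sum_bij' (fun p _ => ⟨ν ⊓ p.2, p.2⟩) (fun p _ => ⟨ν ⊔ p.2, p.2⟩) ?_ ?_ ?_ ?_ ?_
    · rintro ⟨μ, κ⟩ h
      simp only [Finset.mem_sigma, Finset.mem_erase, mem_up, mem_down] at h ⊢
      have hs := sup_eq_of_mem_down (mem_down.mpr h.1) (mem_down.mpr h.2.2) h.2.1
      have := card_sup_add_card_inf ν κ
      rw [hs] at this
      exact ⟨⟨inf_le_left, by omega⟩, h.2.1, inf_le_right, by omega⟩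
    · rintro ⟨ρ, κ⟩ h
      simp only [Finset.mem_sigma, Finset.mem_erase, mem_up, mem_down] at h ⊢
      have hs := inf_eq_of_mem_up (mem_down.mpr h.1) (mem_down.mpr h.2.2) h.2.1
      have := card_sup_add_card_inf ν κ
      rw [hs] at this
      exact ⟨⟨le_sup_left, by omega⟩, h.2.1, le_sup_right, by omega⟩
    · rintro ⟨μ, κ⟩ h
      simp only [Finset.mem_sigma, Finset.mem_erase, mem_up, mem_down] at h
      have hs := sup_eq_of_mem_down (mem_down.mpr h.1) (mem_down.mpr h.2.2) h.2.1
      simp [hs]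
    · rintro ⟨ρ, κ⟩ h
      simp only [Finset.mem_sigma, Finset.mem_erase, mem_up, mem_down] at h
      have hs := inf_eq_of_mem_up (mem_down.mpr h.1) (mem_down.mpr h.2.2) h.2.1
      simp [hs]
    · rintro ⟨μ, κ⟩ h
      rfl
  rw [h3]; ring

/-- If `f` is superadditive for the removal of boxes and satisfies the reverse inequality for the
addition of boxes, then it is additive for the removal of boxes: by induction on the number of boxes,
`sum_up_sum_down` turns both inequalities into equalities. -/
theorem sum_down_eq_of_le (f : YoungDiagram → ℕ) (h1 : ∀ μ, ∑ ν ∈ μ.down, f ν ≤ f μ)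
    (h2 : ∀ ν, ∑ μ ∈ ν.up, f μ ≤ (ν.card + 1) * f ν) {μ : YoungDiagram} (hμ : μ.card ≠ 0) :
    ∑ ν ∈ μ.down, f ν = f μ := by
  have key : ∀ n, ∀ ν : YoungDiagram, ν.card = n →
      ∑ μ ∈ ν.up, f μ = (ν.card + 1) * f ν ∧
        ∀ μ ∈ ν.up, ∑ κ ∈ μ.down, f κ = f μ := by
    intro n
    induction n with
    | zero =>
      intro ν hν
      have hd : ν.down = ∅ := by
        apply Finset.eq_empty_of_forall_notMem
        intro ρ hρ
        rw [mem_down] at hρ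
        omega
      have h := sum_up_sum_down f ν
      rw [hd, Finset.sum_empty, add_zero] at h
      have h3 := Finset.sum_le_sum fun μ (_ : μ ∈ ν.up) => h1 μ
      have h4 := h2 ν
      rw [hν] at h4 ⊢
      refine ⟨by omega, (Finset.sum_eq_sum_iff_of_le fun μ _ => h1 μ).mp (by omega)⟩
    | succ n ih =>
      intro ν hν
      have h := sum_up_sum_down f ν
      have h5 : ∑ ρ ∈ ν.down, ∑ κ ∈ ρ.up, f κ = ν.card * f ν := by
        obtain ⟨ρ₀, hρ₀⟩ := down_nonempty (ν := ν) (by omega)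
        have h6 : ∑ ρ ∈ ν.down, ∑ κ ∈ ρ.up, f κ = ∑ ρ ∈ ν.down, ν.card * f ρ := by
          refine Finset.sum_congr rfl fun ρ hρ => ?_
          have hc := (mem_down.mp hρ).2
          rw [(ih ρ (by omega)).1, hc]
        rw [h6, ← Finset.mul_sum, (ih ρ₀ (by have := (mem_down.mp hρ₀).2; omega)).2 ν
          (by rw [mem_up, ← mem_down]; exact hρ₀)]
      rw [h5] at h
      have h3 := Finset.sum_le_sum fun μ (_ : μ ∈ ν.up) => h1 μ
      have h4 := h2 ν
      have h7 : f ν + ν.card * f ν = (ν.card + 1) * f ν := by ring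
      exact ⟨by omega, (Finset.sum_eq_sum_iff_of_le fun μ _ => h1 μ).mp (by omega)⟩
  obtain ⟨ν, hν⟩ := down_nonempty hμ
  exact (key _ ν rfl).2 μ (by rw [mem_up, ← mem_down]; exact hν)

end YoungDiagram

/-! ### Tableaux -/

section Tableaux

variable {k : ℕ} {lam μ : YoungDiagram}

/-- The row in which the tableau `T` contains `x`. -/
def tabRow (T : Fin k ≃ μ.cells) (x : Fin k) : ℕ := (T x).1.1

/-- The column in which the tableau `T` contains `x`. -/
def tabCol (T : Fin k ≃ μ.cells) (x : Fin k) : ℕ := (T x).1.2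

theorem tab_ext (T : Fin k ≃ μ.cells) {x y : Fin k} (h1 : tabRow T x = tabRow T y)
    (h2 : tabCol T x = tabCol T y) : x = y :=
  T.injective (Subtype.ext (Prod.ext h1 h2))

theorem tab_mem (T : Fin k ≃ μ.cells) (x : Fin k) : (tabRow T x, tabCol T x) ∈ μ := (T x).2

/-- The number of boxes in the first `q` rows. -/
theorem card_tabRow_lt (T : Fin k ≃ μ.cells) (q : ℕ) :
    (Finset.univ.filter fun x => tabRow T x < q).card = ∑ i ∈ Finset.range q, μ.rowLen i := by
  have h : ∀ i ∈ Finset.range q, μ.rowLen i =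
      ((Finset.univ.filter fun x => tabRow T x < q).filter fun x => tabRow T x = i).card := by
    intro i hi
    rw [YoungDiagram.rowLen_eq_card, Finset.filter_filter]
    symm
    refine Finset.card_bij (fun x _ => (T x).1) ?_ ?_ ?_
    · intro x hx
      rw [YoungDiagram.mem_row_iff]
      exact ⟨(T x).2, (Finset.mem_filter.mp hx).2.2⟩
    · intro x _ y _ hxy
      exact T.injective (Subtype.ext hxy)
    · intro c hc
      rw [YoungDiagram.mem_row_iff] at hc
      have h1 : tabRow T (T.symm ⟨c, hc.1⟩) = i := by rw [tabRow, apply_symm_apply]; exact hc.2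
      refine ⟨T.symm ⟨c, hc.1⟩, Finset.mem_filter.mpr ⟨Finset.mem_univ _, ?_, h1⟩, by simp⟩
      rw [h1]; simpa using hi
  rw [Finset.sum_congr rfl h]
  exact Finset.card_eq_sum_card_fiberwise fun x hx => by simpa using hx

theorem card_tabCol (T : Fin k ≃ μ.cells) (q j : ℕ) :
    (Finset.univ.filter fun x => tabRow T x < q ∧ tabCol T x = j).card = min q (μ.colLen j) := by
  rw [← Finset.card_range (min q (μ.colLen j))]
  refine Finset.card_bij (fun x _ => tabRow T x) ?_ ?_ ?_
  · intro x hx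
    simp only [Finset.mem_filter, Finset.mem_univ, true_and] at hx
    have := YoungDiagram.mem_iff_lt_colLen.mp (tab_mem T x)
    rw [hx.2] at this
    simp; omega
  · intro x hx y hy hxy
    simp only [Finset.mem_filter, Finset.mem_univ, true_and] at hx hy
    exact tab_ext T hxy (hx.2.trans hy.2.symm)
  · intro i hi
    have hi' : i < q ∧ i < μ.colLen j := by simpa using hi
    refine ⟨T.symm ⟨(i, j), YoungDiagram.mem_iff_lt_colLen.mpr hi'.2⟩,
      Finset.mem_filter.mpr ⟨Finset.mem_univ _, ?_, ?_⟩, ?_⟩ <;>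
    simp [tabRow, tabCol, hi'.1]

variable {T : Fin k ≃ lam.cells} {S : Fin k ≃ μ.cells}

/-- If no two points share a row of `T` and a column of `S`, then each column of `S` meets the first
`q` rows of `T` in at most `q` points. -/
theorem card_tabRow_tabCol_le (h : ∀ x y, tabRow T x = tabRow T y → tabCol S x = tabCol S y → x = y)
    (q j : ℕ) :
    (Finset.univ.filter fun x => tabRow T x < q ∧ tabCol S x = j).card ≤
      (Finset.univ.filter fun x => tabRow S x < q ∧ tabCol S x = j).card := by
  rw [card_tabCol, le_min_iff]
  constructor
  · rw [← Finset.card_range q]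
    refine Finset.card_le_card_of_injOn (tabRow T) ?_ ?_
    · intro x hx
      simp only [Finset.coe_filter, Finset.mem_univ, true_and, Set.mem_ofPred_eq] at hx
      simpa using hx.1
    · intro x hx y hy hxy
      simp only [Finset.coe_filter, Finset.mem_univ, true_and, Set.mem_ofPred_eq] at hx hy
      exact h x y hxy (hx.2.trans hy.2.symm)
  · have := card_tabCol S (μ.colLen j) j
    rw [min_self] at this
    rw [← this]
    refine Finset.card_le_card fun x hx => ?_
    simp only [Finset.mem_filter, Finset.mem_univ, true_and] at hx ⊢
    refine ⟨?_, hx.2⟩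
    rw [← hx.2]
    exact YoungDiagram.mem_iff_lt_colLen.mp (tab_mem S x)

theorem card_tabRow_eq_sum (r : Fin k → ℕ) (S : Fin k ≃ μ.cells) (q : ℕ) :
    (Finset.univ.filter fun x => r x < q).card = ∑ j ∈ Finset.univ.image (tabCol S),
      (Finset.univ.filter fun x => r x < q ∧ tabCol S x = j).card := by
  rw [Finset.card_eq_sum_card_fiberwise (f := tabCol S) (t := Finset.univ.image (tabCol S))
    (fun x _ => by simp)]
  simp_rw [Finset.filter_filter]

/-- If no two points share a row of `T` and a column of `S`, then the shape of `S` dominates the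
shape of `T`. -/
theorem sum_rowLen_le (h : ∀ x y, tabRow T x = tabRow T y → tabCol S x = tabCol S y → x = y)
    (q : ℕ) : ∑ i ∈ Finset.range q, lam.rowLen i ≤ ∑ i ∈ Finset.range q, μ.rowLen i := by
  rw [← card_tabRow_lt T, ← card_tabRow_lt S, card_tabRow_eq_sum _ S, card_tabRow_eq_sum _ S]
  exact Finset.sum_le_sum fun j _ => card_tabRow_tabCol_le h q j

theorem YoungDiagram.eq_of_sum_rowLen_eq
    (h : ∀ q, ∑ i ∈ Finset.range q, lam.rowLen i = ∑ i ∈ Finset.range q, μ.rowLen i) :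
    lam = μ := by
  have hr : ∀ i, lam.rowLen i = μ.rowLen i := fun i => by
    have h1 := h (i + 1)
    rw [Finset.sum_range_succ, Finset.sum_range_succ, h i] at h1
    omega
  apply YoungDiagram.ext
  ext ⟨i, j⟩
  rw [YoungDiagram.mem_cells, YoungDiagram.mem_cells, YoungDiagram.mem_iff_lt_rowLen,
    YoungDiagram.mem_iff_lt_rowLen, hr]

/-- Two tableaux of the same shape without two points in a common row of the first and a common
column of the second agree up to a column permutation followed by a row permutation. -/
theorem exists_colStab_of_injective {T S : Fin k ≃ μ.cells}
    (h : ∀ x y, tabRow T x = tabRow T y → tabCol S x = tabCol S y → x = y) :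
    ∃ σ ∈ colStab S, ∀ x, tabRow S (σ x) = tabRow T x := by
  have hmem : ∀ x, (tabRow T x, tabCol S x) ∈ μ := by
    intro x
    set q := μ.colLen (tabCol S x) with hq
    -- All the inequalities of `card_tabRow_tabCol_le` are equalities, as the shapes agree.
    have h1 := card_tabRow_eq_sum (tabRow T) S q
    rw [card_tabRow_lt, ← card_tabRow_lt S, card_tabRow_eq_sum _ S] at h1
    have h2 := (Finset.sum_eq_sum_iff_of_le fun j _ => card_tabRow_tabCol_le h q j).mp h1.symm
      (tabCol S x) (Finset.mem_image_of_mem _ (Finset.mem_univ x))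
    have h3 : (Finset.univ.filter fun y => tabRow T y < q ∧ tabCol S y = tabCol S x) =
        Finset.univ.filter fun y => tabCol S y = tabCol S x := by
      refine Finset.eq_of_subset_of_card_le (fun y hy => ?_) ?_
      · simp only [Finset.mem_filter, Finset.mem_univ, true_and] at hy ⊢
        exact hy.2
      · rw [h2]
        refine Finset.card_le_card fun y hy => ?_
        simp only [Finset.mem_filter, Finset.mem_univ, true_and] at hy ⊢
        refine ⟨?_, hy⟩
        rw [hq, ← hy]
        exact YoungDiagram.mem_iff_lt_colLen.mp (tab_mem S y)
    have h4 : x ∈ Finset.univ.filter fun y => tabCol S y = tabCol S x := by simp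
    rw [← h3, Finset.mem_filter] at h4
    exact YoungDiagram.mem_iff_lt_colLen.mpr h4.2.1
  have hinj : Function.Injective fun x => S.symm ⟨(tabRow T x, tabCol S x), hmem x⟩ := by
    intro x y hxy
    have h1 : (tabRow T x, tabCol S x) = (tabRow T y, tabCol S y) :=
      congrArg Subtype.val (S.symm.injective hxy)
    exact h x y (Prod.mk.inj h1).1 (Prod.mk.inj h1).2
  refine ⟨Equiv.ofBijective _ (Finite.injective_iff_bijective.mp hinj), fun x => ?_, fun x => ?_⟩
  · simp [tabCol]
  · simp [tabRow]

end Tableaux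

/-! ### Embeddings of symmetric groups -/

section ViaEmbedding

theorem exists_perm_comp_eq {a b : ℕ} (f g : Fin a ↪ Fin b) :
    ∃ π : Perm (Fin b), ∀ i, π (f i) = g i := by
  obtain ⟨π, h⟩ := Perm.exists_extending_pair f g f.injective g.injective
  exact ⟨π, h⟩

theorem viaEmbedding_conj {a b : ℕ} {f g : Fin a ↪ Fin b} {π : Perm (Fin b)}
    (h : ∀ i, π (f i) = g i) (σ : Perm (Fin a)) :
    σ.viaEmbedding g = π * σ.viaEmbedding f * π⁻¹ := by
  rw [eq_mul_inv_iff_mul_eq]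
  ext1 x
  rw [Perm.mul_apply, Perm.mul_apply]
  by_cases hx : ∃ i, f i = x
  · obtain ⟨i, rfl⟩ := hx
    rw [h, Perm.viaEmbedding_apply, Perm.viaEmbedding_apply, h]
  · rw [Perm.viaEmbedding_apply_of_notMem _ f _ hx, Perm.viaEmbedding_apply_of_notMem]
    rintro ⟨i, hi⟩
    rw [← h] at hi
    exact hx ⟨i, π.injective hi⟩

theorem sign_viaEmbedding {a b : ℕ} (f : Fin a ↪ Fin b) (σ : Perm (Fin a)) :
    Perm.sign (σ.viaEmbedding f) = Perm.sign σ := by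
  classical
  rw [Perm.viaEmbedding]
  convert! Perm.sign_extendDomain σ (Equiv.ofInjective f f.injective)

/-- A permutation fixing every point outside the range of `f` comes from a permutation of the
domain of `f`. -/
theorem exists_viaEmbedding_eq {a b : ℕ} (f : Fin a ↪ Fin b) {σ : Perm (Fin b)}
    (h : ∀ x, x ∉ Set.range f → σ x = x) : ∃ τ : Perm (Fin a), τ.viaEmbedding f = σ := by
  have h1 : ∀ i, ∃ j, f j = σ (f i) := by
    intro i
    by_contra hn
    have := h _ hn
    exact hn ⟨i, (σ.injective this).symm⟩
  choose t ht using h1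
  have hinj : Function.Injective t := fun i j hij => by
    apply f.injective
    apply σ.injective
    rw [← ht, ← ht, hij]
  refine ⟨Equiv.ofBijective t (Finite.injective_iff_bijective.mp hinj), ?_⟩
  ext1 x
  by_cases hx : ∃ i, f i = x
  · obtain ⟨i, rfl⟩ := hx
    rw [Perm.viaEmbedding_apply, ofBijective_apply, ht]
  · rw [Perm.viaEmbedding_apply_of_notMem _ f _ hx, h x hx]

end ViaEmbedding

/-! ### Young symmetrizers -/

section YoungSymmetrizer

open Representation

variable {K : Type*} [Field K] {k : ℕ} {lam μ : YoungDiagram}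

open Classical in
theorem youngSymmetrizer_coeff (T : Fin k ≃ μ.cells) (g : Perm (Fin k)) :
    (youngSymmetrizer K T).coeff g =
      ∑ p ∈ Finset.univ.filter (· ∈ colStab T) ×ˢ Finset.univ.filter (· ∈ rowStab T),
        if p.1 * p.2 = g then ((Perm.sign p.1 : ℤ) : K) else 0 := by
  rw [youngSymmetrizer, Finset.sum_mul_sum, ← Finset.sum_product']
  simp_rw [MonoidAlgebra.single_mul_single, mul_one]
  rw [MonoidAlgebra.coeff_sum, Finset.sum_apply']
  simp_rw [MonoidAlgebra.coeff_single, Finsupp.single_apply]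

theorem apply_eq_of_mem_stab {T : Fin k ≃ μ.cells} {σ τ : Perm (Fin k)} (hσ : σ ∈ colStab T)
    (hτ : τ ∈ rowStab T) {x : Fin k} (h : σ (τ x) = x) : τ x = x := by
  refine tab_ext T (hτ x) ?_
  have := hσ (τ x)
  rw [h] at this
  exact this.symm

theorem youngSymmetrizer_coeff_one (T : Fin k ≃ μ.cells) :
    (youngSymmetrizer K T).coeff 1 = 1 := by
  classical
  rw [youngSymmetrizer_coeff, Finset.sum_eq_single (1, 1)]
  · simp
  · rintro ⟨σ, τ⟩ h hne
    simp only [Finset.mem_product, Finset.mem_filter, Finset.mem_univ, true_and] at h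
    rw [if_neg]
    intro h1
    apply hne
    have : τ = 1 := by
      ext1 x
      exact apply_eq_of_mem_stab h.1 h.2 (DFunLike.congr_fun h1 x)
    subst this
    rw [mul_one] at h1
    exact Prod.ext h1 rfl
  · intro h
    exact absurd (by simp [one_mem]) h

theorem coeff_leftRegular (g h : Perm (Fin k)) (x : MonoidAlgebra K (Perm (Fin k))) :
    (leftRegular K (Perm (Fin k)) g x).coeff h = x.coeff (g⁻¹ * h) :=
  coeff_ofMulAction g x h

theorem leftRegular_youngSymmetrizer (T : Fin k ≃ μ.cells) {σ : Perm (Fin k)}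
    (hσ : σ ∈ colStab T) :
    leftRegular K _ σ (youngSymmetrizer K T) = ((Perm.sign σ : ℤ) : K) • youngSymmetrizer K T := by
  classical
  ext g
  rw [coeff_leftRegular, MonoidAlgebra.coeff_smul, Finsupp.smul_apply, youngSymmetrizer_coeff,
    youngSymmetrizer_coeff, Finset.smul_sum]
  refine Finset.sum_bij' (fun p _ => (σ * p.1, p.2)) (fun p _ => (σ⁻¹ * p.1, p.2)) ?_ ?_ ?_ ?_ ?_
  · rintro ⟨a, b⟩ h
    simp only [Finset.mem_product, Finset.mem_filter, Finset.mem_univ, true_and] at h ⊢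
    exact ⟨mul_mem hσ h.1, h.2⟩
  · rintro ⟨a, b⟩ h
    simp only [Finset.mem_product, Finset.mem_filter, Finset.mem_univ, true_and] at h ⊢
    exact ⟨mul_mem (inv_mem hσ) h.1, h.2⟩
  · rintro ⟨a, b⟩ h; simp
  · rintro ⟨a, b⟩ h; simp
  · rintro ⟨a, b⟩ h
    have h1 : σ * a * b = g ↔ a * b = σ⁻¹ * g := by rw [eq_inv_mul_iff_mul_eq, mul_assoc]
    have h2 : ((Perm.sign σ : ℤ) : K) * ((Perm.sign σ : ℤ) : K) = 1 := by
      rw [← Int.cast_mul, ← Units.val_mul, Int.units_mul_self]; simp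
    simp only [h1, Perm.sign_mul, Units.val_mul, Int.cast_mul, smul_eq_mul]
    split_ifs
    · rw [← mul_assoc, h2, one_mul]
    · simp

/-- Elements of the left ideal generated by the Young symmetrizer are invariant under right
multiplication by the row stabilizer. -/
theorem coeff_mul_of_mem_spechtSub (T : Fin k ≃ μ.cells) {τ : Perm (Fin k)} (hτ : τ ∈ rowStab T)
    {x : MonoidAlgebra K (Perm (Fin k))} (hx : x ∈ spechtSub K T) (g : Perm (Fin k)) :
    x.coeff (g * τ) = x.coeff g := by
  classical
  change x ∈ Submodule.span K _ at hx
  induction hx using Submodule.span_induction generalizing g with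
  | mem x hx =>
    obtain ⟨h, rfl⟩ := hx
    simp only [coeff_leftRegular]
    rw [← mul_assoc]
    generalize h⁻¹ * g = g
    rw [youngSymmetrizer_coeff, youngSymmetrizer_coeff]
    refine Finset.sum_bij' (fun p _ => (p.1, p.2 * τ⁻¹)) (fun p _ => (p.1, p.2 * τ)) ?_ ?_ ?_ ?_ ?_
    · rintro ⟨a, b⟩ h
      simp only [Finset.mem_product, Finset.mem_filter, Finset.mem_univ, true_and] at h ⊢
      exact ⟨h.1, mul_mem h.2 (inv_mem hτ)⟩
    · rintro ⟨a, b⟩ h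
      simp only [Finset.mem_product, Finset.mem_filter, Finset.mem_univ, true_and] at h ⊢
      exact ⟨h.1, mul_mem h.2 hτ⟩
    · rintro ⟨a, b⟩ h; simp
    · rintro ⟨a, b⟩ h; simp
    · rintro ⟨a, b⟩ h
      have h1 : a * (b * τ⁻¹) = g ↔ a * b = g * τ := by rw [← mul_assoc, mul_inv_eq_iff_eq_mul]
      simp only [h1]
  | zero => simp
  | add x y _ _ hx hy => simp [hx, hy]
  | smul a x _ hx => simp [hx]

/-- The signed sum over the column stabilizer of `T`, acting in a representation. -/
noncomputable def colOp {V : Type*} [AddCommGroup V] [Module K V] (T : Fin k ≃ μ.cells)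
    (ρ : Representation K (Perm (Fin k)) V) : V →ₗ[K] V :=
  open Classical in
  ∑ σ ∈ Finset.univ.filter (· ∈ colStab T), ((Perm.sign σ : ℤ) : K) • ρ σ

theorem map_colOp {V W : Type*} [AddCommGroup V] [Module K V] [AddCommGroup W] [Module K W]
    (T : Fin k ≃ μ.cells) {ρ : Representation K (Perm (Fin k)) V}
    {σ : Representation K (Perm (Fin k)) W} (f : IntertwiningMap ρ σ) (v : V) :
    f (colOp T ρ v) = colOp T σ (f v) := by
  simp only [colOp, LinearMap.sum_apply, LinearMap.smul_apply, map_sum, map_smul, f.isIntertwining]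

theorem colOp_sign {V : Type*} [AddCommGroup V] [Module K V] (T : Fin k ≃ μ.cells)
    (ρ : Representation K (Perm (Fin k)) V) {σ : Perm (Fin k)} (hσ : σ ∈ colStab T) (v : V) :
    ρ σ (colOp T ρ v) = ((Perm.sign σ : ℤ) : K) • colOp T ρ v := by
  classical
  simp only [colOp, LinearMap.sum_apply, LinearMap.smul_apply, map_sum, map_smul, Finset.smul_sum]
  refine Finset.sum_bij' (fun τ _ => σ * τ) (fun τ _ => σ⁻¹ * τ) ?_ ?_ ?_ ?_ ?_
  · intro τ h
    simp only [Finset.mem_filter, Finset.mem_univ, true_and] at h ⊢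
    exact mul_mem hσ h
  · intro τ h
    simp only [Finset.mem_filter, Finset.mem_univ, true_and] at h ⊢
    exact mul_mem (inv_mem hσ) h
  · intro τ h; simp
  · intro τ h; simp
  · intro τ h
    have h2 : ((Perm.sign σ : ℤ) : K) * ((Perm.sign σ : ℤ) : K) = 1 := by
      rw [← Int.cast_mul, ← Units.val_mul, Int.units_mul_self]; simp
    simp only [Units.val_mul, Int.cast_mul, smul_smul, map_mul,
      Module.End.mul_apply]
    rw [← mul_assoc, h2, one_mul]

variable [CharZero K]

/-- A function on the symmetric group which is alternating under the column stabilizer of `S` on the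
left and invariant under the row stabilizer of `T` on the right vanishes at `g` if two points
share a row of `T` and their images under `g` share a column of `S`. -/
theorem coeff_eq_zero_of_swap {T : Fin k ≃ lam.cells} {S : Fin k ≃ μ.cells}
    {x : MonoidAlgebra K (Perm (Fin k))}
    (hl : ∀ σ ∈ colStab S, leftRegular K _ σ x = ((Perm.sign σ : ℤ) : K) • x)
    (hr : ∀ τ ∈ rowStab T, ∀ g, x.coeff (g * τ) = x.coeff g) {g : Perm (Fin k)} {i j : Fin k}
    (hij : i ≠ j) (hT : tabRow T i = tabRow T j) (hS : tabCol S (g i) = tabCol S (g j)) :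
    x.coeff g = 0 := by
  have h1 : swap i j ∈ rowStab T := apply_swap_eq_self (v := tabRow T) hT
  have h2 : swap (g i) (g j) ∈ colStab S := apply_swap_eq_self (v := tabCol S) hS
  have h3 : g * swap i j = swap (g i) (g j) * g := by
    rw [mul_swap_eq_swap_mul]
  have h4 := congrArg (fun y => y.coeff (swap (g i) (g j) * g)) (hl _ h2)
  simp only [coeff_leftRegular, inv_mul_cancel_left, MonoidAlgebra.coeff_smul,
    Finsupp.smul_apply] at h4
  rw [← h3, hr _ h1, Perm.sign_swap (g.injective.ne hij)] at h4
  simp only [Units.val_neg, Units.val_one, Int.cast_neg, Int.cast_one, smul_eq_mul, neg_mul,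
    one_mul] at h4
  exact self_eq_neg.mp h4

/-- The elements which are alternating under the column stabilizer on the left and invariant under
the row stabilizer on the right form the line spanned by the Young symmetrizer. -/
theorem eq_smul_youngSymmetrizer {T : Fin k ≃ μ.cells} {x : MonoidAlgebra K (Perm (Fin k))}
    (hl : ∀ σ ∈ colStab T, leftRegular K _ σ x = ((Perm.sign σ : ℤ) : K) • x)
    (hr : ∀ τ ∈ rowStab T, ∀ g, x.coeff (g * τ) = x.coeff g) :
    x = x.coeff 1 • youngSymmetrizer K T := by
  have key : ∀ y : MonoidAlgebra K (Perm (Fin k)),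
      (∀ σ ∈ colStab T, leftRegular K _ σ y = ((Perm.sign σ : ℤ) : K) • y) →
      (∀ τ ∈ rowStab T, ∀ g, y.coeff (g * τ) = y.coeff g) → y.coeff 1 = 0 → y = 0 := by
    intro y hl hr h0
    ext g
    rw [MonoidAlgebra.coeff_zero, Finsupp.zero_apply]
    by_cases h : ∃ i j, i ≠ j ∧ tabRow T i = tabRow T j ∧ tabCol T (g i) = tabCol T (g j)
    · obtain ⟨i, j, hij, hT, hS⟩ := h
      exact coeff_eq_zero_of_swap hl hr hij hT hS
    · push Not at h
      obtain ⟨σ, hσ, h1⟩ := exists_colStab_of_injective (T := (g⁻¹ : Perm _).trans T) (S := T)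
        fun x y hr hc => by
          by_contra hxy
          refine h (g⁻¹ x) (g⁻¹ y) (fun he => hxy (g⁻¹.injective he)) hr ?_
          simpa using hc
      have h2 : σ * g ∈ rowStab T := fun i => by
        have := h1 (g i)
        simpa [tabRow] using this
      have h3 := hr _ h2 σ⁻¹
      have h4 := congrArg (fun y => y.coeff 1) (hl _ hσ)
      simp only [coeff_leftRegular, MonoidAlgebra.coeff_smul, Finsupp.smul_apply, h0,
        smul_zero, mul_one] at h4
      rw [inv_mul_cancel_left] at h3
      rw [h3, h4]
  rw [← sub_eq_zero]
  refine key _ ?_ ?_ ?_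
  · intro σ hσ
    rw [map_sub, map_smul, hl σ hσ, leftRegular_youngSymmetrizer T hσ, smul_sub, smul_comm]
  · intro τ hτ g
    rw [MonoidAlgebra.coeff_sub, MonoidAlgebra.coeff_smul, Finsupp.sub_apply, Finsupp.sub_apply,
      Finsupp.smul_apply, Finsupp.smul_apply, hr τ hτ,
      coeff_mul_of_mem_spechtSub T hτ (Submodule.subset_span ⟨1, by simp⟩)]
  · rw [MonoidAlgebra.coeff_sub, MonoidAlgebra.coeff_smul, Finsupp.sub_apply,
      Finsupp.smul_apply, youngSymmetrizer_coeff_one]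
    simp

end YoungSymmetrizer

/-! ### Irreducible representations of the symmetric groups -/

section SpechtRep

open Representation

variable (K : Type*) [Field K] {k : ℕ} {lam μ : YoungDiagram}

instance (T : Fin k ≃ μ.cells) : FiniteDimensional K (spechtSub K T).toSubmodule := inferInstance

/-- The representation on the left ideal generated by the Young symmetrizer of `T`. -/
noncomputable def spechtRep (T : Fin k ≃ μ.cells) :
    Representation K (Perm (Fin k)) (spechtSub K T).toSubmodule :=
  (spechtSub K T).toRepresentation

/-- The Young symmetrizer as an element of the left ideal that it generates. -/
noncomputable def spechtGen (T : Fin k ≃ μ.cells) : (spechtSub K T).toSubmodule :=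
  ⟨youngSymmetrizer K T, Submodule.subset_span ⟨1, by simp⟩⟩

variable {K}

theorem spechtGen_ne_zero (T : Fin k ≃ μ.cells) : spechtGen K T ≠ 0 := by
  intro h
  have h1 := congrArg (fun y : (spechtSub K T).toSubmodule => y.1.coeff 1) h
  have h2 : (youngSymmetrizer K T).coeff 1 = 0 := h1
  rw [youngSymmetrizer_coeff_one] at h2
  exact one_ne_zero h2

instance (T : Fin k ≃ μ.cells) : Nontrivial (spechtSub K T).toSubmodule :=
  ⟨_, _, spechtGen_ne_zero T⟩

theorem spechtRep_coe (T : Fin k ≃ μ.cells) (g : Perm (Fin k)) (x : (spechtSub K T).toSubmodule) :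
    (spechtRep K T g x : MonoidAlgebra K (Perm (Fin k))) = leftRegular K _ g x.1 := rfl

/-- A linear map on the left ideal generated by the Young symmetrizer is determined by its values
on the translates of the Young symmetrizer. -/
theorem spechtRep_ext {W : Type*} [AddCommGroup W] [Module K W] (T : Fin k ≃ μ.cells)
    {f f' : (spechtSub K T).toSubmodule →ₗ[K] W}
    (h : ∀ g, f (spechtRep K T g (spechtGen K T)) = f' (spechtRep K T g (spechtGen K T))) :
    f = f' := by
  ext ⟨x, hx⟩
  change x ∈ Submodule.span K _ at hx
  induction hx using Submodule.span_induction with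
  | mem x hx =>
    obtain ⟨g, rfl⟩ := hx
    exact h g
  | zero =>
    have : (⟨0, (spechtSub K T).toSubmodule.zero_mem⟩ : (spechtSub K T).toSubmodule) = 0 := rfl
    rw [this, map_zero, map_zero]
  | add x y hx hy h1 h2 =>
    have : (⟨x + y, (spechtSub K T).toSubmodule.add_mem hx hy⟩ : (spechtSub K T).toSubmodule)
      = ⟨x, hx⟩ + ⟨y, hy⟩ := rfl
    rw [this, map_add, map_add, h1, h2]
  | smul a x hx h1 =>
    have : (⟨a • x, (spechtSub K T).toSubmodule.smul_mem a hx⟩ : (spechtSub K T).toSubmodule)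
      = a • ⟨x, hx⟩ := rfl
    rw [this, map_smul, map_smul, h1]

theorem spechtRep_hom_ext {W : Type*} [AddCommGroup W] [Module K W] (T : Fin k ≃ μ.cells)
    {σ : Representation K (Perm (Fin k)) W} {f f' : IntertwiningMap (spechtRep K T) σ}
    (h : f (spechtGen K T) = f' (spechtGen K T)) : f = f' := by
  apply IntertwiningMap.ext
  refine spechtRep_ext T fun g => ?_
  change f _ = f' _
  rw [f.isIntertwining, f'.isIntertwining, h]

variable [CharZero K]

theorem colOp_spechtGen (T : Fin k ≃ μ.cells) :
    ∃ c : K, c ≠ 0 ∧ colOp T (spechtRep K T) (spechtGen K T) = c • spechtGen K T := by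
  classical
  refine ⟨((Finset.univ.filter (· ∈ colStab T)).card : K), ?_, ?_⟩
  · rw [Nat.cast_ne_zero, ← Nat.pos_iff_ne_zero, Finset.card_pos]
    exact ⟨1, by simp [one_mem]⟩
  · rw [colOp, LinearMap.sum_apply, Nat.cast_smul_eq_nsmul, ← Finset.sum_const]
    refine Finset.sum_congr rfl fun σ hσ => ?_
    rw [LinearMap.smul_apply]
    apply Subtype.ext
    rw [Submodule.coe_smul, spechtRep_coe]
    change _ • leftRegular K _ σ (youngSymmetrizer K T) = _
    rw [leftRegular_youngSymmetrizer T (by simpa using hσ), smul_smul, ← Int.cast_mul,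
      ← Units.val_mul, Int.units_mul_self]
    simp [spechtGen]

omit [CharZero K] in
theorem colOp_coe_sign (T : Fin k ≃ lam.cells) (S : Fin k ≃ μ.cells)
    (x : (spechtSub K T).toSubmodule) {σ : Perm (Fin k)} (hσ : σ ∈ colStab S) :
    leftRegular K _ σ (colOp S (spechtRep K T) x).1
      = ((Perm.sign σ : ℤ) : K) • (colOp S (spechtRep K T) x).1 := by
  rw [← spechtRep_coe, colOp_sign S _ hσ]; rfl

/-- An endomorphism is determined by the image of the Young symmetrizer, which stays alternating
under the column stabilizer and therefore is a multiple of the Young symmetrizer. -/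
theorem homDim_spechtRep_self (T : Fin k ≃ μ.cells) : homDim (spechtRep K T) (spechtRep K T) = 1 := by
  refine homDim_eq_one_of_forall_smul fun f => ?_
  obtain ⟨c, hc, h⟩ := colOp_spechtGen (K := K) T
  have h1 : ∃ a : K, colOp T (spechtRep K T) (f (spechtGen K T)) = a • spechtGen K T :=
    ⟨_, Subtype.ext (eq_smul_youngSymmetrizer (fun σ hσ => colOp_coe_sign T T _ hσ)
      fun τ hτ g => coeff_mul_of_mem_spechtSub T hτ (Subtype.mem _) g)⟩
  obtain ⟨a, ha⟩ := h1
  rw [← map_colOp, h, map_smul] at ha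
  have h2 : f = (c⁻¹ * a) • IntertwiningMap.id (spechtRep K T) := by
    apply spechtRep_hom_ext
    rw [IntertwiningMap.smul_apply, IntertwiningMap.id_apply, mul_smul, ← ha, smul_smul,
      inv_mul_cancel₀ hc, one_smul]
  exact ⟨c⁻¹ * a, fun v => by rw [h2]; simp⟩

theorem spechtRep_isIrreducible (T : Fin k ≃ μ.cells) : (spechtRep K T).IsIrreducible :=
  isIrreducible_of_homDim_eq_one (homDim_spechtRep_self T)

/-- There is no nonzero map if the shape `μ` of the source does not dominate the shape of the target:
the image of the Young symmetrizer vanishes by `coeff_eq_zero_of_swap`. -/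
theorem homDim_spechtRep_eq_zero_of_not_le {T : Fin k ≃ lam.cells} {S : Fin k ≃ μ.cells} {q : ℕ}
    (hq : ∑ i ∈ Finset.range q, μ.rowLen i < ∑ i ∈ Finset.range q, lam.rowLen i) :
    homDim (spechtRep K S) (spechtRep K T) = 0 := by
  rw [homDim_eq_zero_iff]
  intro f
  obtain ⟨c, hc, h⟩ := colOp_spechtGen (K := K) S
  have h1 : colOp S (spechtRep K T) (f (spechtGen K S)) = 0 := by
    apply Subtype.ext
    ext g
    change _ = (0 : K)
    by_cases hb : ∃ i j, i ≠ j ∧ tabRow T i = tabRow T j ∧ tabCol S (g i) = tabCol S (g j)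
    · obtain ⟨i, j, hij, hT, hS⟩ := hb
      exact coeff_eq_zero_of_swap (fun σ hσ => colOp_coe_sign T S _ hσ)
        (fun τ hτ g => coeff_mul_of_mem_spechtSub T hτ (Subtype.mem _) g) hij hT hS
    · push Not at hb
      have := sum_rowLen_le (T := T) (S := (g : Perm _).trans S)
        (fun x y h1 h2 => by
          by_contra hxy
          exact hb x y hxy h1 h2) q
      omega
  rw [← map_colOp, h, map_smul] at h1
  apply spechtRep_hom_ext
  exact (smul_eq_zero.mp h1).resolve_left hc

theorem homDim_spechtRep_of_ne (T : Fin k ≃ lam.cells) (S : Fin k ≃ μ.cells) (h : lam ≠ μ) :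
    homDim (spechtRep K S) (spechtRep K T) = 0 := by
  obtain ⟨q, hq⟩ := not_forall.mp (mt YoungDiagram.eq_of_sum_rowLen_eq h)
  rcases lt_or_gt_of_ne hq with h1 | h1
  · rw [homDim_comm]; exact homDim_spechtRep_eq_zero_of_not_le h1
  · exact homDim_spechtRep_eq_zero_of_not_le h1

end SpechtRep

/-! ### Restriction to a smaller symmetric group -/

section Branching

open Representation

variable {K : Type*} [Field K] {a k : ℕ} {ν μ : YoungDiagram}

/-- The restriction of functions along the embedding of symmetric groups given by `f`. -/
noncomputable def restrictPerm (K : Type*) [Field K] (f : Fin a ↪ Fin k) :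
    IntertwiningMap (MonoidHom.comp (leftRegular K (Perm (Fin k))) (Perm.viaEmbeddingHom f))
      (leftRegular K (Perm (Fin a))) where
  toLinearMap := (MonoidAlgebra.coeffLinearEquiv K).symm.toLinearMap ∘ₗ
    Finsupp.lcomapDomain (Perm.viaEmbeddingHom f) (Perm.viaEmbeddingHom_injective f) ∘ₗ
    (MonoidAlgebra.coeffLinearEquiv K).toLinearMap
  isIntertwining' g := by
    apply LinearMap.ext
    intro x
    ext h
    change (leftRegular K _ (Perm.viaEmbeddingHom f g) x).coeff (Perm.viaEmbeddingHom f h) =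
      (leftRegular K _ g _).coeff h
    rw [coeff_leftRegular, coeff_leftRegular, ← map_inv, ← map_mul]
    rfl

theorem restrictPerm_coeff (f : Fin a ↪ Fin k) (x : MonoidAlgebra K (Perm (Fin k)))
    (h : Perm (Fin a)) : (restrictPerm K f x).coeff h = x.coeff (h.viaEmbedding f) := rfl

/-- If `S` is obtained from `T` by deleting the point `p`, restricting functions turns the
Young symmetrizer of `T` into that of `S`. -/
theorem restrictPerm_youngSymmetrizer {T : Fin k ≃ μ.cells} {S : Fin a ≃ ν.cells}
    {f : Fin a ↪ Fin k} (hf : ∀ i, (T (f i)).1 = (S i).1) {p : Fin k}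
    (hpr : p ∉ Set.range f) (hp : ∀ x, x ∉ Set.range f → x = p) :
    restrictPerm K f (youngSymmetrizer K T) = youngSymmetrizer K S := by
  classical
  ext h
  rw [restrictPerm_coeff, youngSymmetrizer_coeff, youngSymmetrizer_coeff]
  symm
  have hcol : ∀ σ : Perm (Fin a), σ.viaEmbedding f ∈ colStab T ↔ σ ∈ colStab S := by
    intro σ
    constructor
    · intro h i
      have := h (f i)
      rwa [Perm.viaEmbedding_apply, hf, hf] at this
    · intro h x
      by_cases hx : ∃ i, f i = x
      · obtain ⟨i, rfl⟩ := hx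
        rw [Perm.viaEmbedding_apply, hf, hf]; exact h i
      · rw [Perm.viaEmbedding_apply_of_notMem _ f _ hx]
  have hrow : ∀ σ : Perm (Fin a), σ.viaEmbedding f ∈ rowStab T ↔ σ ∈ rowStab S := by
    intro σ
    constructor
    · intro h i
      have := h (f i)
      rwa [Perm.viaEmbedding_apply, hf, hf] at this
    · intro h x
      by_cases hx : ∃ i, f i = x
      · obtain ⟨i, rfl⟩ := hx
        rw [Perm.viaEmbedding_apply, hf, hf]; exact h i
      · rw [Perm.viaEmbedding_apply_of_notMem _ f _ hx]
  refine Finset.sum_of_injOn (fun q => (q.1.viaEmbedding f, q.2.viaEmbedding f)) ?_ ?_ ?_ ?_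
  · rintro ⟨σ, τ⟩ - ⟨σ', τ'⟩ - hst
    exact Prod.ext (Perm.viaEmbeddingHom_injective f (Prod.mk.inj hst).1)
      (Perm.viaEmbeddingHom_injective f (Prod.mk.inj hst).2)
  · rintro ⟨σ, τ⟩ hst
    simp only [Finset.coe_product, Finset.coe_filter, Finset.mem_univ, true_and, Set.mem_prod,
      Set.mem_ofPred_eq] at hst ⊢
    exact ⟨(hcol σ).mpr hst.1, (hrow τ).mpr hst.2⟩
  · rintro ⟨σ, τ⟩ hst hnot
    simp only [Finset.mem_product, Finset.mem_filter, Finset.mem_univ, true_and] at hst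
    rw [if_neg]
    intro heq
    apply hnot
    have h1 : σ (τ p) = p := by
      have := DFunLike.congr_fun heq p
      rwa [Perm.viaEmbedding_apply_of_notMem _ f _ hpr] at this
    have h2 := apply_eq_of_mem_stab hst.1 hst.2 h1
    rw [h2] at h1
    obtain ⟨σ', rfl⟩ := exists_viaEmbedding_eq f (σ := σ) fun x hx => by rw [hp x hx, h1]
    obtain ⟨τ', rfl⟩ := exists_viaEmbedding_eq f (σ := τ) fun x hx => by rw [hp x hx, h2]
    refine ⟨(σ', τ'), ?_, rfl⟩
    simp only [Finset.coe_product, Finset.coe_filter, Finset.mem_univ, true_and, Set.mem_prod,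
      Set.mem_ofPred_eq]
    exact ⟨(hcol σ').mp hst.1, (hrow τ').mp hst.2⟩
  · rintro ⟨σ, τ⟩ hst
    have h1 : σ.viaEmbedding f * τ.viaEmbedding f = h.viaEmbedding f ↔ σ * τ = h := by
      rw [← Perm.viaEmbeddingHom_apply, ← Perm.viaEmbeddingHom_apply, ← Perm.viaEmbeddingHom_apply,
        ← map_mul, (Perm.viaEmbeddingHom_injective f).eq_iff]
    have h2 : Perm.sign (σ.viaEmbedding f) = Perm.sign σ := sign_viaEmbedding f σ
    simp only [h1, h2]

end Branching

section Branching

open Representation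

variable {K : Type*} [Field K] [CharZero K] {a k : ℕ} {ν μ : YoungDiagram}

omit [CharZero K] in
theorem character_viaEmbedding {V : Type*} [AddCommGroup V] [Module K V]
    (ρ : Representation K (Perm (Fin k)) V) (f g : Fin a ↪ Fin k) (σ : Perm (Fin a)) :
    character (MonoidHom.comp ρ (Perm.viaEmbeddingHom f)) σ =
      character (MonoidHom.comp ρ (Perm.viaEmbeddingHom g)) σ := by
  obtain ⟨π, hπ⟩ := exists_perm_comp_eq f g
  change ρ.character (σ.viaEmbedding f) = ρ.character (σ.viaEmbedding g)
  rw [viaEmbedding_conj hπ, char_conj]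

/-- If `ν` arises from `μ` by removing a box, then a tableau of shape `ν` is obtained from one of shape
`μ` by deleting one point `p` and renaming the others along `f`. -/
theorem exists_tableau_embedding (h : ν ∈ μ.down) (S : Fin a ≃ ν.cells) (T : Fin k ≃ μ.cells) :
    ∃ (f : Fin a ↪ Fin k) (p : Fin k), (∀ i, (T (f i)).1 = (S i).1) ∧ p ∉ Set.range f ∧
      ∀ x, x ∉ Set.range f → x = p := by
  obtain ⟨i, j, hn, he⟩ := YoungDiagram.exists_cells_eq_insert h
  have hsub : ∀ c : ν.cells, c.1 ∈ μ.cells := fun c => by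
    rw [he]; exact Finset.mem_insert_of_mem c.2
  have hc : (i, j) ∈ μ.cells := by rw [he]; exact Finset.mem_insert_self _ _
  refine ⟨⟨fun x => T.symm ⟨(S x).1, hsub _⟩, fun x y hxy => ?_⟩, T.symm ⟨(i, j), hc⟩, ?_, ?_, ?_⟩
  · have h1 := congrArg Subtype.val (T.symm.injective hxy)
    exact S.injective (Subtype.ext h1)
  · intro x
    exact congrArg Subtype.val (T.apply_symm_apply _)
  · rintro ⟨x, hx⟩
    have h1 : (S x).1 = (i, j) := congrArg Subtype.val (T.symm.injective hx)
    exact hn (h1 ▸ (S x).2)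
  · intro x hx
    rw [← T.symm_apply_apply x]
    congr 1
    rcases Finset.mem_insert.mp ((Finset.ext_iff.mp he _).mp (T x).2) with h2 | h2
    · exact Subtype.ext h2
    · refine absurd ⟨S.symm ⟨_, h2⟩, ?_⟩ hx
      have h3 : (S (S.symm ⟨(T x).1, h2⟩)).1 = (T x).1 := by rw [apply_symm_apply]
      exact (Equiv.symm_apply_eq T).mpr (Subtype.ext h3)

/-- Removing a box from `μ` yields a constituent of the restriction of the representation labelled
by `μ`: the restriction of functions maps the Young symmetrizer to the smaller one. -/
theorem homDim_spechtRep_restrict_ne_zero (h : ν ∈ μ.down) (S : Fin a ≃ ν.cells)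
    (T : Fin k ≃ μ.cells) (f : Fin a ↪ Fin k) :
    homDim (spechtRep K S) (MonoidHom.comp (spechtRep K T) (Perm.viaEmbeddingHom f)) ≠ 0 := by
  obtain ⟨g, p, hg, hp, hp'⟩ := exists_tableau_embedding h S T
  rw [homDim_congr (ρ := spechtRep K S) (fun _ => rfl) (character_viaEmbedding (spechtRep K T) f g)]
  let θ : IntertwiningMap (MonoidHom.comp (spechtRep K T) (Perm.viaEmbeddingHom g))
      (leftRegular K (Perm (Fin a))) :=
    ⟨(restrictPerm K g).toLinearMap ∘ₗ (spechtSub K T).toSubmodule.subtype, fun σ => by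
      apply LinearMap.ext
      intro x
      exact DFunLike.congr_fun ((restrictPerm K g).isIntertwining' σ) x.1⟩
  have hθ : θ (spechtGen K T) = (spechtGen K S).1 := restrictPerm_youngSymmetrizer hg hp hp'
  refine homDim_toRepresentation_ne_zero θ (spechtSub K S) (v := spechtGen K T) ?_ ?_
  · rw [hθ]; exact (spechtGen K S).2
  · rw [hθ]; exact fun h0 => spechtGen_ne_zero S (Subtype.ext h0)

/-- A tableau of a shape with `k` boxes. -/
noncomputable def tableauOfCard (μ : {μ : YoungDiagram // μ.card = k}) : Fin k ≃ μ.1.cells :=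
  (finCongr μ.2.symm).trans (someTableau μ.1)

omit [CharZero K] in
theorem finrank_spechtSub_tableauOfCard (μ : {μ : YoungDiagram // μ.card = k}) :
    Module.finrank K (spechtSub K (tableauOfCard μ)).toSubmodule =
      Module.finrank K (SpechtV K μ.1) := by
  obtain ⟨μ, rfl⟩ := μ
  rfl

theorem homDim_tableauOfCard_of_ne {μ ν : {μ : YoungDiagram // μ.card = k}} (h : μ ≠ ν) :
    homDim (spechtRep K (tableauOfCard μ)) (spechtRep K (tableauOfCard ν)) = 0 :=
  homDim_spechtRep_of_ne _ _ fun h' => h (Subtype.ext h'.symm)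

variable (K) in
theorem sum_down_finrank_le (μ : YoungDiagram) :
    ∑ ν ∈ μ.down, Module.finrank K (SpechtV K ν) ≤ Module.finrank K (SpechtV K μ) := by
  rcases Nat.eq_zero_or_pos μ.card with h0 | h0
  · rw [Finset.eq_empty_of_forall_notMem (s := μ.down) fun ν hν => by
      rw [YoungDiagram.mem_down] at hν; omega]
    simp
  obtain ⟨a, ha⟩ : ∃ a, μ.card = a + 1 := ⟨μ.card - 1, by omega⟩
  rw [← Finset.sum_subtype_of_mem (p := fun ν => ν.card = a) _ fun ν hν => by
    rw [YoungDiagram.mem_down] at hν; omega]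
  simp_rw [← finrank_spechtSub_tableauOfCard]
  exact (sum_finrank_le_and_character_eq (K := K) (fun ν => spechtRep K (tableauOfCard ν))
    (fun ν => spechtRep_isIrreducible _) (fun ν κ h => homDim_tableauOfCard_of_ne h)
    (μ.down.subtype fun ν => ν.card = a)
    (MonoidHom.comp (spechtRep K (someTableau μ))
      (Perm.viaEmbeddingHom (Fin.castLEEmb (by omega : a ≤ μ.card))))
    fun ν hν => homDim_spechtRep_restrict_ne_zero (by simpa using hν) _ _ _).1

variable (K) in
/-- By Frobenius reciprocity, the representations labelled by the diagrams with one box more occur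
in the induced representation. -/
theorem sum_up_finrank_le (ν : YoungDiagram) :
    ∑ μ ∈ ν.up, Module.finrank K (SpechtV K μ) ≤
      (ν.card + 1) * Module.finrank K (SpechtV K ν) := by
  rw [← Finset.sum_subtype_of_mem (p := fun μ => μ.card = ν.card + 1) _ fun μ hμ => by
    rw [YoungDiagram.mem_up] at hμ; omega]
  simp_rw [← finrank_spechtSub_tableauOfCard]
  let φ := Perm.viaEmbeddingHom (Fin.castLEEmb (Nat.le_succ ν.card))
  have h1 := (sum_finrank_le_and_character_eq (K := K) (fun μ => spechtRep K (tableauOfCard μ))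
    (fun μ => spechtRep_isIrreducible _) (fun ν κ h => homDim_tableauOfCard_of_ne h)
    (ν.up.subtype fun μ => μ.card = ν.card + 1)
    (ind φ (spechtRep K (someTableau ν)))
    fun μ hμ => by
      rw [homDim_comm, homDim_ind]
      refine homDim_spechtRep_restrict_ne_zero ?_ _ _ _
      rw [YoungDiagram.mem_down, ← YoungDiagram.mem_up]
      simpa using hμ).1
  refine h1.trans (le_of_eq ?_)
  have h2 := finrank_indV φ (spechtRep K (someTableau ν)) (Perm.viaEmbeddingHom_injective _)
  rw [Nat.card_perm, Nat.card_perm, Nat.card_fin, Nat.card_fin, Nat.factorial_succ] at h2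
  have h3 := Nat.factorial_pos ν.card
  apply Nat.eq_of_mul_eq_mul_left h3
  rw [h2]
  change _ = _ * (_ * Module.finrank K (spechtSub K (someTableau ν)).toSubmodule)
  ring

variable (K) in
/-- The branching rule for the dimensions of the irreducible representations of the symmetric
groups. -/
theorem sum_down_finrank {μ : YoungDiagram} (hμ : μ.card ≠ 0) :
    ∑ ν ∈ μ.down, Module.finrank K (SpechtV K ν) = Module.finrank K (SpechtV K μ) :=
  YoungDiagram.sum_down_eq_of_le (fun μ => Module.finrank K (SpechtV K μ)) (sum_down_finrank_le K)
    (sum_up_finrank_le K) hμ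

end Branching

/-! ### The group of type `D` in the group of type `B` -/

namespace HypOct

variable {m n : ℕ}

/-- The sign change at the point `i`. -/
def flip (i : Fin n) : HypOct n := SemidirectProduct.inl (Pi.mulSingle i (-1 : ℤˣ))

theorem t_eq_flip (i : Fin n) : t n (i + 1) = flip i := by
  rw [t_eq (Nat.succ_pos _) i.2]; rfl

theorem flip_mul_self (i : Fin n) : flip i * flip i = 1 := by
  rw [← t_eq_flip, t_mul_self]

theorem flip_inv (i : Fin n) : (flip i)⁻¹ = flip i := inv_eq_of_mul_eq_one_left (flip_mul_self i)

theorem signProd_flip (i : Fin n) : signProd n (flip i) = -1 := by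
  change ∏ j, (Pi.mulSingle i (-1 : ℤˣ) : Fin n → ℤˣ) j = -1
  rw [Finset.prod_pi_mulSingle', if_pos (Finset.mem_univ i)]

theorem signProd_inr (σ : Perm (Fin n)) : signProd n (SemidirectProduct.inr σ) = 1 := by
  change ∏ j : Fin n, (1 : ℤˣ) = 1
  simp

theorem signProd_s (k : ℕ) : signProd n (s n k) = 1 := by
  by_cases h : 0 < k ∧ k < n
  · rw [s_eq h.1 h.2, signProd_inr]
  · rw [s, dif_neg h, map_one]

theorem signProd_gen (k : ℕ) : signProd n (gen n k) = 1 := by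
  have h : ∀ g u : HypOct n, signProd n g = 1 → signProd n (u * g * u) = 1 := fun g u hg => by
    rw [map_mul, map_mul, hg, mul_one, Int.units_mul_self]
  unfold gen
  split_ifs
  · exact h _ _ (signProd_s _)
  · exact h _ _ (signProd_s _)
  · exact signProd_s _

theorem W_le_ker_signProd : W n ≤ (signProd n).ker := by
  rw [W, Subgroup.closure_le]
  rintro _ ⟨k, -, rfl⟩
  exact signProd_gen k

theorem inr_mem_W (σ : Perm (Fin n)) : SemidirectProduct.inr σ ∈ W n := by
  rcases n with _ | n
  · rw [Subsingleton.elim σ 1, map_one]; exact one_mem _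
  have h : (⊤ : Submonoid (Perm (Fin (n + 1)))) ≤
      (W (n + 1)).toSubmonoid.comap SemidirectProduct.inr := by
    rw [← Perm.mclosure_swap_castSucc_succ, Submonoid.closure_le]
    rintro _ ⟨i, rfl⟩
    have := s_mem_W (n := n + 1) (k := i + 1) (Nat.succ_pos _) (by omega)
    rw [s_eq (Nat.succ_pos _) (by omega)] at this
    exact this
  exact h (Submonoid.mem_top σ)

theorem flip_conj_mem_W (i : Fin n) {w : HypOct n} (hw : w ∈ W n) : flip i * w * flip i ∈ W n := by
  rw [← t_eq_flip]
  exact t_conj_mem_W (Nat.succ_pos _) i.2 hw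

theorem flip_mul_flip_mem_W (i j : Fin n) : flip i * flip j ∈ W n := by
  have h1 : flip j = SemidirectProduct.inr (swap i j) * flip i * SemidirectProduct.inr (swap i j) := by
    rw [flip, flip, inr_mul_inl_mulSingle, mul_assoc, ← map_mul, swap_mul_self, map_one, mul_one,
      swap_apply_left]
  rw [h1, ← mul_assoc, ← mul_assoc]
  exact mul_mem (flip_conj_mem_W i (inr_mem_W _)) (inr_mem_W _)

theorem mem_W_or_flip_mul_mem_W (i : Fin n) (g : HypOct n) : g ∈ W n ∨ flip i * g ∈ W n := by
  let P : Submonoid (HypOct n) :=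
    { carrier := {g | g ∈ W n ∨ flip i * g ∈ W n}
      one_mem' := Or.inl (one_mem _)
      mul_mem' := by
        rintro a b (ha | ha) (hb | hb)
        · exact Or.inl (mul_mem ha hb)
        · refine Or.inr ?_
          have h1 := mul_mem (flip_conj_mem_W i ha) hb
          rwa [mul_assoc, mul_assoc, ← mul_assoc (flip i) (flip i), flip_mul_self, one_mul] at h1
        · refine Or.inr ?_
          have h1 := mul_mem ha hb
          rwa [mul_assoc] at h1
        · refine Or.inl ?_
          have h1 := mul_mem (flip_conj_mem_W i ha) hb
          rw [mul_assoc (flip i * _) (flip i), ← mul_assoc (flip i) (flip i) b, flip_mul_self,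
            one_mul, ← mul_assoc (flip i) (flip i) a, flip_mul_self, one_mul] at h1
          exact h1 }
  have h1 : ∀ σ, SemidirectProduct.inr σ ∈ P := fun σ => Or.inl (inr_mem_W σ)
  have h2 : ∀ x : Fin n → ℤˣ, x ∈ P.comap SemidirectProduct.inl := by
    intro x
    rw [← Finset.univ_prod_mulSingle x]
    refine Submonoid.prod_mem _ fun j _ => ?_
    rcases Int.units_eq_one_or (x j) with h | h
    · rw [h, Pi.mulSingle_one]; exact one_mem _
    · rw [h]; exact Or.inr (flip_mul_flip_mem_W i j)
  have h3 := P.mul_mem (h2 g.left) (h1 g.right)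
  rwa [SemidirectProduct.inl_left_mul_inr_right] at h3

/-- The group of type `D_n` consists of the signed permutations with an even number of signs. -/
theorem mem_W_iff {g : HypOct n} : g ∈ W n ↔ signProd n g = 1 := by
  refine ⟨fun h => W_le_ker_signProd h, fun h => ?_⟩
  rcases n with _ | n
  · have h1 : g = SemidirectProduct.inr g.right :=
      SemidirectProduct.ext (Subsingleton.elim _ _) rfl
    rw [h1]; exact inr_mem_W _
  · refine (mem_W_or_flip_mul_mem_W 0 g).resolve_right fun h1 => ?_
    have h2 := W_le_ker_signProd h1
    rw [MonoidHom.mem_ker, map_mul, h, signProd_flip] at h2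
    exact absurd h2 (by decide)

theorem signProd_emb (f : Fin m ↪ Fin n) (g : HypOct m) : signProd n (emb f g) = signProd m g := by
  change ∏ j, Function.extend f g.left 1 j = ∏ i, g.left i
  symm
  refine Finset.prod_of_injOn f f.injective.injOn (by simp) ?_ ?_
  · intro j _ hj
    rw [Function.extend_apply']
    · rfl
    · rintro ⟨i, rfl⟩; exact hj ⟨i, by simp, rfl⟩
  · intro i _
    rw [f.injective.extend_apply]

theorem emb_mem_W (f : Fin m ↪ Fin n) {g : HypOct m} (hg : g ∈ W m) : emb f g ∈ W n := by
  rw [mem_W_iff, signProd_emb]; exact mem_W_iff.mp hg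

theorem flip_commute_emb (f : Fin m ↪ Fin n) {i : Fin n} (hi : i ∉ Set.range f) (g : HypOct m) :
    Commute (flip i) (emb f g) := by
  have h := emb_commute (⟨fun _ => i, fun _ _ _ => Subsingleton.elim _ _⟩ : Fin 1 ↪ Fin n) f
    (fun _ j h => hi ⟨j, h.symm⟩) (flip 0) g
  rw [flip, emb_inl_mulSingle] at h
  exact h

/-- Embeddings of type `B` groups along different injections of the points are conjugate. -/
theorem emb_conj {f g : Fin m ↪ Fin n} {π : Perm (Fin n)} (h : ∀ i, π (f i) = g i) (x : HypOct m) :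
    emb g x = SemidirectProduct.inr π * emb f x * (SemidirectProduct.inr π)⁻¹ := by
  apply SemidirectProduct.ext
  · funext j
    rw [← map_inv]
    simp only [SemidirectProduct.mul_left, SemidirectProduct.left_inr, SemidirectProduct.right_inr,
      SemidirectProduct.mul_right, map_one, mul_one, one_mul]
    change Function.extend g x.left 1 j = Function.extend f x.left 1 (π⁻¹ j)
    by_cases hj : ∃ i, g i = j
    · obtain ⟨i, rfl⟩ := hj
      rw [g.injective.extend_apply, ← h, Perm.inv_eq_iff_eq.mpr rfl, f.injective.extend_apply]
    · rw [Function.extend_apply' _ _ _ hj, Function.extend_apply']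
      · rfl
      · rintro ⟨i, hi⟩
        exact hj ⟨i, by rw [← h, hi]; simp⟩
  · rw [← map_inv]
    simp only [SemidirectProduct.right_inr, SemidirectProduct.mul_right, emb_right]
    exact viaEmbedding_conj h _

theorem character_emb {K V : Type*} [Field K] [AddCommGroup V] [Module K V]
    (ρ : Representation K (HypOct n) V) (f g : Fin m ↪ Fin n) (x : HypOct m) :
    Representation.character (MonoidHom.comp ρ (emb f)) x =
      Representation.character (MonoidHom.comp ρ (emb g)) x := by
  obtain ⟨π, hπ⟩ := exists_perm_comp_eq f g
  change ρ.character (emb f x) = ρ.character (emb g x)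
  rw [emb_conj hπ, Representation.char_conj]

theorem card_hypOct (n : ℕ) : Nat.card (HypOct n) = 2 ^ n * n.factorial := by
  rw [SemidirectProduct.card, Nat.card_perm, Nat.card_fin, Nat.card_fun]
  simp

end HypOct

/-! ### Sign characters and their kernels -/

namespace Representation

section Twist

variable {K G H : Type*} [Field K] [Group G] [Group H]
  {V W U : Type*} [AddCommGroup V] [Module K V] [AddCommGroup W] [Module K W]
  [AddCommGroup U] [Module K U]

theorem homDim_comp_surjective (ρ : Representation K G V) (σ : Representation K G W) {φ : H →* G}
    (hφ : Function.Surjective φ) :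
    homDim (MonoidHom.comp ρ φ) (MonoidHom.comp σ φ) = homDim ρ σ := by
  let e : IntertwiningMap ρ σ ≃ₗ[K]
      IntertwiningMap (MonoidHom.comp ρ φ) (MonoidHom.comp σ φ) :=
    { toFun := fun f => f.pull φ
      map_add' := fun _ _ => rfl
      map_smul' := fun _ _ => rfl
      invFun := fun f => ⟨f.toLinearMap, fun g => by
        obtain ⟨h, rfl⟩ := hφ g
        exact f.isIntertwining' h⟩
      left_inv := fun _ => rfl
      right_inv := fun _ => rfl }
  exact e.finrank_eq.symm

theorem character_signTwist (χ : G →* ℤˣ) (ρ : Representation K G V) (g : G) :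
    (signTwist χ ρ).character g = (((χ g : ℤˣ) : ℤ) : K) * ρ.character g := by
  change LinearMap.trace K V ((((χ g : ℤˣ) : ℤ) : K) • ρ g) = _
  rw [map_smul]; rfl

theorem intCast_units_mul_self (u : ℤˣ) : (((u : ℤˣ) : ℤ) : K) * (((u : ℤˣ) : ℤ) : K) = 1 := by
  rw [← Int.cast_mul, ← Units.val_mul, Int.units_mul_self]; simp

theorem sum_sign_eq_zero [CharZero K] [Fintype G] (χ : G →* ℤˣ) {t : G} (ht : χ t = -1) :
    ∑ g, (((χ g : ℤˣ) : ℤ) : K) = 0 := by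
  have h1 : ∑ g, (((χ g : ℤˣ) : ℤ) : K) = -∑ g, (((χ g : ℤˣ) : ℤ) : K) := by
    conv_lhs => rw [← Equiv.sum_comp (Equiv.mulLeft t)]
    rw [← Finset.sum_neg_distrib]
    refine Finset.sum_congr rfl fun g _ => ?_
    rw [Equiv.coe_mulLeft, map_mul, ht]
    simp
  exact self_eq_neg.mp h1

variable [FiniteDimensional K V] [FiniteDimensional K W] [FiniteDimensional K U]
  [CharZero K] [Finite G]

theorem homDim_signTwist (χ : G →* ℤˣ) (ρ : Representation K G V) (σ : Representation K G W) :
    homDim (signTwist χ ρ) (signTwist χ σ) = homDim ρ σ := by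
  cases nonempty_fintype G
  apply Nat.cast_injective (R := K)
  rw [← card_inv_mul_sum_char, ← card_inv_mul_sum_char]
  congr 1
  refine Finset.sum_congr rfl fun g _ => ?_
  rw [character_signTwist, character_signTwist, map_inv, Int.units_inv_eq_self, mul_mul_mul_comm,
    intCast_units_mul_self, one_mul]

/-- Restricting to the kernel `N` of a nontrivial sign character adds to the homomorphisms those
which change by the sign character. -/
theorem homDim_ker (χ : G →* ℤˣ) {N : Subgroup G} (hN : ∀ g, g ∈ N ↔ χ g = 1) {t : G}
    (ht : χ t = -1) (ρ : Representation K G V) (σ : Representation K G W) :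
    homDim (MonoidHom.comp ρ N.subtype) (MonoidHom.comp σ N.subtype) =
      homDim ρ σ + homDim ρ (signTwist χ σ) := by
  classical
  cases nonempty_fintype G
  have key : ∀ F : G → K, ∑ w : N, F w.1 + ∑ w : N, F w.1 =
      ∑ g, F g + ∑ g, (((χ g : ℤˣ) : ℤ) : K) * F g := by
    intro F
    have h1 : ∑ w : N, F w.1 = ∑ g, if g ∈ N then F g else 0 := by
      rw [← Finset.sum_filter]
      exact (Finset.sum_subtype _ (by simp) F).symm
    rw [h1, ← Finset.sum_add_distrib, ← Finset.sum_add_distrib]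
    refine Finset.sum_congr rfl fun g _ => ?_
    rcases Int.units_eq_one_or (χ g) with h | h
    · rw [if_pos ((hN g).mpr h), h]; simp
    · rw [if_neg (fun h' => by rw [(hN g).mp h'] at h; exact absurd h (by decide)), h]; simp
  have hsum := sum_sign_eq_zero (K := K) χ ht
  have hcard : (Nat.card N : K) + (Nat.card N : K) = (Nat.card G : K) := by
    have := key fun _ => 1
    simp only [mul_one, hsum, add_zero] at this
    simpa using this
  apply Nat.cast_injective (R := K)
  rw [Nat.cast_add, ← card_inv_mul_sum_char, ← card_inv_mul_sum_char, ← card_inv_mul_sum_char,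
    ← mul_add]
  have h2 := key fun g => σ.character g * ρ.character g⁻¹
  simp_rw [character_signTwist, mul_assoc]
  rw [← h2, ← hcard]
  have h3 : (Nat.card N : K) ≠ 0 := Nat.cast_ne_zero.mpr Nat.card_pos.ne'
  change (Nat.card N : K)⁻¹ * ∑ w : N, σ.character w.1 * ρ.character w.1⁻¹ = _
  rw [← two_mul, ← two_mul, mul_inv]
  field_simp

omit [FiniteDimensional K V] [FiniteDimensional K W] [FiniteDimensional K U] [CharZero K]
  [Finite G] in
/-- If every intertwining map into `τ` takes its values in the image of an embedding of `σ`, then it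
factors through `σ`. -/
theorem homDim_eq_of_range {ρ : Representation K G V} {σ : Representation K G W}
    {τ : Representation K G U} (ι : IntertwiningMap σ τ) (hι : Function.Injective ι)
    (h : ∀ (f : IntertwiningMap ρ τ) v, ∃ w, ι w = f v) : homDim ρ τ = homDim ρ σ := by
  symm
  refine (LinearEquiv.ofBijective (IntertwiningMap.llcomp ρ σ τ ι) ⟨?_, ?_⟩).finrank_eq
  · intro f f' hf
    apply IntertwiningMap.ext
    apply LinearMap.ext
    intro v
    exact hι (DFunLike.congr_fun hf v)
  · intro f
    choose s hs using h f
    refine ⟨⟨⟨⟨s, fun x y => hι ?_⟩, fun c x => hι ?_⟩, fun g => LinearMap.ext fun x => hι ?_⟩, ?_⟩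
    · rw [hs, map_add, map_add, hs, hs]
    · simp only [hs, map_smul, RingHom.id_apply]
    · change ι (s (ρ g x)) = ι (σ g (s x))
      rw [hs, f.isIntertwining, ι.isIntertwining, hs]
    · apply IntertwiningMap.ext
      apply LinearMap.ext
      exact hs

omit [FiniteDimensional K V] [CharZero K] [Finite G] [FiniteDimensional K W] in
theorem character_eq_of_isIrreducible {ρ : Representation K G V} {σ : Representation K G W}
    [ρ.IsIrreducible] [σ.IsIrreducible] {f : IntertwiningMap ρ σ} (hf : f ≠ 0) (g : G) :
    ρ.character g = σ.character g := by
  have h1 := (IsIrreducible.bijective_or_eq_zero f).resolve_right hf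
  rw [char_iso (IntertwiningMap.ofBijective f h1)]

end Twist

end Representation

/-! ### Products of groups of type `B` -/

namespace HypOct

variable {a b n : ℕ}

/-- The embedding of the first block of `a` points. -/
def fstEmb (h : a + b = n) : Fin a ↪ Fin n := (Fin.castAddEmb b).trans (finCongr h).toEmbedding

/-- The embedding of the last block of `b` points. -/
def sndEmb (h : a + b = n) : Fin b ↪ Fin n := (Fin.natAddEmb a).trans (finCongr h).toEmbedding

theorem fstEmb_val (h : a + b = n) (i : Fin a) : (fstEmb h i : ℕ) = i := rfl

theorem sndEmb_val (h : a + b = n) (i : Fin b) : (sndEmb h i : ℕ) = a + i := rfl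

theorem prodHom_apply (h : a + b = n) (x : HypOct a) (y : HypOct b) :
    prodHom h (x, y) = emb (fstEmb h) x * emb (sndEmb h) y := rfl

theorem fstEmb_ne_sndEmb (h : a + b = n) (i : Fin a) (j : Fin b) : fstEmb h i ≠ sndEmb h j := by
  intro hij
  have := congrArg Fin.val hij
  rw [fstEmb_val, sndEmb_val] at this
  omega

theorem mem_range_fstEmb (h : a + b = n) (j : Fin n) : j ∈ Set.range (fstEmb h) ↔ (j : ℕ) < a := by
  constructor
  · rintro ⟨i, rfl⟩; exact i.2
  · intro hj; exact ⟨⟨j, hj⟩, rfl⟩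

theorem mem_range_sndEmb (h : a + b = n) (j : Fin n) : j ∈ Set.range (sndEmb h) ↔ a ≤ (j : ℕ) := by
  constructor
  · rintro ⟨i, rfl⟩; rw [sndEmb_val]; omega
  · intro hj
    exact ⟨⟨j - a, by omega⟩, Fin.ext (by rw [sndEmb_val]; change a + (j - a) = (j : ℕ); omega)⟩

theorem prodHom_injective (h : a + b = n) : Function.Injective (prodHom h) := by
  rw [injective_iff_map_eq_one]
  rintro ⟨x, y⟩ hxy
  rw [prodHom_apply, mul_eq_one_iff_eq_inv, ← map_inv] at hxy
  -- An element supported on both blocks is trivial.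
  have hx : x = 1 := by
    apply SemidirectProduct.ext
    · funext i
      have := congrFun (congrArg SemidirectProduct.left hxy) (fstEmb h i)
      rw [emb_left, emb_left, (fstEmb h).injective.extend_apply, Function.extend_apply'] at this
      · exact this
      · rintro ⟨j, hj⟩; exact fstEmb_ne_sndEmb h i j hj.symm
    · ext1 i
      have := DFunLike.congr_fun (congrArg SemidirectProduct.right hxy) (fstEmb h i)
      rw [emb_right, emb_right, Perm.viaEmbedding_apply, Perm.viaEmbedding_apply_of_notMem] at this
      · exact (fstEmb h).injective this
      · rintro ⟨j, hj⟩; exact fstEmb_ne_sndEmb h i j hj.symm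
  subst hx
  rw [map_one, eq_comm, map_eq_one_iff _ (emb_injective _), inv_eq_one] at hxy
  rw [hxy]; rfl

theorem signProd_prodHom (h : a + b = n) (x : HypOct a) (y : HypOct b) :
    signProd n (prodHom h (x, y)) = signProd a x * signProd b y := by
  rw [prodHom_apply, map_mul, signProd_emb, signProd_emb]

/-- Every sign change lies in the product subgroup. -/
theorem prodHom_inl (h : a + b = n) (x : Fin n → ℤˣ) :
    prodHom h (SemidirectProduct.inl fun i => x (fstEmb h i),
      SemidirectProduct.inl fun i => x (sndEmb h i)) = SemidirectProduct.inl x := by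
  rw [prodHom_apply]
  apply SemidirectProduct.ext
  · funext j
    rw [SemidirectProduct.mul_left]
    have h1 : (emb (fstEmb h) (SemidirectProduct.inl fun i => x (fstEmb h i))).right = 1 := by
      rw [emb_right, SemidirectProduct.right_inl]; exact map_one (Perm.viaEmbeddingHom (fstEmb h))
    rw [h1, map_one, MulAut.one_apply, Pi.mul_apply, emb_left, emb_left,
      SemidirectProduct.left_inl, SemidirectProduct.left_inl, SemidirectProduct.left_inl]
    rcases lt_or_ge (j : ℕ) a with hj | hj
    · obtain ⟨i, rfl⟩ := (mem_range_fstEmb h j).mpr hj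
      rw [(fstEmb h).injective.extend_apply, Function.extend_apply', Pi.one_apply, mul_one]
      rintro ⟨k, hk⟩; exact fstEmb_ne_sndEmb h i k hk.symm
    · obtain ⟨i, rfl⟩ := (mem_range_sndEmb h j).mpr hj
      rw [(sndEmb h).injective.extend_apply, Function.extend_apply', Pi.one_apply, one_mul]
      rintro ⟨k, hk⟩; exact fstEmb_ne_sndEmb h k i hk
  · rw [SemidirectProduct.mul_right, emb_right, emb_right, SemidirectProduct.right_inl,
      SemidirectProduct.right_inl, SemidirectProduct.right_inl]
    exact (congrArg₂ (· * ·) (map_one (Perm.viaEmbeddingHom (fstEmb h)))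
      (map_one (Perm.viaEmbeddingHom (sndEmb h)))).trans (one_mul 1)

/-- A signed permutation whose permutation preserves the blocks lies in the product subgroup. -/
theorem exists_prodHom_eq (h : a + b = n) (g : HypOct n)
    (hg : ∀ i : Fin n, a ≤ (g.right i : ℕ) ↔ a ≤ (i : ℕ)) : ∃ l, prodHom h l = g := by
  have h1 : ∀ i, ∃ j, fstEmb h j = g.right (fstEmb h i) := fun i => by
    rw [← Set.mem_range, mem_range_fstEmb, ← not_le, hg, not_le]; exact i.2
  choose t ht using h1
  have hinj : Function.Injective t := fun i j hij => by
    apply (fstEmb h).injective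
    apply g.right.injective
    rw [← ht, ← ht, hij]
  let τ : Perm (Fin a) := Equiv.ofBijective t (Finite.injective_iff_bijective.mp hinj)
  obtain ⟨τ', hτ'⟩ := exists_viaEmbedding_eq (sndEmb h)
    (σ := (τ.viaEmbedding (fstEmb h))⁻¹ * g.right) fun x hx => by
      rw [mem_range_sndEmb, not_le, ← mem_range_fstEmb h] at hx
      obtain ⟨i, rfl⟩ := hx
      rw [Perm.mul_apply, Perm.inv_eq_iff_eq, Perm.viaEmbedding_apply]
      exact (ht i).symm
  refine ⟨(SemidirectProduct.inl fun i => g.left (fstEmb h i),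
    SemidirectProduct.inl fun i => g.left (sndEmb h i)) *
    (SemidirectProduct.inr τ, SemidirectProduct.inr τ'), ?_⟩
  rw [map_mul, prodHom_inl]
  have h2 : prodHom h (SemidirectProduct.inr τ, SemidirectProduct.inr τ') =
      SemidirectProduct.inr g.right := by
    rw [prodHom_apply, emb, emb, SemidirectProduct.map_inr, SemidirectProduct.map_inr, ← map_mul,
      Perm.viaEmbeddingHom_apply, Perm.viaEmbeddingHom_apply, hτ', mul_inv_cancel_left]
  rw [h2, SemidirectProduct.inl_left_mul_inr_right]

theorem emb_trans {c : ℕ} (f : Fin a ↪ Fin b) (g : Fin b ↪ Fin c) (x : HypOct a) :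
    emb (f.trans g) x = emb g (emb f x) := by
  apply SemidirectProduct.ext
  · funext j
    rw [emb_left, emb_left, emb_left]
    by_cases hj : ∃ i, g i = j
    · obtain ⟨i, rfl⟩ := hj
      rw [g.injective.extend_apply]
      by_cases hi : ∃ k, f k = i
      · obtain ⟨k, rfl⟩ := hi
        rw [f.injective.extend_apply]
        exact (f.trans g).injective.extend_apply _ _ k
      · rw [Function.extend_apply' _ _ _ hi, Function.extend_apply']
        · rfl
        · rintro ⟨k, hk⟩; exact hi ⟨k, g.injective hk⟩
    · rw [Function.extend_apply' _ _ _ hj, Function.extend_apply']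
      rintro ⟨k, hk⟩; exact hj ⟨f k, hk⟩
  · rw [emb_right, emb_right, emb_right]
    ext1 j
    by_cases hj : ∃ i, g i = j
    · obtain ⟨i, rfl⟩ := hj
      rw [Perm.viaEmbedding_apply]
      by_cases hi : ∃ k, f k = i
      · obtain ⟨k, rfl⟩ := hi
        rw [Perm.viaEmbedding_apply]
        exact Perm.viaEmbedding_apply _ (f.trans g) k
      · rw [Perm.viaEmbedding_apply_of_notMem _ f _ hi, Perm.viaEmbedding_apply_of_notMem]
        rintro ⟨k, hk⟩; exact hi ⟨k, g.injective hk⟩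
    · rw [Perm.viaEmbedding_apply_of_notMem _ g _ hj, Perm.viaEmbedding_apply_of_notMem]
      rintro ⟨k, hk⟩; exact hj ⟨f k, hk⟩

theorem inl_mul (x : Fin n → ℤˣ) (g : HypOct n) :
    SemidirectProduct.inl x * g = g * SemidirectProduct.inl fun i => x (g.right i) := by
  apply SemidirectProduct.ext
  · funext j
    rw [SemidirectProduct.mul_left, SemidirectProduct.mul_left, SemidirectProduct.right_inl,
      map_one, MulAut.one_apply, SemidirectProduct.left_inl, SemidirectProduct.left_inl, mul_comm]
    change g.left j * x j = g.left j * x (g.right (g.right⁻¹ j))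
    simp
  · simp

/-- The product of the signs on the points from `a` on. -/
def tailSign (n a : ℕ) : (Fin n → ℤˣ) →* ℤˣ where
  toFun x := ∏ i : Fin n, if a ≤ (i : ℕ) then x i else 1
  map_one' := by simp
  map_mul' x y := by
    rw [← Finset.prod_mul_distrib]
    refine Finset.prod_congr rfl fun i _ => ?_
    split_ifs <;> simp

theorem tailSign_mulSingle (n a : ℕ) (j : Fin n) :
    tailSign n a (Pi.mulSingle j (-1)) = if a ≤ (j : ℕ) then -1 else 1 := by
  change (∏ i : Fin n, if a ≤ (i : ℕ) then (Pi.mulSingle j (-1) : Fin n → ℤˣ) i else 1) = _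
  rw [Finset.prod_eq_single j]
  · simp
  · intro i _ hi
    rw [Pi.mulSingle_eq_of_ne hi]; simp
  · simp

theorem tailSign_eq (h : a + b = n) (x : Fin n → ℤˣ) :
    tailSign n a x = ∏ i, x (sndEmb h i) := by
  symm
  change _ = ∏ i : Fin n, if a ≤ (i : ℕ) then x i else 1
  refine Finset.prod_of_injOn (sndEmb h) (sndEmb h).injective.injOn (by simp) ?_ ?_
  · intro j _ hj
    rw [if_neg]
    rw [← mem_range_sndEmb h]
    rintro ⟨i, rfl⟩; exact hj ⟨i, by simp, rfl⟩
  · intro i _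
    rw [if_pos (by rw [sndEmb_val]; omega)]

end HypOct

/-! ### Representations of the groups of type `B` -/

section TypeB

open Representation

variable (K : Type*) [Field K] {a b n : ℕ} {lam μ : YoungDiagram}

/-- The left ideal generated by the Young symmetrizer of `T`, as a type of its own: instances on
tensor products and induced representations are then found without unfolding the submodule. -/
def YoungV (T : Fin a ≃ μ.cells) : Type _ := (spechtSub K T).toSubmodule

section

variable (T : Fin a ≃ μ.cells)

noncomputable instance : AddCommGroup (YoungV K T) :=
  inferInstanceAs (AddCommGroup (spechtSub K T).toSubmodule)

noncomputable instance : Module K (YoungV K T) :=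
  inferInstanceAs (Module K (spechtSub K T).toSubmodule)

instance : FiniteDimensional K (YoungV K T) :=
  inferInstanceAs (FiniteDimensional K (spechtSub K T).toSubmodule)

instance : Nontrivial (YoungV K T) :=
  inferInstanceAs (Nontrivial (spechtSub K T).toSubmodule)

/-- The representation of the symmetric group on the left ideal generated by the Young symmetrizer
of `T`. -/
noncomputable def youngRep : Representation K (Perm (Fin a)) (YoungV K T) := spechtRep K T

end

/-- The representation `[λ] ⊠ (ε' ⊗ [μ])` of the product of the groups of types `B_a` and `B_b`, for
tableaux of shapes `λ` and `μ`. -/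
noncomputable def boxRep (T₁ : Fin a ≃ lam.cells) (T₂ : Fin b ≃ μ.cells) :
    Representation K (HypOct a × HypOct b)
      (TensorProduct K (YoungV K T₁) (YoungV K T₂)) :=
  boxTensor (MonoidHom.comp (youngRep K T₁) SemidirectProduct.rightHom)
    (signTwist (signProd b) (MonoidHom.comp (youngRep K T₂) SemidirectProduct.rightHom))

/-- The representation of the type `B_n` group attached to tableaux of two shapes. -/
noncomputable abbrev indRep (h : a + b = n) (T₁ : Fin a ≃ lam.cells) (T₂ : Fin b ≃ μ.cells) :
    Representation K (HypOct n) (IndV (prodHom h) (boxRep K T₁ T₂)) :=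
  ind (prodHom h) (boxRep K T₁ T₂)

instance : Finite (HypOct n) := Finite.of_equiv _ SemidirectProduct.equivProd.symm

variable {K}

theorem boxRep_tmul (T₁ : Fin a ≃ lam.cells) (T₂ : Fin b ≃ μ.cells) (x : HypOct a) (y : HypOct b)
    (u : YoungV K T₁) (v : YoungV K T₂) :
    boxRep K T₁ T₂ (x, y) (TensorProduct.tmul K u v) = (((signProd b y : ℤˣ) : ℤ) : K) •
      TensorProduct.tmul K (youngRep K T₁ x.right u) (youngRep K T₂ y.right v) := by
  rw [← TensorProduct.tmul_smul]; rfl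

instance (T₁ : Fin a ≃ lam.cells) (T₂ : Fin b ≃ μ.cells) :
    Nontrivial (TensorProduct K (YoungV K T₁) (YoungV K T₂)) := by
  apply Module.nontrivial_of_finrank_pos (R := K)
  rw [Module.finrank_tensorProduct]
  exact Nat.mul_pos Module.finrank_pos Module.finrank_pos

variable (T₁ : Fin a ≃ lam.cells) (T₂ : Fin b ≃ μ.cells) (h : a + b = n)

theorem indRep_inl_mk_one (x : Fin n → ℤˣ)
    (u : TensorProduct K (YoungV K T₁) (YoungV K T₂)) :
    indRep K h T₁ T₂ (SemidirectProduct.inl x) (IndV.mk _ _ 1 u) =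
      (((tailSign n a x : ℤˣ) : ℤ) : K) • IndV.mk (prodHom h) (boxRep K T₁ T₂) 1 u := by
  rw [← prodHom_inl h x, ind_map_mk_one, ← map_smul]
  congr 1
  induction u using TensorProduct.induction_on with
  | zero => simp
  | tmul u v =>
    rw [boxRep_tmul, SemidirectProduct.right_inl, SemidirectProduct.right_inl, map_one, map_one,
      tailSign_eq h]
    rfl
  | add u v hu hv => rw [map_add, hu, hv, smul_add]

variable [CharZero K]

/-- A vector of `indRep` on which sign changes act through the product of the signs on the points
from `a` on is a combination of translates by those `g` whose permutation matches that set of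
points with the last block. -/
theorem mem_of_tailSign {c : ℕ} {y : IndV (prodHom h) (boxRep K T₁ T₂)}
    (hy : ∀ x, indRep K h T₁ T₂ (SemidirectProduct.inl x) y =
      (((tailSign n c x : ℤˣ) : ℤ) : K) • y)
    (Q : Submodule K (IndV (prodHom h) (boxRep K T₁ T₂)))
    (hQ : ∀ (g : HypOct n) u, (∀ i, c ≤ (g.right i : ℕ) ↔ a ≤ (i : ℕ)) →
      indRep K h T₁ T₂ g (IndV.mk _ _ 1 u) ∈ Q) : y ∈ Q := by
  -- `p` is a multiple of the projection to the weight space.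
  let p : Module.End K (IndV (prodHom h) (boxRep K T₁ T₂)) :=
    ∑ x : Fin n → ℤˣ, (((tailSign n c x : ℤˣ) : ℤ) : K) •
      indRep K h T₁ T₂ (SemidirectProduct.inl x)
  have hp : p y = (Fintype.card (Fin n → ℤˣ) : K) • y := by
    rw [LinearMap.sum_apply, Nat.cast_smul_eq_nsmul, ← Finset.card_univ, ← Finset.sum_const]
    refine Finset.sum_congr rfl fun x _ => ?_
    rw [LinearMap.smul_apply, hy, smul_smul, intCast_units_mul_self, one_smul]
  have hpQ : Q.mkQ ∘ₗ p = 0 := by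
    apply IndV.hom_ext
    intro g
    apply LinearMap.ext
    intro u
    change Q.mkQ (p (IndV.mk _ _ g u)) = 0
    rw [indV_mk_eq]
    generalize g⁻¹ = g
    rw [Submodule.mkQ_apply, Submodule.Quotient.mk_eq_zero]
    have h1 : p (indRep K h T₁ T₂ g (IndV.mk _ _ 1 u)) =
        (∑ x : Fin n → ℤˣ, (((tailSign n c x * tailSign n a (fun i => x (g.right i)) : ℤˣ) : ℤ) : K))
          • indRep K h T₁ T₂ g (IndV.mk _ _ 1 u) := by
      rw [LinearMap.sum_apply, Finset.sum_smul]
      refine Finset.sum_congr rfl fun x _ => ?_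
      rw [LinearMap.smul_apply, ← Module.End.mul_apply, ← map_mul, inl_mul, map_mul,
        Module.End.mul_apply, indRep_inl_mk_one, map_smul, smul_smul, Units.val_mul, Int.cast_mul]
    rw [h1]
    by_cases hg : ∀ i, c ≤ (g.right i : ℕ) ↔ a ≤ (i : ℕ)
    · exact Q.smul_mem _ (hQ g u hg)
    · obtain ⟨i, hi⟩ := not_forall.mp hg
      let ψ : (Fin n → ℤˣ) →* ℤˣ := tailSign n c *
        (tailSign n a).comp
          { toFun := fun x j => x (g.right j), map_one' := rfl, map_mul' := fun _ _ => rfl }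
      have h2 : ψ (Pi.mulSingle (g.right i) (-1)) = -1 := by
        have h3 : (fun j => (Pi.mulSingle (g.right i) (-1) : Fin n → ℤˣ) (g.right j)) =
            Pi.mulSingle i (-1) := by
          funext j
          by_cases hj : j = i
          · subst hj; simp
          · rw [Pi.mulSingle_eq_of_ne hj, Pi.mulSingle_eq_of_ne (g.right.injective.ne hj)]
        change tailSign n c _ * tailSign n a (fun j =>
          (Pi.mulSingle (g.right i) (-1) : Fin n → ℤˣ) (g.right j)) = -1
        rw [h3, tailSign_mulSingle, tailSign_mulSingle]
        by_cases h4 : c ≤ (g.right i : ℕ) <;> by_cases h5 : a ≤ (i : ℕ) <;> simp_all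
      have h6 := sum_sign_eq_zero (K := K) ψ h2
      change (∑ x, (((ψ x : ℤˣ) : ℤ) : K)) • _ ∈ Q
      rw [h6, zero_smul]
      exact Q.zero_mem
  have h1 : Q.mkQ (p y) = 0 := LinearMap.congr_fun hpQ y
  rw [hp, map_smul, smul_eq_zero] at h1
  rw [← Submodule.Quotient.mk_eq_zero]
  exact h1.resolve_left (Nat.cast_ne_zero.mpr Fintype.card_ne_zero)

end TypeB

section TypeB

open Representation

variable {K : Type*} [Field K] [CharZero K] {a b c d n : ℕ} {lam μ lam' μ' : YoungDiagram}

theorem homDim_youngRep_self (T : Fin a ≃ μ.cells) : homDim (youngRep K T) (youngRep K T) = 1 :=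
  homDim_spechtRep_self T

theorem homDim_youngRep_of_ne (T : Fin a ≃ lam.cells) (S : Fin a ≃ μ.cells) (h : lam ≠ μ) :
    homDim (youngRep K T) (youngRep K S) = 0 :=
  homDim_spechtRep_of_ne S T h.symm

theorem homDim_boxRep (T₁ : Fin a ≃ lam.cells) (T₂ : Fin b ≃ μ.cells) (S₁ : Fin a ≃ lam'.cells)
    (S₂ : Fin b ≃ μ'.cells) :
    homDim (boxRep K T₁ T₂) (boxRep K S₁ S₂) =
      homDim (youngRep K T₁) (youngRep K S₁) * homDim (youngRep K T₂) (youngRep K S₂) := by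
  rw [boxRep, boxRep, homDim_boxTensor, homDim_signTwist,
    homDim_comp_surjective _ _ SemidirectProduct.rightHom_surjective,
    homDim_comp_surjective _ _ SemidirectProduct.rightHom_surjective]

theorem boxRep_isIrreducible (T₁ : Fin a ≃ lam.cells) (T₂ : Fin b ≃ μ.cells) :
    (boxRep K T₁ T₂).IsIrreducible :=
  isIrreducible_of_homDim_eq_one (by rw [homDim_boxRep, homDim_youngRep_self, homDim_youngRep_self])

theorem indIncl_boxRep_injective (T₁ : Fin a ≃ lam.cells) (T₂ : Fin b ≃ μ.cells) (h : a + b = n) :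
    Function.Injective (indIncl (prodHom h) (boxRep K T₁ T₂)) := by
  have := boxRep_isIrreducible (K := K) T₁ T₂
  exact (IsIrreducible.injective_or_eq_zero _).resolve_right
    (indIncl_ne_zero _ _ (prodHom_injective h))

omit [CharZero K] in
/-- Sign changes act on the image of an intertwining map as they do on the inducing subspace. -/
theorem intertwiningMap_tailSign {V : Type*} [AddCommGroup V] [Module K V]
    {T₁ : Fin a ≃ lam.cells} {T₂ : Fin b ≃ μ.cells} (h : a + b = n)
    {ρ : Representation K (HypOct n) V}
    (f : IntertwiningMap (boxRep K T₁ T₂) (MonoidHom.comp ρ (prodHom h)))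
    (x : Fin n → ℤˣ) (u) : ρ (SemidirectProduct.inl x) (f u) =
      (((tailSign n a x : ℤˣ) : ℤ) : K) • f u := by
  have h1 := congrArg ((indHomEquiv _ _ _).symm f) (indRep_inl_mk_one (K := K) T₁ T₂ h x u)
  rw [map_smul, indHomEquiv_symm_mk_one, IntertwiningMap.isIntertwining,
    indHomEquiv_symm_mk_one] at h1
  exact h1

/-- For blocks of different sizes the sign changes act on the inducing subspaces through characters
in different orbits. -/
theorem homDim_indRep_of_ne (T₁ : Fin a ≃ lam.cells) (T₂ : Fin b ≃ μ.cells)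
    (S₁ : Fin c ≃ lam'.cells) (S₂ : Fin d ≃ μ'.cells) (h : a + b = n) (h' : c + d = n)
    (hne : a ≠ c) : homDim (indRep K h T₁ T₂) (indRep K h' S₁ S₂) = 0 := by
  rw [homDim_ind, homDim_eq_zero_iff]
  intro f
  apply IntertwiningMap.ext
  apply LinearMap.ext
  intro u
  have h1 := mem_of_tailSign S₁ S₂ h' (c := a) (intertwiningMap_tailSign h f · u) ⊥ fun g v hg => by
    exfalso
    -- A permutation cannot match two final segments of different sizes.
    have h2 : (Finset.univ.filter fun i : Fin n => a ≤ (i : ℕ)).card =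
        (Finset.univ.filter fun i : Fin n => c ≤ (i : ℕ)).card := by
      symm
      refine Finset.card_bij (fun i _ => g.right i) ?_ (fun _ _ _ _ h => g.right.injective h) ?_
      · intro i hi
        simpa [hg] using hi
      · intro j hj
        refine ⟨g.right⁻¹ j, ?_, by simp⟩
        simp only [Finset.mem_filter, Finset.mem_univ, true_and] at hj ⊢
        rw [← hg]; simpa using hj
    have h3 : ∀ {a b : ℕ} (_ : a + b = n),
        (Finset.univ.filter fun i : Fin n => a ≤ (i : ℕ)).card = b := by
      intro a b h
      rw [← Finset.card_fin b]
      symm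
      refine Finset.card_bij (fun i _ => sndEmb h i) ?_ (fun _ _ _ _ h' => (sndEmb h).injective h') ?_
      · intro i _; simp [sndEmb_val]
      · intro j hj
        obtain ⟨i, hi⟩ := (mem_range_sndEmb h j).mpr (by simpa using hj)
        exact ⟨i, Finset.mem_univ _, hi⟩
    rw [h3 h, h3 h'] at h2
    omega
  exact h1

/-- An intertwining map takes the inducing subspace of its source to that of its target, since the
two are the weight spaces for the same character of the sign changes. -/
theorem homDim_indRep (T₁ : Fin a ≃ lam.cells) (T₂ : Fin b ≃ μ.cells) (S₁ : Fin a ≃ lam'.cells)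
    (S₂ : Fin b ≃ μ'.cells) (h : a + b = n) :
    homDim (indRep K h T₁ T₂) (indRep K h S₁ S₂) =
      homDim (youngRep K T₁) (youngRep K S₁) * homDim (youngRep K T₂) (youngRep K S₂) := by
  rw [homDim_ind, ← homDim_boxRep]
  refine homDim_eq_of_range (indIncl _ _) (indIncl_boxRep_injective _ _ h) fun f u => ?_
  refine mem_of_tailSign S₁ S₂ h (c := a) (intertwiningMap_tailSign h f · u)
    (LinearMap.range (IndV.mk (prodHom h) (boxRep K S₁ S₂) 1)) fun g v hg => ?_
  obtain ⟨l, rfl⟩ := exists_prodHom_eq h g hg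
  exact ⟨boxRep K S₁ S₂ l v, (ind_map_mk_one _ _ l v).symm⟩

theorem indRep_isIrreducible (T₁ : Fin a ≃ lam.cells) (T₂ : Fin b ≃ μ.cells) (h : a + b = n) :
    (indRep K h T₁ T₂).IsIrreducible :=
  isIrreducible_of_homDim_eq_one (by rw [homDim_indRep, homDim_youngRep_self, homDim_youngRep_self])

omit [CharZero K] in
theorem character_typeB_eq (γ : Bipartition n) (h₁ : γ.fst.card = a) (h₂ : γ.snd.card = b)
    (h : a + b = n) (g : HypOct n) : (typeB K γ).character g =
      (indRep K h (tableauOfCard ⟨γ.fst, h₁⟩) (tableauOfCard ⟨γ.snd, h₂⟩)).character g := by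
  subst h₁ h₂
  rfl

instance (μ : YoungDiagram) : FiniteDimensional K (SpechtV K μ) :=
  inferInstanceAs (FiniteDimensional K (spechtSub K (someTableau μ)).toSubmodule)

open Classical in
theorem homDim_typeB (γ δ : Bipartition n) :
    homDim (typeB K γ) (typeB K δ) = if γ = δ then 1 else 0 := by
  by_cases h₁ : δ.fst.card = γ.fst.card
  · have h₂ : δ.snd.card = γ.snd.card := by have := γ.card_add; have := δ.card_add; omega
    have h0 : homDim (typeB K γ) (typeB K δ) =
        homDim (indRep K γ.card_add (someTableau γ.fst) (someTableau γ.snd))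
          (indRep K γ.card_add (tableauOfCard ⟨δ.fst, h₁⟩) (tableauOfCard ⟨δ.snd, h₂⟩)) :=
      homDim_congr (fun _ => rfl) (character_typeB_eq δ h₁ h₂ γ.card_add)
    rw [h0, homDim_indRep]
    split_ifs with h
    · subst h
      have e₁ : tableauOfCard ⟨γ.fst, h₁⟩ = someTableau γ.fst := rfl
      have e₂ : tableauOfCard ⟨γ.snd, h₂⟩ = someTableau γ.snd := rfl
      rw [e₁, e₂, homDim_youngRep_self, homDim_youngRep_self]
    · by_cases h3 : γ.fst = δ.fst
      · have h4 : γ.snd ≠ δ.snd := fun h4 => h (Bipartition.ext h3 h4)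
        rw [homDim_youngRep_of_ne (K := K) (someTableau γ.snd) _ h4, mul_zero]
      · rw [homDim_youngRep_of_ne (K := K) (someTableau γ.fst) _ h3, zero_mul]
  · rw [if_neg (by rintro rfl; exact h₁ rfl)]
    exact homDim_indRep_of_ne _ _ _ _ _ _ (Ne.symm h₁)

instance typeB_isIrreducible (γ : Bipartition n) : (typeB K γ).IsIrreducible :=
  indRep_isIrreducible _ _ _

theorem finrank_typeB (γ : Bipartition n) :
    γ.fst.card.factorial * γ.snd.card.factorial * Module.finrank K (TypeBV K γ) =
      n.factorial * (Module.finrank K (SpechtV K γ.fst) * Module.finrank K (SpechtV K γ.snd)) := by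
  have h1 := finrank_indV (prodHom γ.card_add) (typeBInner K γ) (prodHom_injective _)
  rw [Nat.card_prod, card_hypOct, card_hypOct, card_hypOct, Module.finrank_tensorProduct] at h1
  have h2 : 2 ^ γ.fst.card * 2 ^ γ.snd.card = 2 ^ n := by rw [← pow_add, γ.card_add]
  apply Nat.eq_of_mul_eq_mul_left (show 0 < 2 ^ n by positivity)
  refine Eq.trans ?_ (h1.trans (by ring))
  rw [← h2]
  ring

end TypeB

/-! ### Exchanging the components of a bipartition -/

namespace HypOct

variable {a b n : ℕ}

/-- The permutation exchanging the block of the first `a` and that of the last `b` points. -/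
def blockSwap (h : a + b = n) (h' : b + a = n) : Perm (Fin n) :=
  (finCongr h).symm.trans (finAddFlip.trans (finCongr h'))

theorem blockSwap_fstEmb (h : a + b = n) (h' : b + a = n) (i : Fin a) :
    blockSwap h h' (fstEmb h i) = sndEmb h' i := by
  subst h
  simp [blockSwap, fstEmb, sndEmb]

theorem blockSwap_sndEmb (h : a + b = n) (h' : b + a = n) (i : Fin b) :
    blockSwap h h' (sndEmb h i) = fstEmb h' i := by
  subst h
  simp [blockSwap, fstEmb, sndEmb]

theorem blockSwap_mul_self (h : a + a = n) : blockSwap h h * blockSwap h h = 1 := by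
  ext1 j
  rw [Perm.mul_apply, Perm.one_apply]
  rcases lt_or_ge (j : ℕ) a with hj | hj
  · obtain ⟨i, rfl⟩ := (mem_range_fstEmb h j).mpr hj
    rw [blockSwap_fstEmb, blockSwap_sndEmb]
  · obtain ⟨i, rfl⟩ := (mem_range_sndEmb h j).mpr hj
    rw [blockSwap_sndEmb, blockSwap_fstEmb]

theorem prodHom_swap (h : a + b = n) (h' : b + a = n) (x : HypOct a) (y : HypOct b) :
    prodHom h' (y, x) * SemidirectProduct.inr (blockSwap h h') =
      SemidirectProduct.inr (blockSwap h h') * prodHom h (x, y) := by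
  rw [prodHom_apply, prodHom_apply, emb_conj (blockSwap_fstEmb h h'), emb_conj (blockSwap_sndEmb h h'),
    (emb_commute (fstEmb h) (sndEmb h) (fstEmb_ne_sndEmb h) x y).eq]
  group

end HypOct

section TypeB

open Representation

variable {K : Type*} [Field K] {a b n : ℕ} {lam μ : YoungDiagram}

/-- The map `u ⊗ v ↦ w (v ⊗ u)`, where `w` exchanges the two blocks. -/
noncomputable def swapBox (h : a + b = n) (h' : b + a = n) (T₁ : Fin a ≃ lam.cells)
    (T₂ : Fin b ≃ μ.cells) :
    IntertwiningMap (boxRep K T₂ T₁)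
      (MonoidHom.comp (signTwist (signProd n) (indRep K h T₁ T₂)) (prodHom h')) :=
  ⟨indRep K h T₁ T₂ (SemidirectProduct.inr (blockSwap h h')) ∘ₗ
      IndV.mk (prodHom h) (boxRep K T₁ T₂) 1 ∘ₗ
      (TensorProduct.comm K (YoungV K T₂) (YoungV K T₁)).toLinearMap, by
    rintro ⟨y, x⟩
    apply TensorProduct.ext'
    intro v u
    have h1 : (((signProd a x : ℤˣ) : ℤ) : K) • indRep K h T₁ T₂
          (SemidirectProduct.inr (blockSwap h h')) (IndV.mk (prodHom h) (boxRep K T₁ T₂) 1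
            (TensorProduct.tmul K (youngRep K T₁ x.right u) (youngRep K T₂ y.right v))) =
        (((signProd n (prodHom h' (y, x)) : ℤˣ) : ℤ) : K) • indRep K h T₁ T₂ (prodHom h' (y, x))
          (indRep K h T₁ T₂ (SemidirectProduct.inr (blockSwap h h'))
            (IndV.mk (prodHom h) (boxRep K T₁ T₂) 1 (TensorProduct.tmul K u v))) := by
      rw [← Module.End.mul_apply (indRep K h T₁ T₂ (prodHom h' (y, x))), ← map_mul, prodHom_swap h h',
        map_mul, Module.End.mul_apply, ind_map_mk_one, boxRep_tmul, map_smul, map_smul, smul_smul,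
        signProd_prodHom, Units.val_mul, Int.cast_mul, mul_assoc, mul_left_comm,
        intCast_units_mul_self, mul_one]
    refine Eq.trans ?_ h1
    change indRep K h T₁ T₂ _ (IndV.mk (prodHom h) (boxRep K T₁ T₂) 1
      (TensorProduct.comm K (YoungV K T₂) (YoungV K T₁)
        (boxRep K T₂ T₁ (y, x) (TensorProduct.tmul K v u)))) = _
    rw [boxRep_tmul, map_smul, TensorProduct.comm_tmul, map_smul, map_smul]⟩

theorem swapBox_tmul (h : a + b = n) (h' : b + a = n) (T₁ : Fin a ≃ lam.cells)
    (T₂ : Fin b ≃ μ.cells) (u : YoungV K T₁) (v : YoungV K T₂) :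
    swapBox h h' T₁ T₂ (TensorProduct.tmul K v u) =
      indRep K h T₁ T₂ (SemidirectProduct.inr (blockSwap h h'))
        (IndV.mk (prodHom h) (boxRep K T₁ T₂) 1 (TensorProduct.tmul K u v)) := rfl

variable [CharZero K]

theorem swapBox_ne_zero (h : a + b = n) (h' : b + a = n) (T₁ : Fin a ≃ lam.cells)
    (T₂ : Fin b ≃ μ.cells) : swapBox (K := K) h h' T₁ T₂ ≠ 0 := by
  intro h0
  obtain ⟨u, hu⟩ := exists_ne (0 : TensorProduct K (YoungV K T₂) (YoungV K T₁))
  have h1 : swapBox (K := K) h h' T₁ T₂ u = 0 := by rw [h0]; rfl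
  apply hu
  have h2 : IndV.mk (prodHom h) (boxRep K T₁ T₂) 1
      (TensorProduct.comm K (YoungV K T₂) (YoungV K T₁) u) = 0 := by
    have h2' : indRep K h T₁ T₂ (SemidirectProduct.inr (blockSwap h h'))
        (IndV.mk (prodHom h) (boxRep K T₁ T₂) 1
          (TensorProduct.comm K (YoungV K T₂) (YoungV K T₁) u)) =
        indRep K h T₁ T₂ (SemidirectProduct.inr (blockSwap h h')) 0 :=
      Eq.trans h1 (map_zero (indRep K h T₁ T₂ (SemidirectProduct.inr (blockSwap h h')))).symm
    exact (apply_bijective (indRep K h T₁ T₂) (SemidirectProduct.inr (blockSwap h h'))).1 h2'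
  have h3 := indIncl_boxRep_injective (K := K) T₁ T₂ h (h2.trans (map_zero _).symm)
  exact (TensorProduct.comm K (YoungV K T₂) (YoungV K T₁)).injective (h3.trans (map_zero _).symm)

theorem character_indRep_swap (h : a + b = n) (h' : b + a = n) (T₁ : Fin a ≃ lam.cells)
    (T₂ : Fin b ≃ μ.cells) (g : HypOct n) : (indRep K h' T₂ T₁).character g =
      (signTwist (signProd n) (indRep K h T₁ T₂)).character g := by
  have := indRep_isIrreducible (K := K) T₂ T₁ h'
  have : (signTwist (signProd n) (indRep K h T₁ T₂)).IsIrreducible :=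
    isIrreducible_of_homDim_eq_one (by
      rw [homDim_signTwist, homDim_indRep, homDim_youngRep_self, homDim_youngRep_self])
  refine character_eq_of_isIrreducible (f := (indHomEquiv _ _ _).symm (swapBox h h' T₁ T₂)) ?_ g
  rw [Ne, LinearEquiv.map_eq_zero_iff]
  exact swapBox_ne_zero h h' T₁ T₂

/-- The bipartition with the two components exchanged. -/
@[simps] def Bipartition.swap (γ : Bipartition n) : Bipartition n :=
  ⟨γ.snd, γ.fst, by rw [add_comm, γ.card_add]⟩

/-- Multiplying by the linear character with kernel `W_n` exchanges the two components of the
label. -/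
theorem character_typeB_swap (γ : Bipartition n) (g : HypOct n) :
    (typeB K γ.swap).character g = (signTwist (signProd n) (typeB K γ)).character g :=
  character_indRep_swap γ.card_add γ.swap.card_add (someTableau γ.fst) (someTableau γ.snd) g

open Classical in
/-- A map over `W_n` is a sum of one over the type `B` group and one which changes by the linear
character with kernel `W_n`; twisting the target by that character exchanges the components of
its label. -/
theorem homDim_typeB_W (hn : 0 < n) {V : Type*} [AddCommGroup V] [Module K V] [FiniteDimensional K V]
    (ρ : Representation K (HypOct n) V) (γ : Bipartition n) :
    homDim (MonoidHom.comp ρ (W n).subtype) (MonoidHom.comp (typeB K γ) (W n).subtype) =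
      homDim ρ (typeB K γ) + homDim ρ (typeB K γ.swap) := by
  rw [homDim_ker (signProd n) (fun g => mem_W_iff) (signProd_flip ⟨0, hn⟩)]
  congr 1
  exact homDim_congr (fun _ => rfl) fun g => (character_typeB_swap γ g).symm

omit [CharZero K] in
/-- If the two components of `γ` agree, then `[γ]` becomes reducible on `W_n`: the map
`u ⊗ v ↦ w (v ⊗ u)`, where `w` exchanges the blocks, extends to an involution which commutes with
`W_n` and anticommutes with sign changes. -/
theorem exists_involution (T : Fin a ≃ μ.cells) (h : a + a = n) :
    ∃ Φ : Module.End K (IndV (prodHom h) (boxRep K T T)), (∀ v, Φ (Φ v) = v) ∧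
      ∀ g v, Φ (indRep K h T T g v) =
        (((signProd n g : ℤˣ) : ℤ) : K) • indRep K h T T g (Φ v) := by
  let F := (indHomEquiv _ _ _).symm (swapBox (K := K) h h T T)
  have hF : ∀ u, F (IndV.mk _ _ 1 u) = swapBox (K := K) h h T T u :=
    fun u => indHomEquiv_symm_mk_one _ _ _ _ u
  have hg : ∀ g v, F (indRep K h T T g v) =
      (((signProd n g : ℤˣ) : ℤ) : K) • indRep K h T T g (F v) :=
    fun g v => F.isIntertwining _ _ g v
  refine ⟨F.toLinearMap, ?_, hg⟩
  have h1 : F.toLinearMap ∘ₗ F.toLinearMap = LinearMap.id := by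
    apply IndV.hom_ext
    intro g
    apply TensorProduct.ext'
    intro u v
    change F (F (IndV.mk _ _ g (TensorProduct.tmul K u v))) = IndV.mk _ _ g (TensorProduct.tmul K u v)
    rw [indV_mk_eq, hg, hF, swapBox_tmul, map_smul, hg, hg, hF, swapBox_tmul, signProd_inr,
      ← Module.End.mul_apply (indRep K h T T (SemidirectProduct.inr _)), ← map_mul, ← map_mul,
      blockSwap_mul_self, map_one, map_one, smul_smul, intCast_units_mul_self]
    simp
  exact LinearMap.congr_fun h1

end TypeB

/-! ### The branching rule for type `B` -/

namespace HypOct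

variable {a b a' b' m n : ℕ}

/-- The sum of an embedding of the first blocks and one of the last blocks. -/
def blockEmb (h' : a' + b' = m) (h : a + b = n) (e₁ : Fin a' ↪ Fin a) (e₂ : Fin b' ↪ Fin b) :
    Fin m ↪ Fin n :=
  ((finCongr h').symm.trans finSumFinEquiv.symm).toEmbedding.trans
    ((e₁.sumMap e₂).trans (finSumFinEquiv.trans (finCongr h)).toEmbedding)

theorem blockEmb_fstEmb (h' : a' + b' = m) (h : a + b = n) (e₁ : Fin a' ↪ Fin a)
    (e₂ : Fin b' ↪ Fin b) :
    (fstEmb h').trans (blockEmb h' h e₁ e₂) = e₁.trans (fstEmb h) := by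
  subst h' h
  ext i
  simp [blockEmb, fstEmb]

theorem blockEmb_sndEmb (h' : a' + b' = m) (h : a + b = n) (e₁ : Fin a' ↪ Fin a)
    (e₂ : Fin b' ↪ Fin b) :
    (sndEmb h').trans (blockEmb h' h e₁ e₂) = e₂.trans (sndEmb h) := by
  subst h' h
  ext i
  simp [blockEmb, sndEmb]

theorem emb_blockEmb_prodHom (h' : a' + b' = m) (h : a + b = n) (e₁ : Fin a' ↪ Fin a)
    (e₂ : Fin b' ↪ Fin b) (x : HypOct a' × HypOct b') :
    emb (blockEmb h' h e₁ e₂) (prodHom h' x) = prodHom h ((emb e₁).prodMap (emb e₂) x) := by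
  obtain ⟨x, y⟩ := x
  rw [MonoidHom.prodMap_def, MonoidHom.prod_apply, prodHom_apply, map_mul, ← emb_trans, ← emb_trans,
    blockEmb_fstEmb, blockEmb_sndEmb, emb_trans, emb_trans]
  rfl

end HypOct

section TypeB

open Representation

variable {K : Type*} [Field K] [CharZero K] {a b a' b' m n : ℕ} {lam μ lam' μ' : YoungDiagram}

theorem homDim_boxRep_restrict (S₁ : Fin a' ≃ lam'.cells) (S₂ : Fin b' ≃ μ'.cells)
    (T₁ : Fin a ≃ lam.cells) (T₂ : Fin b ≃ μ.cells) (e₁ : Fin a' ↪ Fin a) (e₂ : Fin b' ↪ Fin b) :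
    homDim (boxRep K S₁ S₂) (MonoidHom.comp (boxRep K T₁ T₂) ((emb e₁).prodMap (emb e₂))) =
      homDim (youngRep K S₁) (MonoidHom.comp (youngRep K T₁) (Perm.viaEmbeddingHom e₁)) *
      homDim (youngRep K S₂) (MonoidHom.comp (youngRep K T₂) (Perm.viaEmbeddingHom e₂)) := by
  have h1 : homDim (boxRep K S₁ S₂)
      (MonoidHom.comp (boxRep K T₁ T₂) ((emb e₁).prodMap (emb e₂))) =
      homDim (boxRep K S₁ S₂) (boxTensor
        (MonoidHom.comp (MonoidHom.comp (youngRep K T₁) (Perm.viaEmbeddingHom e₁))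
          SemidirectProduct.rightHom)
        (signTwist (signProd b') (MonoidHom.comp
          (MonoidHom.comp (youngRep K T₂) (Perm.viaEmbeddingHom e₂))
          SemidirectProduct.rightHom))) := by
    refine homDim_congr (fun _ => rfl) ?_
    rintro ⟨x, y⟩
    rw [boxTensor, char_tensor, Pi.mul_apply]
    change (boxTensor _ _).character (emb e₁ x, emb e₂ y) = _
    rw [boxTensor, char_tensor, Pi.mul_apply]
    congr 1
    change (signTwist _ _).character (emb e₂ y) = (signTwist _ _).character y
    rw [character_signTwist, character_signTwist, signProd_emb]
    rfl
  rw [h1, boxRep, homDim_boxTensor, homDim_signTwist,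
    homDim_comp_surjective _ _ SemidirectProduct.rightHom_surjective,
    homDim_comp_surjective _ _ SemidirectProduct.rightHom_surjective]

/-- A constituent of the restriction of the inducing representation to smaller blocks spans, inside
the induced representation, an image of the representation induced from it. -/
theorem homDim_indRep_restrict_ne_zero (S₁ : Fin a' ≃ lam'.cells) (S₂ : Fin b' ≃ μ'.cells)
    (T₁ : Fin a ≃ lam.cells) (T₂ : Fin b ≃ μ.cells) (e₁ : Fin a' ↪ Fin a) (e₂ : Fin b' ↪ Fin b)
    (h' : a' + b' = m) (h : a + b = n) (f : Fin m ↪ Fin n)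
    (h₁ : homDim (youngRep K S₁) (MonoidHom.comp (youngRep K T₁) (Perm.viaEmbeddingHom e₁)) ≠ 0)
    (h₂ : homDim (youngRep K S₂) (MonoidHom.comp (youngRep K T₂) (Perm.viaEmbeddingHom e₂)) ≠ 0) :
    homDim (indRep K h' S₁ S₂) (MonoidHom.comp (indRep K h T₁ T₂) (emb f)) ≠ 0 := by
  rw [homDim_congr (ρ := indRep K h' S₁ S₂) (fun _ => rfl)
    (character_emb (indRep K h T₁ T₂) f (blockEmb h' h e₁ e₂)), homDim_ind]
  obtain ⟨θ, hθ⟩ := homDim_ne_zero_iff.mp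
    ((homDim_boxRep_restrict S₁ S₂ T₁ T₂ e₁ e₂).trans_ne (mul_ne_zero h₁ h₂))
  let I := indIncl (prodHom h) (boxRep K T₁ T₂)
  refine homDim_ne_zero_iff.mpr ⟨⟨I.toLinearMap ∘ₗ θ.toLinearMap, fun x => ?_⟩, ?_⟩
  · apply LinearMap.ext
    intro u
    change I (θ (boxRep K S₁ S₂ x u)) =
      indRep K h T₁ T₂ (emb (blockEmb h' h e₁ e₂) (prodHom h' x)) (I (θ u))
    rw [θ.isIntertwining, emb_blockEmb_prodHom]
    exact I.isIntertwining _ _ ((emb e₁).prodMap (emb e₂) x) (θ u)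
  · intro h0
    apply hθ
    apply IntertwiningMap.ext
    apply LinearMap.ext
    intro u
    apply indIncl_boxRep_injective T₁ T₂ h
    exact (DFunLike.congr_fun h0 u).trans (map_zero I).symm

omit [CharZero K] in
theorem homDim_youngRep_restrict_refl_ne_zero (T : Fin a ≃ μ.cells) :
    homDim (youngRep K T)
      (MonoidHom.comp (youngRep K T) (Perm.viaEmbeddingHom (Function.Embedding.refl _))) ≠ 0 := by
  have h1 : Perm.viaEmbeddingHom (Function.Embedding.refl (Fin a)) = MonoidHom.id _ := by
    ext σ i
    exact congrArg Fin.val (Perm.viaEmbedding_apply σ (Function.Embedding.refl _) i)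
  rw [h1]
  exact homDim_self_ne_zero (youngRep K T)

/-- The bipartitions obtained from `γ` by removing a box are indexed by the diagrams obtained from
the first or the second component of `γ` by removing a box. -/
abbrev Bipartition.DownIndex (γ : Bipartition n) : Type :=
  {ν // ν ∈ γ.fst.down} ⊕ {ν // ν ∈ γ.snd.down}

/-- The bipartition obtained from `γ` by removing a box. -/
def Bipartition.DownIndex.toBip {γ : Bipartition (m + 1)} : γ.DownIndex → Bipartition m
  | Sum.inl ν => ⟨ν.1, γ.snd, by
      have := (YoungDiagram.mem_down.mp ν.2).2; have := γ.card_add; omega⟩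
  | Sum.inr ν => ⟨γ.fst, ν.1, by
      have := (YoungDiagram.mem_down.mp ν.2).2; have := γ.card_add; omega⟩

open Bipartition.DownIndex

theorem toBip_injective (γ : Bipartition (m + 1)) :
    Function.Injective (toBip (γ := γ)) := by
  rintro (⟨ν, hν⟩ | ⟨ν, hν⟩) (⟨κ, hκ⟩ | ⟨κ, hκ⟩) h
  · have : ν = κ := congrArg Bipartition.fst h
    subst this; rfl
  · have : ν = γ.fst := congrArg Bipartition.fst h
    subst this
    have := (YoungDiagram.mem_down.mp hν).2
    omega
  · have : γ.fst = κ := congrArg Bipartition.fst h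
    subst this
    have := (YoungDiagram.mem_down.mp hκ).2
    omega
  · have : ν = κ := congrArg Bipartition.snd h
    subst this; rfl

theorem homDim_toBip_ne_zero {γ : Bipartition (m + 1)} (i : γ.DownIndex) (f : Fin m ↪ Fin (m + 1)) :
    homDim (typeB K i.toBip) (MonoidHom.comp (typeB K γ) (emb f)) ≠ 0 := by
  obtain ⟨ν, hν⟩ | ⟨ν, hν⟩ := i
  · have hc := (YoungDiagram.mem_down.mp hν).2
    let e₁ : Fin ν.card ↪ Fin γ.fst.card := Fin.castLEEmb (by omega)
    exact homDim_indRep_restrict_ne_zero (someTableau ν) (someTableau γ.snd) (someTableau γ.fst)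
      (someTableau γ.snd) e₁ (Function.Embedding.refl _) _ γ.card_add f
      (homDim_spechtRep_restrict_ne_zero hν _ _ _) (homDim_youngRep_restrict_refl_ne_zero _)
  · have hc := (YoungDiagram.mem_down.mp hν).2
    let e₂ : Fin ν.card ↪ Fin γ.snd.card := Fin.castLEEmb (by omega)
    exact homDim_indRep_restrict_ne_zero (someTableau γ.fst) (someTableau ν) (someTableau γ.fst)
      (someTableau γ.snd) (Function.Embedding.refl _) e₂ _ γ.card_add f
      (homDim_youngRep_restrict_refl_ne_zero _) (homDim_spechtRep_restrict_ne_zero hν _ _ _)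

variable (K)

/-- The dimension count behind the branching rule: both sides are `n! / (a! b!)` times products of
degrees of representations of symmetric groups, with `(a, b)` replaced by `(a - 1, b)` or
`(a, b - 1)` on the left. -/
theorem sum_finrank_toBip (γ : Bipartition (m + 1)) :
    ∑ i : γ.DownIndex, Module.finrank K (TypeBV K i.toBip) = Module.finrank K (TypeBV K γ) := by
  set F := fun μ : YoungDiagram => Module.finrank K (SpechtV K μ) with hF
  set a := γ.fst.card with ha
  set b := γ.snd.card with hb
  have hab : a + b = m + 1 := γ.card_add
  have hγ : a.factorial * b.factorial * Module.finrank K (TypeBV K γ) =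
    (m + 1).factorial * (F γ.fst * F γ.snd) := finrank_typeB γ
  -- Removing a box from either component.
  have h1 : a.factorial * b.factorial *
      ∑ ν : {ν // ν ∈ γ.fst.down}, Module.finrank K (TypeBV K (toBip (γ := γ) (Sum.inl ν))) =
      a * (m.factorial * (F γ.fst * F γ.snd)) := by
    have h2 : ∀ ν : {ν // ν ∈ γ.fst.down}, a.factorial * b.factorial *
        Module.finrank K (TypeBV K (toBip (γ := γ) (Sum.inl ν))) =
        a * (m.factorial * (F ν.1 * F γ.snd)) := by
      intro ν
      have hc := (YoungDiagram.mem_down.mp ν.2).2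
      have h3 : ν.1.card.factorial * b.factorial *
        Module.finrank K (TypeBV K (toBip (γ := γ) (Sum.inl ν))) =
          m.factorial * (F ν.1 * F γ.snd) := finrank_typeB (toBip (γ := γ) (Sum.inl ν))
      rw [ha, ← hc, Nat.factorial_succ, ← h3]
      ring
    rw [Finset.mul_sum, Finset.sum_congr rfl fun ν _ => h2 ν, ← Finset.mul_sum, ← Finset.mul_sum,
      ← Finset.sum_mul, Finset.sum_coe_sort γ.fst.down F]
    rcases Nat.eq_zero_or_pos a with h0 | h0
    · rw [h0, zero_mul, zero_mul]
    · rw [sum_down_finrank K (by omega)]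
  have h1' : a.factorial * b.factorial *
      ∑ ν : {ν // ν ∈ γ.snd.down}, Module.finrank K (TypeBV K (toBip (γ := γ) (Sum.inr ν))) =
      b * (m.factorial * (F γ.fst * F γ.snd)) := by
    have h2 : ∀ ν : {ν // ν ∈ γ.snd.down}, a.factorial * b.factorial *
        Module.finrank K (TypeBV K (toBip (γ := γ) (Sum.inr ν))) =
        b * (m.factorial * (F γ.fst * F ν.1)) := by
      intro ν
      have hc := (YoungDiagram.mem_down.mp ν.2).2
      have h3 : a.factorial * ν.1.card.factorial *
        Module.finrank K (TypeBV K (toBip (γ := γ) (Sum.inr ν))) =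
          m.factorial * (F γ.fst * F ν.1) := finrank_typeB (toBip (γ := γ) (Sum.inr ν))
      rw [hb, ← hc, Nat.factorial_succ, ← h3]
      ring
    rw [Finset.mul_sum, Finset.sum_congr rfl fun ν _ => h2 ν, ← Finset.mul_sum, ← Finset.mul_sum,
      ← Finset.mul_sum, Finset.sum_coe_sort γ.snd.down F]
    rcases Nat.eq_zero_or_pos b with h0 | h0
    · rw [h0, zero_mul, zero_mul]
    · rw [sum_down_finrank K (by omega)]
  apply Nat.eq_of_mul_eq_mul_left (show 0 < a.factorial * b.factorial by positivity)
  rw [Fintype.sum_sum_type, mul_add, h1, h1', hγ, ← add_mul, hab, Nat.factorial_succ, mul_assoc]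

variable {K}

/-- The branching rule for groups of type `B`, in terms of characters. -/
theorem character_typeB_emb (γ : Bipartition (m + 1)) (f : Fin m ↪ Fin (m + 1)) (g : HypOct m) :
    Representation.character (MonoidHom.comp (typeB K γ) (emb f)) g =
      ∑ i : γ.DownIndex, (typeB K i.toBip).character g := by
  classical
  exact (sum_finrank_le_and_character_eq (fun i : γ.DownIndex => typeB K i.toBip)
    (fun i => typeB_isIrreducible _)
    (fun i j hij => by rw [homDim_typeB, if_neg ((toBip_injective γ).ne hij)]) Finset.univ
    (MonoidHom.comp (typeB K γ) (emb f)) fun i _ => homDim_toBip_ne_zero i f).2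
    (sum_finrank_toBip K γ) g

open Classical in
/-- The branching rule for groups of type `B`. -/
theorem homDim_typeB_emb (γ : Bipartition (m + 1)) (β : Bipartition m) (f : Fin m ↪ Fin (m + 1)) :
    homDim (MonoidHom.comp (typeB K γ) (emb f)) (typeB K β) =
      if β ∈ Set.range (toBip (γ := γ)) then 1 else 0 := by
  rw [homDim_sum_left Finset.univ (fun i : γ.DownIndex => typeB K i.toBip) (typeB K β) _
    (character_typeB_emb γ f)]
  simp_rw [homDim_typeB]
  split_ifs with h
  · obtain ⟨i, rfl⟩ := h
    simp_rw [(toBip_injective γ).eq_iff]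
    simp
  · exact Finset.sum_eq_zero fun i _ => if_neg fun hi => h ⟨i, hi⟩

end TypeB

/-! ### Clifford theory for a subgroup of index two -/

namespace Representation

section Clifford

variable {K G : Type*} [Field K] [Group G] {V U : Type*} [AddCommGroup V] [Module K V]
  [AddCommGroup U] [Module K U] [FiniteDimensional K V] [FiniteDimensional K U]

omit [FiniteDimensional K U] in
/-- Clifford theory for a subgroup `N` of index two with complement generated by the involution `t`:
if an irreducible representation `σ` of the whole group properly contains an irreducible
representation `ρ` of `N`, then it restricts to the sum of `ρ` and its conjugate by `t`. -/
theorem character_add_character_conj {N : Subgroup G} {t : G} (ht : t * t = 1) {c : N →* N}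
    (hc : ∀ w, (c w : G) = t * w * t) (hN : ∀ g, g ∈ N ∨ t * g ∈ N) {ρ : Representation K N V}
    {σ : Representation K G U} [ρ.IsIrreducible] [σ.IsIrreducible]
    {f : IntertwiningMap ρ (MonoidHom.comp σ N.subtype)} (hf : f ≠ 0)
    (hf' : ¬Function.Surjective f) (w : N) :
    σ.character w = ρ.character w + ρ.character (c w) := by
  have hinj := (IsIrreducible.injective_or_eq_zero f).resolve_right hf
  have hfw : ∀ (w : N) x, f (ρ w x) = σ w (f x) := fun w x => f.isIntertwining _ _ w x
  have htt : ∀ v, σ t (σ t v) = v := fun v => by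
    rw [← Module.End.mul_apply, ← map_mul, ht, map_one, Module.End.one_apply]
  have htw : ∀ (w : N) v, σ w (σ t v) = σ t (σ (c w) v) := fun w v => by
    rw [hc, ← Module.End.mul_apply, ← Module.End.mul_apply, ← map_mul, ← map_mul, ← mul_assoc,
      ← mul_assoc, ht, one_mul]
  -- A subspace is stable under `G` as soon as it is stable under `N` and `t`.
  have hstab : ∀ p : Submodule K U, (∀ (w : N), ∀ v ∈ p, σ w v ∈ p) → (∀ v ∈ p, σ t v ∈ p) →
      p = ⊥ ∨ p = ⊤ := by
    intro p h1 h2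
    let P : Subrepresentation σ :=
      { toSubmodule := p
        apply_mem_toSubmodule := fun g v hv => by
          rcases hN g with hg | hg
          · exact h1 ⟨g, hg⟩ v hv
          · have h3 := h2 _ (h1 ⟨t * g, hg⟩ v hv)
            rwa [← Module.End.mul_apply, ← map_mul, ← mul_assoc, ht, one_mul] at h3 }
    exact (eq_bot_or_eq_top P).imp (congrArg Subrepresentation.toSubmodule)
      (congrArg Subrepresentation.toSubmodule)
  let R : Submodule K U := LinearMap.range f.toLinearMap
  have hRw : ∀ (w : N), ∀ v ∈ R, σ w v ∈ R := by
    rintro w _ ⟨x, rfl⟩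
    exact ⟨ρ w x, hfw w x⟩
  have hmeet : R ⊓ R.comap (σ t) = ⊥ := by
    refine (hstab _ ?_ ?_).resolve_right fun h => hf' fun v => ?_
    · rintro w v ⟨h1, h2⟩
      refine ⟨hRw w v h1, ?_⟩
      change σ t (σ w v) ∈ R
      have h3 := htw (c w) v
      have h4 : c (c w) = w := Subtype.ext (by
        rw [hc, hc, ← mul_assoc, ← mul_assoc, ht, one_mul, mul_assoc, ht, mul_one])
      rw [h4] at h3
      rw [← h3]
      exact hRw _ _ h2
    · rintro v ⟨h1, h2⟩
      refine ⟨h2, ?_⟩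
      change σ t (σ t v) ∈ R
      rwa [htt]
    · have : v ∈ R ⊓ R.comap (σ t) := h ▸ Submodule.mem_top
      exact this.1
  let F : IntertwiningMap (ρ.prod (MonoidHom.comp ρ c)) (MonoidHom.comp σ N.subtype) :=
    ⟨f.toLinearMap.coprod (σ t ∘ₗ f.toLinearMap), fun w => by
      apply LinearMap.ext
      rintro ⟨x, y⟩
      change f (ρ w x) + σ t (f (ρ (c w) y)) = σ w (f x + σ t (f y))
      rw [hfw, hfw, map_add, htw]⟩
  have hF : ∀ x y, F (x, y) = f x + σ t (f y) := fun _ _ => rfl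
  have hbij : Function.Bijective F := by
    constructor
    · refine (injective_iff_map_eq_zero F).mpr ?_
      rintro ⟨x, y⟩ h
      rw [hF] at h
      have h1 : f x ∈ R ⊓ R.comap (σ t) := by
        refine ⟨⟨x, rfl⟩, ?_⟩
        change σ t (f x) ∈ R
        rw [eq_neg_of_add_eq_zero_left h, map_neg, htt]
        exact R.neg_mem ⟨y, rfl⟩
      rw [hmeet, Submodule.mem_bot] at h1
      rw [h1, zero_add] at h
      have h2 : f y = 0 := by rw [← htt (f y), h, map_zero]
      rw [hinj (h1.trans (map_zero f).symm), hinj (h2.trans (map_zero f).symm)]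
      rfl
    · refine LinearMap.range_eq_top (f := F.toLinearMap).mp ?_
      refine (hstab _ ?_ ?_).resolve_left fun h => hf ?_
      · rintro w _ ⟨x, rfl⟩
        exact ⟨_, F.isIntertwining _ _ w x⟩
      · rintro _ ⟨⟨x, y⟩, rfl⟩
        refine ⟨(y, x), ?_⟩
        change f y + σ t (f x) = σ t (f x + σ t (f y))
        rw [map_add, htt, add_comm]
      · apply IntertwiningMap.ext
        apply LinearMap.ext
        intro x
        have h1 : F (x, 0) ∈ (⊥ : Submodule K U) := h ▸ ⟨(x, 0), rfl⟩
        rw [Submodule.mem_bot, hF, map_zero, map_zero, add_zero] at h1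
        exact h1
  change Representation.character (MonoidHom.comp σ N.subtype) w = _
  rw [← char_iso (IntertwiningMap.ofBijective F hbij), character_prod]
  rfl

omit [FiniteDimensional K V] [FiniteDimensional K U] in
/-- An involution which commutes with a subgroup `N` and anticommutes with some element forces the
restriction to `N` to be reducible. -/
theorem not_surjective_of_involution [CharZero K] [Nontrivial U] {N : Subgroup G} {t : G}
    {ρ : Representation K N V} {σ : Representation K G U} [ρ.IsIrreducible] (Φ : Module.End K U)
    (hΦ : ∀ v, Φ (Φ v) = v) (hN : ∀ (w : N) v, Φ (σ w v) = σ w (Φ v))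
    (ht : ∀ v, Φ (σ t v) = -σ t (Φ v))
    (f : IntertwiningMap ρ (MonoidHom.comp σ N.subtype)) : ¬Function.Surjective f := by
  intro hs
  have hfw : ∀ (w : N) x, f (ρ w x) = σ w (f x) := fun w x => f.isIntertwining _ _ w x
  let F : IntertwiningMap ρ (MonoidHom.comp σ N.subtype) :=
    ⟨(Φ - 1) ∘ₗ f.toLinearMap, fun w => by
      apply LinearMap.ext
      intro x
      change Φ (f (ρ w x)) - f (ρ w x) = σ w (Φ (f x) - f x)
      rw [hfw, hN, map_sub]⟩
  have hF : ∀ x, F x = Φ (f x) - f x := fun _ => rfl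
  -- As `(Φ - 1) (Φ + 1) = 0` and `Φ - 1` is injective or zero, `Φ` is a scalar.
  have hscalar : ∃ c : K, ∀ v, Φ v = c • v := by
    rcases IsIrreducible.injective_or_eq_zero F with h1 | h1
    · refine ⟨-1, fun v => ?_⟩
      obtain ⟨x, hx⟩ := hs (Φ v + v)
      have h2 : F x = 0 := by rw [hF, hx, map_add, hΦ]; abel
      have h3 : x = 0 := h1 (h2.trans (map_zero F).symm)
      rw [h3, map_zero] at hx
      rw [neg_one_smul]
      exact eq_neg_of_add_eq_zero_left hx.symm
    · refine ⟨1, fun v => ?_⟩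
      obtain ⟨x, rfl⟩ := hs v
      have h2 : F x = 0 := by rw [h1]; rfl
      rw [one_smul]
      exact sub_eq_zero.mp h2
  obtain ⟨c, hc⟩ := hscalar
  obtain ⟨v, hv⟩ := exists_ne (0 : U)
  apply hv
  have : IsAddTorsionFree U := IsAddTorsionFree.of_isTorsionFree K U
  have h1 := ht v
  rw [hc v, map_smul, ← hc, self_eq_neg, ← map_zero Φ] at h1
  have h2 := (Function.LeftInverse.injective hΦ) h1
  exact (apply_bijective σ t).1 (h2.trans (map_zero (σ t)).symm)

theorem mul_homDim_eq [CharZero K] [Finite G] {V₁ V₂ : Type*} [AddCommGroup V₁] [Module K V₁]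
    [AddCommGroup V₂] [Module K V₂] [FiniteDimensional K V₁] [FiniteDimensional K V₂]
    (ρ : Representation K G V) {σ : Representation K G U} {τ₁ : Representation K G V₁}
    {τ₂ : Representation K G V₂} {c : ℕ}
    (h : ∀ g, (c : K) * σ.character g = τ₁.character g + τ₂.character g) :
    c * homDim ρ σ = homDim ρ τ₁ + homDim ρ τ₂ := by
  cases nonempty_fintype G
  apply Nat.cast_injective (R := K)
  rw [Nat.cast_add, Nat.cast_mul, ← card_inv_mul_sum_char, ← card_inv_mul_sum_char,
    ← card_inv_mul_sum_char, ← mul_add, mul_left_comm, Finset.mul_sum, ← Finset.sum_add_distrib]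
  simp_rw [← mul_assoc, h, add_mul]

end Clifford

end Representation

/-! ### The branching rule for type `D` -/

namespace HypOct

variable {m n : ℕ}

/-- Conjugation by the sign change at `i`, as an endomorphism of `W_n`. -/
def conjFlip (i : Fin n) : W n →* W n where
  toFun w := ⟨flip i * w * flip i, flip_conj_mem_W i w.2⟩
  map_one' := Subtype.ext (by simp [flip_mul_self])
  map_mul' v w := Subtype.ext (by
    change flip i * (v * w) * flip i = flip i * v * flip i * (flip i * w * flip i)
    simp only [mul_assoc]
    rw [← mul_assoc (flip i) (flip i) (w * flip i), flip_mul_self, one_mul])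

theorem conjFlip_coe (i : Fin n) (w : W n) :
    (conjFlip i w : HypOct n) = flip i * w * flip i := rfl

theorem conjFlip_conjFlip (i : Fin n) (w : W n) : conjFlip i (conjFlip i w) = w :=
  Subtype.ext (by
    rw [conjFlip_coe, conjFlip_coe, ← mul_assoc, ← mul_assoc, flip_mul_self, one_mul, mul_assoc,
      flip_mul_self, mul_one])

/-- The restriction of `emb f` to groups of type `D`. -/
noncomputable def embW (f : Fin m ↪ Fin n) : W m →* W n :=
  ((emb f).comp (W m).subtype).codRestrict (W n) fun w => emb_mem_W f w.2

theorem conjFlip_embW (f : Fin m ↪ Fin n) {i : Fin n} (hi : i ∉ Set.range f) (w : W m) :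
    conjFlip i (embW f w) = embW f w :=
  Subtype.ext (by
    rw [conjFlip_coe, show flip i * (embW f w : HypOct n) = embW f w * flip i from flip_commute_emb f hi w, mul_assoc,
      flip_mul_self, mul_one])

end HypOct

section TypeD

open Representation

variable {K : Type*} [Field K] {m n : ℕ} {V U : Type*} [AddCommGroup V] [Module K V]
  [AddCommGroup U] [Module K U]

theorem IsLabelledBy.finiteDimensional {X : Representation K (W n) V} {γ : Bipartition n}
    (hX : IsLabelledBy X γ) : FiniteDimensional K V := by
  have := hX.1
  obtain ⟨f, hf⟩ := hX.2
  exact Module.Finite.of_injective f.toLinearMap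
    ((IsIrreducible.injective_or_eq_zero f).resolve_right hf)

variable [CharZero K]

instance (γ : Bipartition n) : Nontrivial (TypeBV K γ) := by
  obtain ⟨u, hu⟩ := exists_ne (0 : TensorProduct K (YoungV K (someTableau γ.fst))
    (YoungV K (someTableau γ.snd)))
  exact ⟨_, _, (indIncl_boxRep_injective _ _ γ.card_add).ne hu⟩

omit [CharZero K] in
/-- `exists_involution` for two tableaux which are only propositionally equal. -/
theorem exists_involution_of_heq {lam μ : YoungDiagram} {a b : ℕ} (h : a + b = n)
    {T₁ : Fin a ≃ lam.cells} {T₂ : Fin b ≃ μ.cells} (hab : a = b) (hμ : lam = μ) (hT : T₁ ≍ T₂) :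
    ∃ Φ : Module.End K (IndV (prodHom h) (boxRep K T₁ T₂)), (∀ v, Φ (Φ v) = v) ∧
      ∀ g v, Φ (indRep K h T₁ T₂ g v) =
        (((signProd n g : ℤˣ) : ℤ) : K) • indRep K h T₁ T₂ g (Φ v) := by
  subst hab hμ
  obtain rfl := eq_of_heq hT
  exact exists_involution T₁ h

omit [CharZero K] in
theorem exists_involution_typeB {γ : Bipartition n} (hγ : γ.fst = γ.snd) :
    ∃ Φ : Module.End K (TypeBV K γ), (∀ v, Φ (Φ v) = v) ∧
      ∀ g v, Φ (typeB K γ g v) = (((signProd n g : ℤˣ) : ℤ) : K) • typeB K γ g (Φ v) :=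
  exists_involution_of_heq γ.card_add (congrArg YoungDiagram.card hγ) hγ (by rw [hγ])

theorem not_surjective_of_fst_eq_snd {X : Representation K (W n) V} {γ : Bipartition n}
    (hn : 0 < n) (hγ : γ.fst = γ.snd) [X.IsIrreducible]
    (f : IntertwiningMap X (MonoidHom.comp (typeB K γ) (W n).subtype)) :
    ¬Function.Surjective f := by
  obtain ⟨Φ, hΦ, hΦg⟩ := exists_involution_typeB (K := K) hγ
  refine not_surjective_of_involution Φ hΦ (fun w v => ?_) (t := HypOct.flip ⟨0, hn⟩)
    (fun v => ?_) f
  · rw [hΦg, mem_W_iff.mp w.2, Units.val_one, Int.cast_one, one_smul]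
  · rw [hΦg, signProd_flip, Units.val_neg, Units.val_one, Int.cast_neg, Int.cast_one, neg_one_smul]

theorem Bipartition.swap_eq_self_iff {γ : Bipartition n} : γ.swap = γ ↔ γ.fst = γ.snd :=
  ⟨fun h => (congrArg Bipartition.snd h), fun h => Bipartition.ext h.symm h⟩

open Classical in
/-- Twice the character of `[γ]` on `W_n` divided by the number of its constituents is the sum of
any constituent and its conjugate under a sign change. -/
theorem IsLabelledBy.mul_character {X : Representation K (W n) V} {γ : Bipartition n}
    (hX : IsLabelledBy X γ) (i : Fin n) (w : W n) :
    ((if γ.fst = γ.snd then 1 else 2 : ℕ) : K) *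
        Representation.character (MonoidHom.comp (typeB K γ) (W n).subtype) w =
      X.character w + Representation.character (MonoidHom.comp X (conjFlip i)) w := by
  have hn := i.pos
  have := hX.1
  have := hX.finiteDimensional
  obtain ⟨f, hf⟩ := hX.2
  split_ifs with h
  · rw [Nat.cast_one, one_mul]
    exact character_add_character_conj (flip_mul_self i) (conjFlip_coe i)
      (mem_W_or_flip_mul_mem_W i) hf (not_surjective_of_fst_eq_snd hn h f) w
  · have : IsIrreducible (MonoidHom.comp (typeB K γ) (W n).subtype) :=
      isIrreducible_of_homDim_eq_one (by
        rw [homDim_typeB_W hn, homDim_typeB, homDim_typeB, if_pos rfl,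
          if_neg fun h' => h (Bipartition.swap_eq_self_iff.mp h'.symm)])
    have h1 := character_eq_of_isIrreducible hf
    change _ = X.character w + X.character (conjFlip i w)
    rw [h1, h1]
    change _ = _ + (typeB K γ).character (HypOct.flip i * w * HypOct.flip i)
    have h2 : HypOct.flip i * (w : HypOct n) * HypOct.flip i =
        HypOct.flip i * w * (HypOct.flip i)⁻¹ := by rw [flip_inv]
    rw [h2, char_conj, Nat.cast_two, two_mul]
    rfl

open Classical in
/-- Conjugate constituents agree on the image of `emb f`, as the sign change at a point outside the
range of `f` centralizes it. -/
theorem IsLabelledBy.mul_homDim_emb {X : Representation K (W n) V} {γ : Bipartition n}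
    (hX : IsLabelledBy X γ) (f : Fin m ↪ Fin n) {i : Fin n} (hi : i ∉ Set.range f)
    [FiniteDimensional K V] [FiniteDimensional K U] (Y : Representation K (W m) U) :
    (if γ.fst = γ.snd then 1 else 2) *
        homDim (MonoidHom.comp (MonoidHom.comp (typeB K γ) (emb f)) (W m).subtype) Y =
      2 * homDim (MonoidHom.comp X (embW f)) Y := by
  rw [homDim_comm, homDim_comm _ Y, two_mul]
  refine mul_homDim_eq Y fun w => (hX.mul_character i (embW f w)).trans ?_
  congr 1
  change X.character (conjFlip i (embW f w)) = _
  rw [conjFlip_embW f hi]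
  rfl

open Classical in
/-- Conjugate constituents have the same multiplicity in a representation which extends to the type
`B` group. -/
theorem IsLabelledBy.mul_homDim_subtype {B : Representation K (W n) V} {β : Bipartition n}
    (hB : IsLabelledBy B β) (hn : 0 < n) [FiniteDimensional K V] [FiniteDimensional K U]
    (Y : Representation K (HypOct n) U) :
    (if β.fst = β.snd then 1 else 2) *
        homDim (MonoidHom.comp Y (W n).subtype) (MonoidHom.comp (typeB K β) (W n).subtype) =
      2 * homDim (MonoidHom.comp Y (W n).subtype) B := by
  let i : Fin n := ⟨0, hn⟩
  rw [mul_homDim_eq _ (hB.mul_character i), two_mul]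
  congr 1
  -- `Y` extends to the type `B` group and so is invariant under conjugation.
  have h1 : ∀ w : W n, Representation.character (MonoidHom.comp Y (W n).subtype) w =
      Representation.character
        (MonoidHom.comp (MonoidHom.comp Y (W n).subtype) (conjFlip i)) w := by
    intro w
    change Y.character w = Y.character (HypOct.flip i * w * HypOct.flip i)
    have h2 : HypOct.flip i * (w : HypOct n) * HypOct.flip i =
        HypOct.flip i * w * (HypOct.flip i)⁻¹ := by rw [flip_inv]
    rw [h2, char_conj]
  rw [homDim_congr h1 (σ' := MonoidHom.comp B (conjFlip i)) fun _ => rfl]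
  exact homDim_comp_surjective _ _ fun w => ⟨_, conjFlip_conjFlip i w⟩

theorem Bipartition.mem_range_toBip {γ : Bipartition (m + 1)} {β : Bipartition m} :
    β ∈ Set.range (DownIndex.toBip (γ := γ)) ↔
      (β.fst ∈ γ.fst.down ∧ β.snd = γ.snd) ∨ (β.fst = γ.fst ∧ β.snd ∈ γ.snd.down) := by
  constructor
  · rintro ⟨⟨ν, hν⟩ | ⟨ν, hν⟩, rfl⟩
    · exact Or.inl ⟨hν, rfl⟩
    · exact Or.inr ⟨rfl, hν⟩
  · rintro (⟨h1, h2⟩ | ⟨h1, h2⟩)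
    · exact ⟨Sum.inl ⟨_, h1⟩, Bipartition.ext rfl h2.symm⟩
    · exact ⟨Sum.inr ⟨_, h2⟩, Bipartition.ext h1.symm rfl⟩

theorem Bipartition.mem_Z_iff {γ : Bipartition (m + 1)} {β : Bipartition m} :
    β ∈ γ.Z ↔ β ∈ Set.range (DownIndex.toBip (γ := γ)) ∨
      β.swap ∈ Set.range (DownIndex.toBip (γ := γ)) := by
  simp only [mem_range_toBip, YoungDiagram.mem_down_iff_exists_removeBox, swap_fst, swap_snd, Z,
    Set.mem_ofPred_eq]
  constructor
  · rintro (⟨d, hd, ⟨h1, h2⟩ | ⟨h1, h2⟩⟩ | ⟨d, hd, ⟨h1, h2⟩ | ⟨h1, h2⟩⟩)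
    · exact Or.inl (Or.inl ⟨⟨d, hd, h1⟩, h2⟩)
    · exact Or.inr (Or.inl ⟨⟨d, hd, h2⟩, h1⟩)
    · exact Or.inl (Or.inr ⟨h1, ⟨d, hd, h2⟩⟩)
    · exact Or.inr (Or.inr ⟨h2, ⟨d, hd, h1⟩⟩)
  · rintro ((⟨⟨d, hd, h1⟩, h2⟩ | ⟨h1, ⟨d, hd, h2⟩⟩) | (⟨⟨d, hd, h1⟩, h2⟩ | ⟨h1, ⟨d, hd, h2⟩⟩))
    · exact Or.inl ⟨d, hd, Or.inl ⟨h1, h2⟩⟩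
    · exact Or.inr ⟨d, hd, Or.inl ⟨h1, h2⟩⟩
    · exact Or.inl ⟨d, hd, Or.inr ⟨h2, h1⟩⟩
    · exact Or.inr ⟨d, hd, Or.inr ⟨h2, h1⟩⟩

open Classical in
/-- The numerical content of the passage from type `B` to type `D`: the four combinations of equal
and unequal components in `γ` and `β`. -/
theorem Bipartition.mul_ite_add_ite (γ : Bipartition (m + 1)) (β : Bipartition m) :
    (if γ.fst = γ.snd then 1 else 2) * ((if β.fst = β.snd then 1 else 2) *
      ((if β ∈ Set.range (DownIndex.toBip (γ := γ)) then 1 else 0) +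
        if β.swap ∈ Set.range (DownIndex.toBip (γ := γ)) then 1 else 0)) =
      4 * if β ∈ γ.Z then 1 else 0 := by
  have hcard : ∀ {ν μ : YoungDiagram}, ν ∈ μ.down → ν ≠ μ := fun h h' => by
    subst h'; have := (YoungDiagram.mem_down.mp h).2; omega
  by_cases hγ : γ.fst = γ.snd
  · have h1 : β.swap ∈ Set.range (DownIndex.toBip (γ := γ)) ↔
        β ∈ Set.range (DownIndex.toBip (γ := γ)) := by
      rw [mem_range_toBip, mem_range_toBip, hγ, swap_fst, swap_snd]
      tauto
    have h2 : β ∈ Set.range (DownIndex.toBip (γ := γ)) → β.fst ≠ β.snd := by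
      rw [mem_range_toBip, hγ]
      rintro (⟨h, h'⟩ | ⟨h, h'⟩)
      · rw [h']; exact hcard h
      · rw [h]; exact (hcard h').symm
    simp only [mem_Z_iff, h1, or_self, if_pos hγ]
    by_cases h : β ∈ Set.range (DownIndex.toBip (γ := γ))
    · rw [if_neg (h2 h), if_pos h]
    · rw [if_neg h]; simp
  · rw [if_neg hγ, mem_Z_iff]
    by_cases hβ : β.fst = β.snd
    · rw [swap_eq_self_iff.mpr hβ, or_self, if_pos hβ]
      split_ifs <;> rfl
    · rw [if_neg hβ]
      have h1 : β ∈ Set.range (DownIndex.toBip (γ := γ)) →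
          β.swap ∉ Set.range (DownIndex.toBip (γ := γ)) := by
        rw [mem_range_toBip, mem_range_toBip, swap_fst, swap_snd]
        rintro (⟨h, h'⟩ | ⟨h, h'⟩) (⟨k, k'⟩ | ⟨k, k'⟩)
        · exact hβ (k'.trans h'.symm)
        · exact hγ (k.symm.trans h')
        · exact hγ (h.symm.trans k')
        · exact hβ (h.trans k.symm)
      by_cases h : β ∈ Set.range (DownIndex.toBip (γ := γ))
      · rw [if_pos h, if_neg (h1 h), if_pos (Or.inl h)]
      · by_cases h' : β.swap ∈ Set.range (DownIndex.toBip (γ := γ))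
        · rw [if_neg h, if_pos h', if_pos (Or.inr h')]
        · rw [if_neg h, if_neg h', if_neg (by tauto)]

open Classical in
/-- The branching rule for groups of type `D`, along any injection of the points. -/
theorem homDim_comp_embW (hm : 0 < m) {γ : Bipartition (m + 1)} {β : Bipartition m}
    {X : Representation K (W (m + 1)) V} (hX : IsLabelledBy X γ) {B : Representation K (W m) U}
    (hB : IsLabelledBy B β) (f : Fin m ↪ Fin (m + 1)) :
    homDim (MonoidHom.comp X (embW f)) B = if β ∈ γ.Z then 1 else 0 := by
  have := hX.finiteDimensional
  have := hB.finiteDimensional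
  -- `f` misses a point.
  obtain ⟨i, hi⟩ : ∃ i, i ∉ Set.range f := by
    by_contra! h
    have := Fintype.card_le_of_surjective f h
    simp at this
  have h1 := hX.mul_homDim_emb f hi B
  have h2 := hB.mul_homDim_subtype hm (MonoidHom.comp (typeB K γ) (emb f))
  rw [homDim_typeB_W hm, homDim_typeB_emb, homDim_typeB_emb] at h2
  have h3 := Bipartition.mul_ite_add_ite γ β
  rw [h2, mul_left_comm, h1] at h3
  omega

theorem finrank_intertwiningMap_inclusion (hm : 0 < m) {γ : Bipartition (m + 1)} {β : Bipartition m}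
    {X : Representation K (W (m + 1)) V} (hX : IsLabelledBy X γ) {H : Subgroup (HypOct (m + 1))}
    (hH : H ≤ W (m + 1)) (f : Fin m ↪ Fin (m + 1)) (φ : W m ≃* H)
    (hφ : ∀ w, (φ w : HypOct (m + 1)) = emb f w) {B : Representation K H U}
    (hB : IsLabelledBy (MonoidHom.comp B φ.toMonoidHom) β) :
    (β ∈ γ.Z → Module.finrank K
      (IntertwiningMap (MonoidHom.comp X (Subgroup.inclusion hH)) B) = 1) ∧
    (β ∉ γ.Z → Module.finrank K
      (IntertwiningMap (MonoidHom.comp X (Subgroup.inclusion hH)) B) = 0) := by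
  classical
  have h1 : (Subgroup.inclusion hH).comp φ.toMonoidHom = embW f :=
    MonoidHom.ext fun w => Subtype.ext (hφ w)
  have h2 : homDim (MonoidHom.comp X (Subgroup.inclusion hH)) B = if β ∈ γ.Z then 1 else 0 := by
    rw [← homDim_comp_embW hm hX hB f, ← h1]
    exact (homDim_comp_surjective (φ := φ.toMonoidHom) _ _ φ.surjective).symm
  exact ⟨fun h => h2.trans (if_pos h), fun h => h2.trans (if_neg h)⟩

end TypeD

theorem mainTheorem2 {K : Type*} [Field K] [CharZero K] {m : ℕ} (hn : 4 ≤ m + 1)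
    (γ : Bipartition (m + 1)) (β : Bipartition m)
    {V U : Type*} [AddCommGroup V] [Module K V] [AddCommGroup U] [Module K U]
    (X : Representation K (W (m + 1)) V) (hX : IsLabelledBy X γ) :
    (∀ B : Representation K (WOneW (m + 1)) U,
      IsLabelledBy (B.comp (isoWOneW (m := m) (by omega)).toMonoidHom) β →
        (β ∈ γ.Z → Module.finrank K (Representation.IntertwiningMap
          (X.comp (Subgroup.inclusion (WOneW_le_W (n := m + 1)))) B) = 1) ∧
        (β ∉ γ.Z → Module.finrank K (Representation.IntertwiningMap
          (X.comp (Subgroup.inclusion (WOneW_le_W (n := m + 1)))) B) = 0)) ∧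
    (∀ B : Representation K (WWOne (m + 1)) U,
      IsLabelledBy (B.comp (isoWWOne (m := m) (by omega)).toMonoidHom) β →
        (β ∈ γ.Z → Module.finrank K (Representation.IntertwiningMap
          (X.comp (Subgroup.inclusion (WWOne_le_W (n := m + 1) (by omega)))) B) = 1) ∧
        (β ∉ γ.Z → Module.finrank K (Representation.IntertwiningMap
          (X.comp (Subgroup.inclusion (WWOne_le_W (n := m + 1) (by omega)))) B) = 0)) := by
  have hm : 0 < m := by omega
  exact ⟨fun B hB => finrank_intertwiningMap_inclusion hm hX _ (Fin.succEmb m) _ (fun _ => rfl) hB,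
    fun B hB => finrank_intertwiningMap_inclusion hm hX _ (revEmb m) _ (fun _ => rfl) hB⟩
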